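/- **Setting.** Let $V$ be a real vector space with basis $e_1,\dots,e_d$; for a word $w=(i_1,\dots,i_m)\in[d]^*=\bigcup_{m\ge 0}[d]^m$ put $e_w=e_{i_1}\otimes\dots\otimes e_{i_m}$, and let $\langle\cdot,\cdot\rangle$ be the coordinate pairing of $T(V)=\bigoplus_m V^{\otimes m}$ with $T((V))=\prod_m V^{\otimes m}$. Fix $p\ge 1$, $T>0$. Let $\mathcal G_p^w(V)$ be the set of weakly geometric $p$-rough paths $\mathbf x:[0,T]^2\to T((V))$: for $s<t<u$, $\langle \mathbf x_{s,t},e_\emptyset\rangle=1$, $\langle\mathbf x_{s,t},f⧢g\rangle=\langle\mathbf x_{s,t},f\rangle\langle\mathbf x_{s,t},g\rangle$ ($⧢$ the shuffle product), $\mathbf x_{s,t}\otimes\mathbf x_{t,u}=\mathbf x_{s,u}$, and for each integer $1\le m\le p$ the level-$m$ parts satisfy $\sup\sum_i|\mathbf x^m_{t_i,t_{i+1}}|^{p/m}<\infty$ over dissections of $[0,T]$. Write $\langle\mathbf x,e_w\rangle:=\langle\mathbf x_{0,T},e_w\rangle$, and equip $\mathcal G_p^w(V)$ with any $\sigma$-algebra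 making all maps $\mathbf x\mapsto\langle\mathbf x,e_w\rangle$ measurable. For a random $\mathbf X$ in $\mathcal G^w_p(V)$ with $\mathbb E|\langle\mathbf X,e_w\rangle|<\infty$ for all $w$, let $\kappa_{\mathbf X}=\log\mathbb E[\mathbf X_{0,T}]\in T((V))$. **Ordered partitions.** For a finite poset $P$, $\mathrm{Orp}(P)$ is the set of partitions $\mathbf a=\ker f$ ($\ker f$ being the partition into nonempty fibres) with $f:P\to\mathbb N$ order-preserving, ordered by refinement ($\mathbf a\le\mathbf b$ if $\mathbf a$ is finer); $|\mathbf a|$ is the number of blocks, $\mathbf a!$ is the number of order-preserving $f:P\to\{1,\dots,|\mathbf a|\}$ with $\ker f=\mathbf a$, $\mathbf a\cap C=\{a\cap C: a\in\mathbf a\}\setminus\{\emptyset\}$, and $$\mathcal A(\mathbf a)=\{\mathbf b\in \mathrm{Orp}(P):\mathbf b\ge\mathbf a,\ \mathbf b\cap C=\mathbf a\cap C\text{ for every chain }C\subseteq P\},\qquad \partial(\mathbf a)=\sum_{\mathbf b\in\mathcal A(\mathbf a)}(-1)^{|\mathbf b|-1}\frac{\mathbf b!}{|\mathbf b|}.$$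 For a tuple $\tau=(\tau_1,\dots,\tau_k)$ of words, $\mathrm{Orp}(\tau)$ refers to the disjoint union $P_\tau$ of $k$ mutually incomparable chains, the $j$-th consisting of the letters of $\tau_j$ (letters in different positions are distinct); put $N_\tau=\sum_j|\tau_j|$. For a block $a$ of a partition, $a^j$ is the subword of $\tau_j$ formed by the letters in $a$; below, products and cumulants over $j$ run over the nonempty $a^j$ only. **Estimator.** For samples $\mathbf X_1,\dots,\mathbf X_n$, with $(n)_l=n(n-1)\cdots(n-l+1)$ and $\mathbf a=\{a_1,\dots,a_l\}$, $$\hat\mu_n(\mathbf a)=\frac1{(n)_l}\sum_{i_1,\dots,i_l\in[n]\text{ distinct}}\ \prod_{r=1}^{l}\prod_j\langle\mathbf X_{i_r},e_{a_r^j}\rangle,\qquad \hat\kappa_n(\tau)=\sum_{\mathbf a\in\mathrm{Orp}(\tau)}(-1)^{|\mathbf a|-1}\frac{\mathbf a!}{|\mathbf a|}\,\hat\mu_n(\mathbf a).$$ (If $N_\tau=0$, set $\hat\kappa_n(\tau)=0$.) **Covariance.** For a partition $\mathbf b$ of $P_\tau$ with blocks $b_i$, let $\kappa_{\mathbf X}(\mathbf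 b)=\prod_i\kappa\big((\langle\mathbf X,e_{b_i^j}\rangle)_j\big)$, a product of classical joint cumulants. For tuples $\tau,\sigma$, $\mathbf a_1\in\mathrm{Orp}(\tau)$, $\mathbf a_2\in\mathrm{Orp}(\sigma)$, let $V(\mathbf a_1,\mathbf a_2)$ be the set of partitions $\mathbf c$ of $P_\tau\sqcup P_\sigma$ with $\mathbf c\cap P_\tau=\mathbf a_1$, $\mathbf c\cap P_\sigma=\mathbf a_2$, $|\mathbf c|=|\mathbf a_1|+|\mathbf a_2|-1$, and set $$\mathcal V(\mathbf a_1,\mathbf a_2)=\sum_{\mathbf c\in V(\mathbf a_1,\mathbf a_2)}\ \sum_{\mathbf b}\kappa_{\mathbf X}(\mathbf b),$$ where $\mathbf b$ runs over the partitions of $P_\tau\sqcup P_\sigma$ with $\mathbf b\le\mathbf c$, with $\mathbf b\cap C=\mathbf c\cap C$ for every chain $C$ (letters of one word that share a block of $\mathbf c$ stay together), such that no block of $\mathbf b$ is a proper subset of a block of $\mathbf a_1$ or $\mathbf a_2$, and $\mathbf b\ne\mathbf a_1\cup\mathbf a_2$. **Proposition 4.2.** Let $\mathbf X_1,\mathbf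 X_2,\dots$ be i.i.d. copies of a $\mathcal G_p^w(V)$-valued random variable $\mathbf X$ with $\mathbb E|\langle\mathbf X,e_w\rangle|<\infty$ for every $w\in[d]^*$. For every tuple $\tau=(\tau_1,\dots,\tau_k)$ of words, with $\theta_\tau(\mathbf X):=\langle\kappa_{\mathbf X},e_{\tau_1}⧢\cdots⧢e_{\tau_k}\rangle$: 1. $\mathbb E\,\hat\kappa_n(\tau)=\theta_\tau(\mathbf X)$ for all $n\ge N_\tau$. 2. For $n\ge N_\tau$, $\hat\kappa_n(\tau)$ has minimum variance among the unbiased polynomial estimators of $\theta_\tau$. Here a polynomial estimator is a polynomial $g$ in the coordinates $\langle\mathbf X_i,e_w\rangle$, $i\in[n]$, $w\in[d]^*$, and it is unbiased if $\mathbb E\,g(\mathbf Y_1,\dots,\mathbf Y_n)=\theta_\tau(\mathbf Y)$ for i.i.d. copies $\mathbf Y_1,\dots,\mathbf Y_n$ of $\mathbf Y$, for every law of $\mathbf Y$ on $\mathcal G_p^w(V)$ with $\mathbb E|\langle\mathbf Y,e_w\rangle|<\infty$ for all $w$. That is, $\hat\kappa_n(\tau)$ is such an estimator and $\operatorname{Var}\hat\kappa_n(\tau)\le\operatorname{Var}g(\mathbf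 X_1,\dots,\mathbf X_n)<\infty$ for every such $g$. 3. $\hat\kappa_n(\tau)\to\theta_\tau(\mathbf X)$ as $n\to\infty$ almost surely and in $L^q$ for every $q\in[1,\infty)$. 4. For every finite family $(\tau^{(s)})_{s\in S}$ of tuples of words, the matrix with entries $\mathcal V(\tau^{(s)},\tau^{(t)})$, where $$\mathcal V(\tau,\sigma)=\sum_{\mathbf a_1\in\mathrm{Orp}(\tau)}\ \sum_{\mathbf a_2\in\mathrm{Orp}(\sigma)}\partial(\mathbf a_1)\,\partial(\mathbf a_2)\,\mathcal V(\mathbf a_1,\mathbf a_2),$$ is positive semidefinite, and $\sqrt n\,\big(\hat\kappa_n(\tau^{(s)})-\theta_{\tau^{(s)}}(\mathbf X)\big)_{s\in S}$ converges in distribution to the centred Gaussian law with this covariance matrix. -/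

import Mathlib

open MeasureTheory ProbabilityTheory Filter Topology

noncomputable section

namespace SigPolykay

/-! ### Words, tensor series, tensor polynomials -/

/-- Tuples `τ ∈ [d]^*`; the word `w` stands for the basis tensor `e_w`. -/
abbrev Word (d : ℕ) : Type := List (Fin d)

/-- The extended tensor algebra `T((V)) = ∏ₘ V^{⊗m}` of a `d`-dimensional space `V` with
basis `e_1, …, e_d`: a tensor series is given by its coordinates `t_w`. -/
abbrev TensorSeries (d : ℕ) : Type := Word d → ℝ

/-- The tensor algebra `T(V) = ⨁ₘ V^{⊗m}`: finite linear combinations of the `e_w`. -/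
abbrev TensorPoly (d : ℕ) : Type := Word d →₀ ℝ

variable {d : ℕ}

/-- The pairing `⟨f, t⟩ = ∑_w f_w t_w` of `T(V)` with `T((V))`. -/
def pairing (f : TensorPoly d) (t : TensorSeries d) : ℝ := f.sum fun w r => r * t w

/-- The unit `1 = e_∅` of `T((V))`. -/
def tensorOne : TensorSeries d := fun w => if w = [] then 1 else 0

/-- The tensor product of series: the coordinate at `w` sums over all splittings `w = uv`. -/
def tensorMul (x y : TensorSeries d) : TensorSeries d :=
  fun w => ∑ i ∈ Finset.range (w.length + 1), x (w.take i) * y (w.drop i)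

/-- Tensor powers `x^{⊗n}`. -/
def tensorPow (x : TensorSeries d) : ℕ → TensorSeries d
  | 0 => tensorOne
  | n + 1 => tensorMul x (tensorPow x n)

/-- If `x` has no constant term then `x^{⊗n}` has no coordinates at words shorter than `n`. -/
theorem tensorPow_eq_zero (x : TensorSeries d) (hx : x [] = 0) (n : ℕ) (w : Word d)
    (h : w.length < n) : tensorPow x n w = 0 := by
  induction n generalizing w with
  | zero => omega
  | succ n ih =>
    simp only [tensorPow, tensorMul]
    refine Finset.sum_eq_zero fun i _ => ?_
    rcases Nat.eq_zero_or_pos i with rfl | hpos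
    · simp [hx]
    · rcases w with _ | ⟨a, w⟩
      · simp [hx]
      · rw [ih _ (by simp at h ⊢; omega), mul_zero]

/-- The logarithm `log x = ∑_{n ≥ 1} (-1)^{n-1}/n (x - 1)^{⊗n}` of a tensor series with constant
term `1`. At the word `w` all terms with `n > |w|` vanish (`tensorPow_eq_zero`), so the series is
written as the finite sum over `1 ≤ n ≤ |w|`. -/
def tensorLog (x : TensorSeries d) : TensorSeries d :=
  fun w => ∑ n ∈ Finset.Icc 1 w.length, (-1 : ℝ) ^ (n - 1) / n * tensorPow (x - tensorOne) n w

/-- The sum of all shuffles of two words. -/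
def shuffleWords : Word d → Word d → TensorPoly d
  | [], v => Finsupp.single v 1
  | u, [] => Finsupp.single u 1
  | a :: u, b :: v =>
      (shuffleWords u (b :: v)).mapDomain (List.cons a) +
        (shuffleWords (a :: u) v).mapDomain (List.cons b)
termination_by u v => u.length + v.length

/-- The shuffle product on `T(V)`, the bilinear extension of `shuffleWords`. -/
def shuffle (f g : TensorPoly d) : TensorPoly d :=
  f.sum fun u r => g.sum fun v s => (r * s) • shuffleWords u v

/-- `e_{τ_1} ⧢ ⋯ ⧢ e_{τ_k}`. -/
def shuffleTuple {k : ℕ} (τ : Fin k → Word d) : TensorPoly d :=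
  (List.ofFn τ).foldr (fun w f => shuffle (Finsupp.single w 1) f) (Finsupp.single [] 1)

/-! ### Weakly geometric rough paths -/

/-- A norm on the level `V^{⊗m}` (all norms on it are equivalent): the Euclidean norm of the
coordinates of the `m`-th level of a tensor series. -/
def levelNorm (m : ℕ) (x : TensorSeries d) : ℝ :=
  Real.sqrt (∑ w : Fin m → Fin d, x (List.ofFn w) ^ 2)

/-- A weakly geometric `p`-rough path in a `d`-dimensional space over `[0, T]`: a map
`(s, t) ↦ x_{s,t} ∈ T((V))` whose values are characters of the shuffle algebra, which satisfies
Chen's relation and has finite `p`-variation. A dissection is a finite increasing family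
`t_0 < ⋯ < t_n` in `[0, T]`. -/
structure RoughPath (d : ℕ) (p T : ℝ) where
  incr : Set.Icc (0 : ℝ) T → Set.Icc (0 : ℝ) T → TensorSeries d
  incr_nil : ∀ s t, s < t → incr s t [] = 1
  incr_shuffle : ∀ s t, s < t → ∀ f g : TensorPoly d,
    pairing (shuffle f g) (incr s t) = pairing f (incr s t) * pairing g (incr s t)
  chen : ∀ s t u, s < t → t < u → tensorMul (incr s t) (incr t u) = incr s u
  finite_variation : ∀ m : ℕ, 1 ≤ m → (m : ℝ) ≤ p → ∃ C : ℝ,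
    ∀ (n : ℕ) (t : Fin (n + 1) → Set.Icc (0 : ℝ) T), StrictMono t →
      ∑ i : Fin n, levelNorm m (incr (t i.castSucc) (t i.succ)) ^ (p / m) ≤ C

/-- The full increment `x_{0,T}` of a rough path over `[0, T]`. -/
def signature {p T : ℝ} (hT : 0 < T) (x : RoughPath d p T) : TensorSeries d :=
  x.incr ⟨0, le_rfl, hT.le⟩ ⟨T, hT.le, le_rfl⟩

/-! ### Ordered partitions -/

section OrderedPartitions

variable {α : Type*} [Fintype α] [DecidableEq α] [PartialOrder α]

/-- Partitions of a finite set; `a ≤ b` means that `a` is finer than `b`. -/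
abbrev SetPart (α : Type*) [Fintype α] [DecidableEq α] : Type _ :=
  Finpartition (Finset.univ : Finset α)

/-- `ker f = a`: the blocks of `a` are the nonempty fibres of `f`. -/
def IsKer {β : Type*} (f : α → β) (a : SetPart α) : Prop :=
  ∀ x y, f x = f y ↔ ∃ B ∈ a.parts, x ∈ B ∧ y ∈ B

open Classical in
/-- `Orp(P)`: the kernels of order-preserving functions `P → ℕ`. -/
def orp (α : Type*) [Fintype α] [DecidableEq α] [PartialOrder α] : Finset (SetPart α) :=
  Finset.univ.filter fun a => ∃ f : α →o ℕ, IsKer f a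

/-- `a!`, the number of order-preserving `f : P → [|a|]` with `ker f = a`. -/
def partFactorial (a : SetPart α) : ℕ :=
  Nat.card {f : α →o Fin a.parts.card // IsKer f a}

/-- `a ∩ U = {a_i ∩ U}`, with the empty set discarded, as a partition of `U`. -/
def trace (a : SetPart α) (U : Finset α) : Finpartition U := a.restrict (Finset.subset_univ U)

/-- `a ∩ C = b ∩ C` for every chain `C`. -/
def SameOnChains (a b : SetPart α) : Prop :=
  ∀ C : Finset α, IsChain (· ≤ ·) (C : Set α) → trace a C = trace b C

open Classical in
/-- The antichain ancestry `𝒜(a)`. -/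
def ancestry (a : SetPart α) : Finset (SetPart α) :=
  (orp α).filter fun b => a ≤ b ∧ SameOnChains a b

/-- The coefficient `(-1)^{|a|-1} a!/|a|`. (The empty poset, where `|a| = 0`, gets `0`.) -/
def orpCoeff (a : SetPart α) : ℝ :=
  (-1) ^ (a.parts.card - 1) * (partFactorial a : ℝ) / (a.parts.card : ℝ)

/-- `𝔡(a) = ∑_{b ∈ 𝒜(a)} (-1)^{|b|-1} b!/|b|`. -/
def height (a : SetPart α) : ℝ := ∑ b ∈ ancestry a, orpCoeff b

end OrderedPartitions

/-! ### Tuples of words -/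

section Tuples

variable {ι : Type*} [Fintype ι] [DecidableEq ι]

/-- The poset `{τ_1} ∪ ⋯ ∪ {τ_k}` of letters of a tuple of words. Letters are told apart by their
position, each word is a chain, and letters of different words are incomparable (this is the
disjoint-sum order that Mathlib puts on sigma types). -/
abbrev Pos (τ : ι → Word d) : Type _ := Σ j : ι, Fin (τ j).length

/-- The word `a_i^j = τ_j ∩ a_i` for a block `B = a_i`. -/
def subword (τ : ι → Word d) (B : Finset (Pos τ)) (j : ι) : Word d :=
  ((List.finRange (τ j).length).filter fun i => (⟨j, i⟩ : Pos τ) ∈ B).map (τ j).get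

/-- The indices `j` for which `τ_j ∩ B` is nonempty. -/
def blockSupport (τ : ι → Word d) (B : Finset (Pos τ)) : Finset ι :=
  Finset.univ.filter fun j => subword τ B j ≠ []

/-! #### Estimators

A statistic of `n` samples that is polynomial in the coordinates of the samples is an
`MvPolynomial` whose variable `(i, w)` stands for `⟨X_i, e_w⟩`. -/

/-- The value of a polynomial statistic at a sample. -/
def evalSample {n : ℕ} (g : MvPolynomial (Fin n × Word d) ℝ) (x : Fin n → TensorSeries d) : ℝ :=
  MvPolynomial.eval (fun v : Fin n × Word d => x v.1 v.2) g

/-- The symmetric mean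
`μ̂_n(a) = 1/(n)_{|a|} ∑^{≠}_{i_1,…,i_{|a|}} ∏_l ∏_j ⟨X_{i_l}, e_{a_l^j}⟩`, where
`(n)_k = n (n - 1) ⋯ (n - k + 1)`. -/
def symMean (n : ℕ) (τ : ι → Word d) (a : SetPart (Pos τ)) : MvPolynomial (Fin n × Word d) ℝ :=
  MvPolynomial.C ((n.descFactorial a.parts.card : ℝ)⁻¹) *
    ∑ i : (a.parts ↪ Fin n), ∏ B : a.parts, ∏ j ∈ blockSupport τ B.1,
      MvPolynomial.X (i B, subword τ B.1 j)

/-- The signature polykay `κ̂_n(τ) = ∑_{a ∈ Orp(τ)} (-1)^{|a|-1} a!/|a| μ̂_n(a)`. -/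
def polykay (n : ℕ) (τ : ι → Word d) : MvPolynomial (Fin n × Word d) ℝ :=
  ∑ a ∈ orp (Pos τ), MvPolynomial.C (orpCoeff a) * symMean n τ a

/-! #### Moments and cumulants of a random tensor series `S` under a measure `ν` -/

variable {E : Type*} [MeasurableSpace E]

/-- The signature moments `μ = 𝔼[S]`. -/
def sigMoment (ν : Measure E) (S : E → TensorSeries d) : TensorSeries d :=
  fun w => ∫ x, S x w ∂ν

/-- The signature cumulant `κ = log 𝔼[S]`. -/
def sigCumulant (ν : Measure E) (S : E → TensorSeries d) : TensorSeries d :=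
  tensorLog (sigMoment ν S)

/-- The classical joint cumulant of the real random variables `Y_j`, `j ∈ J`:
`∑_{π ∈ 𝒫(J)} (-1)^{|π|-1} (|π|-1)! ∏_{K ∈ π} 𝔼[∏_{j ∈ K} Y_j]`. -/
def jointCumulant (ν : Measure E) (J : Finset ι) (Y : ι → E → ℝ) : ℝ :=
  ∑ π : Finpartition J, (-1 : ℝ) ^ (π.parts.card - 1) * ((π.parts.card - 1).factorial : ℝ) *
    ∏ K ∈ π.parts, ∫ x, ∏ j ∈ K, Y j x ∂ν

/-- The generalised cumulant `κ(b) = ∏_i κ(⟨S, e_{b_i^1}⟩, …, ⟨S, e_{b_i^k}⟩)`, where only the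
nonempty `b_i^j` occur. -/
def genCumulant (ν : Measure E) (S : E → TensorSeries d) (τ : ι → Word d) (b : SetPart (Pos τ)) : ℝ :=
  ∏ B ∈ b.parts, jointCumulant ν (blockSupport τ B) fun j x => S x (subword τ B j)

/-! #### The asymptotic covariance -/

variable {ι' : Type*} [Fintype ι'] [DecidableEq ι']

/-- The concatenation of two tuples of words. -/
abbrev concat (τ : ι → Word d) (σ : ι' → Word d) : ι ⊕ ι' → Word d := Sum.elim τ σ

/-- A set of letters of the first tuple as a set of letters of the concatenated tuple. -/
def inFirst (τ : ι → Word d) (σ : ι' → Word d) (B : Finset (Pos τ)) :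
    Finset (Pos (concat τ σ)) :=
  B.image fun x => ⟨Sum.inl x.1, x.2⟩

/-- A set of letters of the second tuple as a set of letters of the concatenated tuple. -/
def inSecond (τ : ι → Word d) (σ : ι' → Word d) (B : Finset (Pos σ)) :
    Finset (Pos (concat τ σ)) :=
  B.image fun x => ⟨Sum.inr x.1, x.2⟩

/-- The blocks of `a₁`, seen in the disjoint union of the two posets. -/
def firstBlocks (τ : ι → Word d) (σ : ι' → Word d) (a₁ : SetPart (Pos τ)) :
    Finset (Finset (Pos (concat τ σ))) := a₁.parts.image (inFirst τ σ)

/-- The blocks of `a₂`, seen in the disjoint union of the two posets. -/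
def secondBlocks (τ : ι → Word d) (σ : ι' → Word d) (a₂ : SetPart (Pos σ)) :
    Finset (Finset (Pos (concat τ σ))) := a₂.parts.image (inSecond τ σ)

/-- `b ∤ a`: no block of `b` is a proper subset of a block of `a`. -/
def NotCutting {β : Type*} [Fintype β] [DecidableEq β] (b : SetPart β)
    (a : Finset (Finset β)) : Prop :=
  ∀ B ∈ b.parts, ∀ A ∈ a, ¬ B ⊂ A

open Classical in
/-- `V(a₁, a₂)`: partitions `c` of the disjoint union `S₁ ∪ S₂` with `c ∩ S₁ = a₁`,
`c ∩ S₂ = a₂` and `|c| = |a₁| + |a₂| - 1`. -/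
def mergers (τ : ι → Word d) (σ : ι' → Word d) (a₁ : SetPart (Pos τ)) (a₂ : SetPart (Pos σ)) :
    Finset (SetPart (Pos (concat τ σ))) :=
  Finset.univ.filter fun c =>
    (trace c (inFirst τ σ Finset.univ)).parts = firstBlocks τ σ a₁ ∧
    (trace c (inSecond τ σ Finset.univ)).parts = secondBlocks τ σ a₂ ∧
    c.parts.card + 1 = a₁.parts.card + a₂.parts.card

open Classical in
/-- The partitions `b ≤ c` over which the inner sum of `𝒱(a₁, a₂)` runs: they satisfy `b ∤ a₁` and
`b ∤ a₂`, keep together the letters of a word that lie in one block of `c` (the atoms are the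
variables `⟨X, e_{c_i^j}⟩`), and differ from `a₁ ∪ a₂`. -/
def innerPartitions (τ : ι → Word d) (σ : ι' → Word d) (a₁ : SetPart (Pos τ)) (a₂ : SetPart (Pos σ))
    (c : SetPart (Pos (concat τ σ))) : Finset (SetPart (Pos (concat τ σ))) :=
  Finset.univ.filter fun b =>
    b ≤ c ∧ SameOnChains b c ∧
    NotCutting b (firstBlocks τ σ a₁) ∧ NotCutting b (secondBlocks τ σ a₂) ∧
    b.parts ≠ firstBlocks τ σ a₁ ∪ secondBlocks τ σ a₂

/-- `𝒱(a₁, a₂) = ∑_{c ∈ V(a₁, a₂)} ∑_b κ(b)`. -/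
def partCov (ν : Measure E) (S : E → TensorSeries d) (τ : ι → Word d) (σ : ι' → Word d)
    (a₁ : SetPart (Pos τ)) (a₂ : SetPart (Pos σ)) : ℝ :=
  ∑ c ∈ mergers τ σ a₁ a₂, ∑ b ∈ innerPartitions τ σ a₁ a₂ c, genCumulant ν S (concat τ σ) b

/-- `𝒱(τ, σ) = ∑_{a₁ ∈ Orp(τ), a₂ ∈ Orp(σ)} 𝔡(a₁) 𝔡(a₂) 𝒱(a₁, a₂)`. -/
def asymCov (ν : Measure E) (S : E → TensorSeries d) (τ : ι → Word d) (σ : ι' → Word d) : ℝ :=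
  ∑ a₁ ∈ orp (Pos τ), ∑ a₂ ∈ orp (Pos σ), height a₁ * height a₂ * partCov ν S τ σ a₁ a₂

end Tuples

/-! ### The estimation problem -/

section Estimation

variable {p T : ℝ} [MeasurableSpace (RoughPath d p T)]

/-- The estimand `⟨κ_X, e_{τ_1} ⧢ ⋯ ⧢ e_{τ_k}⟩` for a random rough path `X` with law `ν`. -/
def estimand (hT : 0 < T) {k : ℕ} (τ : Fin k → Word d) (ν : Measure (RoughPath d p T)) : ℝ :=
  pairing (shuffleTuple τ) (sigCumulant ν (signature hT))

/-- All signature moments under the law `ν` are well-defined. -/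
def HasSigMoments (hT : 0 < T) (ν : Measure (RoughPath d p T)) : Prop :=
  ∀ w : Word d, Integrable (fun x => signature hT x w) ν

/-- The polynomial statistic `g` of `n` samples is an unbiased estimator of `θ`: for every law `ν`
on rough paths with well-defined signature moments, `𝔼 g(X_1, …, X_n) = θ(ν)` when
`X_1, …, X_n` are independent with law `ν`. -/
def IsUnbiasedPolyEstimator (hT : 0 < T) (n : ℕ) (θ : Measure (RoughPath d p T) → ℝ)
    (g : MvPolynomial (Fin n × Word d) ℝ) : Prop :=
  ∀ ν : Measure (RoughPath d p T), IsProbabilityMeasure ν → HasSigMoments hT ν →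
    Integrable (fun x : Fin n → RoughPath d p T => evalSample g fun i => signature hT (x i))
      (Measure.pi fun _ => ν) ∧
    ∫ x : Fin n → RoughPath d p T, evalSample g (fun i => signature hT (x i))
      ∂(Measure.pi fun _ => ν) = θ ν

/-- The value of the polynomial statistic `g` on the first `n` samples of the sequence `X`. -/
def estimator {Ω : Type*} (hT : 0 < T) (X : ℕ → Ω → RoughPath d p T) {n : ℕ}
    (g : MvPolynomial (Fin n × Word d) ℝ) : Ω → ℝ :=
  fun ω => evalSample g fun i => signature hT (X i ω)

end Estimation

end SigPolykay

end

open SigPolykay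

/-! Everything rests on a formula for the estimand as a polynomial in moments. Deconcatenation is
multiplicative for the shuffle product, so pairing `e_{τ_1} ⧢ ⋯ ⧢ e_{τ_k}` with `x ⊗ y` sums over
all ways to cut every word in two, that is, over the lower sets of `P_τ`. Iterating, the pairing
with an `n`-th tensor power is a sum over order-preserving maps `P_τ → {0, …, n - 1}` of products
over fibres. For the powers of `μ - 1` a map with an empty fibre contributes zero, and the
surjections with kernel `a` number `a!`; the logarithm thus becomes a sum over `Orp(τ)` with
coefficients `(-1)^{|a|-1} a!/|a|` (`pairing_shuffleTuple_tensorLog`). Since signatures are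
characters, the factor at a block is the expectation of a product of coordinates
(`HasSigMoments.estimand_eq`). The polykay replaces each product of expectations by the symmetric
mean over distinct sample indices. The same character property writes powers of a coordinate as
linear combinations of coordinates, so that first moments of all coordinates give all moments
(`HasSigMoments.allLp`).

Unbiasedness is independence at distinct indices. For minimum variance, an unbiased `g` is tested on
the uniform laws on sub-families of an arbitrary sample `x_1, …, x_n`; inclusion-exclusion over the
sub-families shows that the average of `g` over all permutations of the sample is the polykay
(`sum_perm_evalSample`), and Cauchy-Schwarz does the rest. For consistency, the recursion
`ustat_option` writes a symmetric mean through sample means and symmetric means of fewer factors,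
with corrections of order `1/n`.

The same recursion gives the first-order (Hájek) expansion with error `o(n^{-1/2})` in `L¹`
(`tendstoZeroL1_ustat`), so a family of polykays is asymptotically a family of sample means of
influence functions. The central limit theorem for linear combinations then yields joint normality,
with the covariance matrix of the influence functions, which is positive semidefinite.

It remains to recognise that covariance as `𝒱(τ, σ)`. Moments of blocks are sums of products of
joint cumulants over partitions that keep words together. In the covariance of two blocks only
partitions with a block meeting both tuples survive (`partMoment_joinPos_sub`). Expanding the
remaining moments too produces pairs of refinements with one marked block in each, and these are the
mergers and inner partitions of `𝒱` (`sum_mergers_sum_inner`, `sum_refinements_sum_mem`). Exchanging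
the sums over ordered partitions and over their refinements turns the polykay coefficients into the
numbers `𝔡(a)` (`sum_height_mul`, `asymCov_eq`). -/

namespace SigPolykay

variable {d : ℕ}

/-! ### The pairing and the shuffle product -/

lemma pairing_add_left (f g : TensorPoly d) (t : TensorSeries d) :
    pairing (f + g) t = pairing f t + pairing g t :=
  Finsupp.sum_add_index' (by simp) (by intros; ring)

lemma pairing_smul_left (c : ℝ) (f : TensorPoly d) (t : TensorSeries d) :
    pairing (c • f) t = c * pairing f t := by
  unfold pairing
  rw [Finsupp.sum_smul_index' (by simp), Finsupp.mul_sum]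
  simp [mul_assoc]

lemma pairing_zero_left (t : TensorSeries d) : pairing 0 t = 0 := Finsupp.sum_zero_index

lemma pairing_single (w : Word d) (c : ℝ) (t : TensorSeries d) :
    pairing (Finsupp.single w c) t = c * t w :=
  Finsupp.sum_single_index (by simp)

lemma pairing_finsetSum_left {β : Type*} (s : Finset β) (f : β → TensorPoly d)
    (t : TensorSeries d) : pairing (∑ i ∈ s, f i) t = ∑ i ∈ s, pairing (f i) t := by
  classical
  induction s using Finset.induction_on with
  | empty => simp [pairing_zero_left]
  | insert a s ha ih => simp [Finset.sum_insert ha, pairing_add_left, ih]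

lemma pairing_mapDomain (φ : Word d → Word d) (f : TensorPoly d) (t : TensorSeries d) :
    pairing (f.mapDomain φ) t = pairing f (t ∘ φ) :=
  Finsupp.sum_mapDomain_index (by simp) (by intros; ring)

lemma pairing_add_right (f : TensorPoly d) (s t : TensorSeries d) :
    pairing f (s + t) = pairing f s + pairing f t := by
  simp [pairing, mul_add, Finsupp.sum_add]

lemma pairing_smul_right (c : ℝ) (f : TensorPoly d) (t : TensorSeries d) :
    pairing f (c • t) = c * pairing f t := by
  simp only [pairing, Finsupp.mul_sum, Pi.smul_apply, smul_eq_mul]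
  exact Finsupp.sum_congr fun _ _ => by ring

lemma pairing_finsetSum_right {β : Type*} (s : Finset β) (f : TensorPoly d)
    (t : β → TensorSeries d) : pairing f (∑ i ∈ s, t i) = ∑ i ∈ s, pairing f (t i) := by
  classical
  induction s using Finset.induction_on with
  | empty => simp [pairing]
  | insert a s ha ih => simp [Finset.sum_insert ha, pairing_add_right, ih]

lemma pairing_shuffle (f g : TensorPoly d) (t : TensorSeries d) :
    pairing (shuffle f g) t =
      f.sum fun u r => g.sum fun v s => r * s * pairing (shuffleWords u v) t := by
  simp only [shuffle, Finsupp.sum, pairing_finsetSum_left, pairing_smul_left]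

/-- The adjoint of the shuffle multiplication by a word. -/
noncomputable def shuffleAdj (w : Word d) (x : TensorSeries d) : TensorSeries d :=
  fun v => pairing (shuffleWords w v) x

lemma pairing_shuffle_single (w : Word d) (f : TensorPoly d) (t : TensorSeries d) :
    pairing (shuffle (Finsupp.single w 1) f) t = pairing f (shuffleAdj w t) := by
  rw [pairing_shuffle, Finsupp.sum_single_index (by simp)]
  simp [pairing, shuffleAdj]

lemma shuffleWords_nil_left (v : Word d) : shuffleWords [] v = Finsupp.single v 1 := by
  rw [shuffleWords]

lemma shuffleWords_nil_right (u : Word d) : shuffleWords u [] = Finsupp.single u 1 := by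
  cases u <;> simp [shuffleWords]

lemma shuffleAdj_nil (x : TensorSeries d) : shuffleAdj [] x = x := by
  ext v; simp [shuffleAdj, shuffleWords_nil_left, pairing_single]

lemma shuffleAdj_apply_nil (u : Word d) (x : TensorSeries d) : shuffleAdj u x [] = x u := by
  simp [shuffleAdj, shuffleWords_nil_right, pairing_single]

/-- The first letter of a shuffle comes from one of the two words; in dual form, prepending a letter
becomes precomposition with `List.cons`. -/
lemma shuffleAdj_cons_cons (a b : Fin d) (u v : Word d) (x : TensorSeries d) :
    shuffleAdj (a :: u) x (b :: v) =
      shuffleAdj u (x ∘ List.cons a) (b :: v) + shuffleAdj (a :: u) (x ∘ List.cons b) v := by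
  simp only [shuffleAdj]
  rw [shuffleWords, pairing_add_left, pairing_mapDomain, pairing_mapDomain]

lemma shuffleAdj_add (w : Word d) (x y : TensorSeries d) :
    shuffleAdj w (x + y) = shuffleAdj w x + shuffleAdj w y := by
  ext v; simp [shuffleAdj, pairing_add_right]

lemma shuffleAdj_smul (w : Word d) (c : ℝ) (x : TensorSeries d) :
    shuffleAdj w (c • x) = c • shuffleAdj w x := by
  ext v; simp [shuffleAdj, pairing_smul_right]

lemma tensorMul_apply_nil (x y : TensorSeries d) : tensorMul x y [] = x [] * y [] := by
  simp [tensorMul]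

/-- A product rule for removing a first letter: in a splitting of `a :: w` the letter leads the left
factor, unless that factor is empty and the letter leads the right one. -/
lemma tensorMul_comp_cons (a : Fin d) (x y : TensorSeries d) :
    tensorMul x y ∘ List.cons a = x [] • (y ∘ List.cons a) + tensorMul (x ∘ List.cons a) y := by
  ext w
  simp only [tensorMul, Function.comp_apply, Pi.add_apply, Pi.smul_apply, smul_eq_mul,
    List.length_cons]
  rw [Finset.sum_range_succ']
  simp [add_comm]

/-- Deconcatenation is multiplicative for the shuffle product, in dual form. -/
lemma shuffleAdj_tensorMul (u v : Word d) (x y : TensorSeries d) :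
    shuffleAdj u (tensorMul x y) v = ∑ i ∈ Finset.range (u.length + 1),
      tensorMul (shuffleAdj (u.take i) x) (shuffleAdj (u.drop i) y) v := by
  -- The series stay general because removing a letter from a word replaces `x` by `x ∘ List.cons
  -- a`.
  induction hn : u.length + v.length generalizing u v x y with
  | zero =>
    have hu : u = [] := List.length_eq_zero_iff.1 (by omega)
    have hv : v = [] := List.length_eq_zero_iff.1 (by omega)
    subst hu hv
    simp [shuffleAdj_nil]
  | succ n ih =>
    match u, v with
    | [], v => simp [shuffleAdj_nil]
    | u, [] =>
      simp [shuffleAdj_apply_nil, tensorMul]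
    | a :: u, b :: v =>
      simp only [List.length_cons] at hn
      rw [shuffleAdj_cons_cons, tensorMul_comp_cons, tensorMul_comp_cons]
      simp only [shuffleAdj_add, shuffleAdj_smul, Pi.add_apply, Pi.smul_apply, smul_eq_mul]
      rw [ih u (b :: v) _ _ (by simp; omega), ih (a :: u) v _ _ (by simp; omega)]
      have key : ∀ (p q : TensorSeries d), tensorMul p q (b :: v) =
          p [] * q (b :: v) + tensorMul (p ∘ List.cons b) q v := fun p q => by
        have := congrFun (tensorMul_comp_cons b p q) v
        simpa using this
      simp only [List.length_cons]
      -- The empty prefix of `a :: u` is split off on both sides, since the recursion for shuffles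
      -- needs a nonempty prefix.
      rw [Finset.sum_range_succ' _ (u.length + 1), Finset.sum_range_succ' _ (u.length + 1)]
      have h0 : shuffleAdj ([] : Word d) (x ∘ List.cons b) = shuffleAdj [] x ∘ List.cons b := by
        simp [shuffleAdj_nil]
      have h1 : ∀ i, tensorMul (shuffleAdj (a :: u.take i) x) (shuffleAdj (u.drop i) y) (b :: v) =
          tensorMul (shuffleAdj (u.take i) (x ∘ List.cons a)) (shuffleAdj (u.drop i) y) (b :: v) +
          tensorMul (shuffleAdj (a :: u.take i) (x ∘ List.cons b)) (shuffleAdj (u.drop i) y) v := by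
        intro i
        rw [key, key]
        have h2 : shuffleAdj (a :: u.take i) x ∘ List.cons b =
            shuffleAdj (u.take i) (x ∘ List.cons a) ∘ List.cons b +
              shuffleAdj (a :: u.take i) (x ∘ List.cons b) := by
          ext w; simp [shuffleAdj_cons_cons]
        rw [h2]
        have h3 : ∀ p q r : TensorSeries d, tensorMul (p + q) r v =
            tensorMul p r v + tensorMul q r v := by
          intro p q r; simp [tensorMul, add_mul, Finset.sum_add_distrib]
        rw [h3, shuffleAdj_apply_nil, shuffleAdj_apply_nil]
        simp only [Function.comp_apply]
        ring
      simp only [List.take_succ_cons, List.drop_succ_cons, h1, Finset.sum_add_distrib,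
        List.take_zero, List.drop_zero]
      rw [key (shuffleAdj [] x), h0, shuffleAdj_apply_nil]
      rw [show shuffleAdj (a :: u) y (b :: v) = shuffleAdj u (y ∘ List.cons a) (b :: v) +
        shuffleAdj (a :: u) (y ∘ List.cons b) v from shuffleAdj_cons_cons ..]
      ring

lemma shuffleTuple_zero (τ : Fin 0 → Word d) : shuffleTuple τ = Finsupp.single [] 1 := by
  simp [shuffleTuple]

lemma shuffleTuple_succ {k : ℕ} (τ : Fin (k + 1) → Word d) :
    shuffleTuple τ = shuffle (Finsupp.single (τ 0) 1) (shuffleTuple (Fin.tail τ)) := by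
  simp [shuffleTuple, List.ofFn_succ, Fin.tail_def]

lemma pairing_shuffleTuple_zero (τ : Fin 0 → Word d) (x : TensorSeries d) :
    pairing (shuffleTuple τ) x = x [] := by
  simp [shuffleTuple_zero, pairing_single]

lemma pairing_shuffleTuple_succ {k : ℕ} (τ : Fin (k + 1) → Word d) (x : TensorSeries d) :
    pairing (shuffleTuple τ) x = pairing (shuffleTuple (Fin.tail τ)) (shuffleAdj (τ 0) x) := by
  rw [shuffleTuple_succ, pairing_shuffle_single]

/-- `shuffleAdj_tensorMul` cuts one word at a time, and the cuts of different words are independent,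
hence a sum over families of cut positions. -/
lemma pairing_shuffleTuple_tensorMul {k : ℕ} (τ : Fin k → Word d) (x y : TensorSeries d) :
    pairing (shuffleTuple τ) (tensorMul x y) =
      ∑ c ∈ Fintype.piFinset fun j => Finset.range ((τ j).length + 1),
        pairing (shuffleTuple fun j => (τ j).take (c j)) x *
          pairing (shuffleTuple fun j => (τ j).drop (c j)) y := by
  induction k generalizing x y with
  | zero => simp [pairing_shuffleTuple_zero, tensorMul_apply_nil]
  | succ k ih =>
    rw [pairing_shuffleTuple_succ]
    have h : shuffleAdj (τ 0) (tensorMul x y) = ∑ i ∈ Finset.range ((τ 0).length + 1),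
        tensorMul (shuffleAdj ((τ 0).take i) x) (shuffleAdj ((τ 0).drop i) y) := by
      ext v; rw [shuffleAdj_tensorMul]; simp
    simp only [h, pairing_finsetSum_right, ih]
    rw [← Finset.sum_product']
    refine Finset.sum_bij' (fun p _ => Fin.cons p.1 p.2) (fun c _ => (c 0, Fin.tail c)) ?_ ?_ ?_ ?_ ?_
    · rintro ⟨i, c⟩ hc
      simp only [Finset.mem_product, Finset.mem_range, Fintype.mem_piFinset] at hc ⊢
      intro j
      refine Fin.cases ?_ (fun j => ?_) j
      · simpa using hc.1
      · simpa [Fin.tail] using hc.2 j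
    · intro c hc
      simp only [Finset.mem_product, Finset.mem_range, Fintype.mem_piFinset] at hc ⊢
      exact ⟨hc 0, fun j => hc j.succ⟩
    · intro p _; simp
    · intro c _; simp
    · rintro ⟨i, c⟩ _
      rw [pairing_shuffleTuple_succ, pairing_shuffleTuple_succ]
      rfl

/-- Characters of the shuffle algebra are multiplicative on shuffles of tuples. -/
lemma pairing_shuffleTuple_of_character {x : TensorSeries d} (h1 : x [] = 1)
    (hx : ∀ f g : TensorPoly d, pairing (shuffle f g) x = pairing f x * pairing g x)
    {k : ℕ} (τ : Fin k → Word d) : pairing (shuffleTuple τ) x = ∏ j, x (τ j) := by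
  induction k with
  | zero => simp [pairing_shuffleTuple_zero, h1]
  | succ k ih =>
    rw [shuffleTuple_succ, hx, pairing_single, ih, Fin.prod_univ_succ]
    simp [Fin.tail]

lemma shuffleAdj_tensorOne (u v : Word d) :
    shuffleAdj u tensorOne v = if u = [] ∧ v = [] then 1 else 0 := by
  match u, v with
  | [], v => simp [shuffleAdj_nil, tensorOne]
  | u, [] => simp [shuffleAdj_apply_nil, tensorOne]
  | a :: u, b :: v =>
    have h : ∀ a : Fin d, (tensorOne ∘ List.cons a : TensorSeries d) = 0 := by
      intro a; ext w; simp [tensorOne]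
    rw [shuffleAdj_cons_cons, h, h]
    simp [shuffleAdj, pairing]

lemma pairing_shuffleTuple_tensorOne {k : ℕ} (τ : Fin k → Word d) :
    pairing (shuffleTuple τ) tensorOne = if ∀ j, τ j = [] then 1 else 0 := by
  induction k with
  | zero => simp [pairing_shuffleTuple_zero, tensorOne]
  | succ k ih =>
    rw [pairing_shuffleTuple_succ]
    by_cases h : τ 0 = []
    · rw [h, shuffleAdj_nil, ih]
      exact if_congr (by simp [Fin.forall_fin_succ, h, Fin.tail]) rfl rfl
    · have : shuffleAdj (τ 0) (tensorOne : TensorSeries d) = 0 := by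
        ext v; simp [shuffleAdj_tensorOne, h]
      rw [this]
      simp [pairing, Fin.forall_fin_succ, h]

end SigPolykay

namespace SigPolykay

variable {d : ℕ}

/-! ### Subwords and deconcatenation along lower sets -/

section Subword

variable {ι : Type*} [DecidableEq ι]

/-- The positions of the `j`-th word that lie in `U`, in increasing order. -/
def posList (τ : ι → Word d) (U : Finset (Pos τ)) (j : ι) : List (Fin (τ j).length) :=
  (List.finRange (τ j).length).filter fun i => (⟨j, i⟩ : Pos τ) ∈ U

lemma subword_eq_map (τ : ι → Word d) (U : Finset (Pos τ)) (j : ι) :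
    subword τ U j = (posList τ U j).map (τ j).get := rfl

lemma mem_posList {τ : ι → Word d} {U : Finset (Pos τ)} {j : ι} {i : Fin (τ j).length} :
    i ∈ posList τ U j ↔ (⟨j, i⟩ : Pos τ) ∈ U := by
  simp [posList]

lemma sortedLT_posList (τ : ι → Word d) (U : Finset (Pos τ)) (j : ι) :
    (posList τ U j).SortedLT :=
  ((List.sortedLT_finRange _).pairwise.filter _).sortedLT

lemma subword_eq_nil_iff {τ : ι → Word d} {U : Finset (Pos τ)} {j : ι} :
    subword τ U j = [] ↔ ∀ i, (⟨j, i⟩ : Pos τ) ∉ U := by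
  simp [subword, List.filter_eq_nil_iff]

lemma subword_univ [Fintype ι] (τ : ι → Word d) (j : ι) : subword τ Finset.univ j = τ j := by
  simp [subword]

lemma subword_empty (τ : ι → Word d) (j : ι) : subword τ ∅ j = [] := by
  simp [subword]

lemma eq_empty_iff_subword {τ : ι → Word d} {U : Finset (Pos τ)} :
    (∀ j, subword τ U j = []) ↔ U = ∅ := by
  simp only [subword_eq_nil_iff, Finset.eq_empty_iff_forall_notMem, Sigma.forall]

end Subword

/-- The subsets of `U` that are closed downwards in `U`. -/
def lowerIn {α : Type*} [DecidableEq α] [PartialOrder α] [DecidableLE α] (U : Finset α) :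
    Finset (Finset α) :=
  U.powerset.filter fun D => ∀ a ∈ D, ∀ b ∈ U, b ≤ a → b ∈ D

open Classical in
-- A lower subset meets each word in an initial segment, so the joined list is still increasing, and
-- strictly sorted lists with the same members are equal.
lemma posList_append {ι : Type*} [DecidableEq ι] {τ : ι → Word d}
    {U D : Finset (Pos τ)} (hD : D ∈ lowerIn U) (j : ι) :
    posList τ U j = posList τ D j ++ posList τ (U \ D) j := by
  simp only [lowerIn, Finset.mem_filter, Finset.mem_powerset] at hD
  refine (sortedLT_posList τ U j).eq_of_mem_iff ?_ ?_
  · refine List.Pairwise.sortedLT ?_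
    rw [List.pairwise_append]
    refine ⟨(sortedLT_posList _ _ _).pairwise, (sortedLT_posList _ _ _).pairwise, ?_⟩
    intro a ha b hb
    rw [mem_posList] at ha hb
    rw [Finset.mem_sdiff] at hb
    by_contra hab
    exact hb.2 (hD.2 _ ha _ hb.1 (Sigma.mk_le_mk_iff.2 (not_lt.1 hab)))
  · intro i
    simp only [List.mem_append, mem_posList, Finset.mem_sdiff]
    have := @hD.1 ⟨j, i⟩
    tauto

open Classical in
-- Cutting every word of `U` in two amounts to choosing a lower set: the cut in word `j` is the
-- number of letters of `D` in that word.
lemma pairing_shuffleTuple_subword_tensorMul {k : ℕ} (τ : Fin k → Word d) (U : Finset (Pos τ))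
    (x y : TensorSeries d) :
    pairing (shuffleTuple (subword τ U)) (tensorMul x y) = ∑ D ∈ lowerIn U,
      pairing (shuffleTuple (subword τ D)) x * pairing (shuffleTuple (subword τ (U \ D))) y := by
  rw [pairing_shuffleTuple_tensorMul]
  symm
  let cut (c : Fin k → ℕ) : Finset (Pos τ) :=
    Finset.univ.filter fun p => p.2 ∈ (posList τ U p.1).take (c p.1)
  have hcut : ∀ c : Fin k → ℕ, cut c ∈ lowerIn U := by
    intro c
    simp only [lowerIn, Finset.mem_filter, Finset.mem_powerset]
    refine ⟨?_, ?_⟩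
    · rintro ⟨j, i⟩ h
      simp only [cut, Finset.mem_filter, Finset.mem_univ, true_and] at h
      exact mem_posList.1 (List.mem_of_mem_take h)
    · rintro ⟨j, i⟩ h ⟨j', i'⟩ hU hle
      obtain rfl : j' = j := (Sigma.le_def.1 hle).1
      rw [Sigma.mk_le_mk_iff] at hle
      simp only [cut, Finset.mem_filter, Finset.mem_univ, true_and] at h ⊢
      have hs := (sortedLT_posList τ U j').pairwise
      rw [← List.take_append_drop (c j') (posList τ U j'), List.pairwise_append] at hs
      have hm : i' ∈ posList τ U j' := mem_posList.2 hU
      rw [← List.take_append_drop (c j') (posList τ U j'), List.mem_append] at hm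
      rcases hm with hm | hm
      · exact hm
      · exact absurd (hs.2.2 _ h _ hm) (not_lt.2 hle)
  have hpos : ∀ c : Fin k → ℕ, ∀ j, posList τ (cut c) j = (posList τ U j).take (c j) := by
    intro c j
    refine (sortedLT_posList _ _ _).eq_of_mem_iff
      ((sortedLT_posList τ U j).pairwise.sublist (List.take_sublist _ _)).sortedLT ?_
    intro i
    simp [mem_posList, cut]
  have hdrop : ∀ c : Fin k → ℕ, ∀ j, posList τ (U \ cut c) j = (posList τ U j).drop (c j) := by
    intro c j
    have h := posList_append (hcut c) j
    rw [hpos] at h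
    exact (List.append_cancel_left ((List.take_append_drop (c j) _).trans h)).symm
  refine Finset.sum_bij' (fun D _ j => (posList τ D j).length) (fun c _ => cut c) ?_ ?_ ?_ ?_ ?_
  · intro D hD
    simp only [Fintype.mem_piFinset, Finset.mem_range]
    intro j
    have := congrArg List.length (posList_append hD j)
    simp only [subword_eq_map, List.length_map, List.length_append] at this ⊢
    omega
  · exact fun c _ => hcut c
  · intro D hD
    ext ⟨j, i⟩
    simp only [cut, Finset.mem_filter, Finset.mem_univ, true_and]
    rw [posList_append hD, List.take_left, mem_posList]
  · intro c hc
    ext j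
    simp only [Fintype.mem_piFinset, Finset.mem_range] at hc
    have := hc j
    simp only [subword_eq_map, List.length_map] at this
    rw [hpos]
    simp
    omega
  · intro D hD
    have h1 : ∀ j, subword τ D j = (subword τ U j).take (posList τ D j).length := by
      intro j
      rw [subword_eq_map, subword_eq_map, posList_append hD j, ← List.map_take, List.take_left]
    have h2 : ∀ j, subword τ (U \ D) j = (subword τ U j).drop (posList τ D j).length := by
      intro j
      rw [subword_eq_map, subword_eq_map, posList_append hD j, ← List.map_drop, List.drop_left]
    simp only [← h1, ← h2]

/-! ### Sums over order-preserving maps -/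

section MonoFuns

variable {α : Type*} [Fintype α] [DecidableEq α] [PartialOrder α]

open Classical in
/-- The order-preserving functions `U → {0, …, n - 1}`, extended by `0` to the whole poset. -/
noncomputable def monoFuns (n : ℕ) (U : Finset α) : Finset (α → ℕ) :=
  (Fintype.piFinset fun x => if x ∈ U then Finset.range n else {0}).filter
    fun f => ∀ x ∈ U, ∀ y ∈ U, x ≤ y → f x ≤ f y

lemma mem_monoFuns {n : ℕ} {U : Finset α} {f : α → ℕ} :
    f ∈ monoFuns n U ↔ (∀ x ∈ U, f x < n) ∧ (∀ x ∉ U, f x = 0) ∧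
      ∀ x ∈ U, ∀ y ∈ U, x ≤ y → f x ≤ f y := by
  simp only [monoFuns, Finset.mem_filter, Fintype.mem_piFinset]
  rw [← and_assoc]
  refine and_congr_left fun _ => ⟨fun h => ⟨fun x hx => ?_, fun x hx => ?_⟩, fun h x => ?_⟩
  · simpa [hx] using h x
  · simpa [hx] using h x
  · by_cases hx : x ∈ U
    · simpa [hx] using h.1 x hx
    · simpa [hx] using h.2 x hx

/-- The sum over order-preserving maps of the product of a set function over the fibres. -/
noncomputable def fibreSum (m : Finset α → ℝ) (n : ℕ) (U : Finset α) : ℝ :=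
  ∑ f ∈ monoFuns n U, ∏ l ∈ Finset.range n, m (U.filter fun x => f x = l)

lemma fibreSum_zero (m : Finset α → ℝ) (U : Finset α) :
    fibreSum m 0 U = if U = ∅ then 1 else 0 := by
  classical
  by_cases hU : U = ∅
  · subst hU
    have : monoFuns 0 (∅ : Finset α) = {0} := by
      ext f; simp [mem_monoFuns, funext_iff]
    simp [fibreSum, this]
  · have : monoFuns 0 U = ∅ := by
      obtain ⟨x, hx⟩ := Finset.nonempty_iff_ne_empty.2 hU
      ext f
      simp only [mem_monoFuns, Finset.notMem_empty, iff_false]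
      intro h
      exact absurd (h.1 x hx) (by omega)
    simp [fibreSum, this, hU]

open Classical in
-- The zero fibre of an order-preserving map is a lower set, and on its complement the map shifted
-- down by one is again order-preserving. Tensor powers obey the same recursion.
lemma fibreSum_succ (m : Finset α → ℝ) (n : ℕ) (U : Finset α) :
    fibreSum m (n + 1) U = ∑ D ∈ lowerIn U, m D * fibreSum m n (U \ D) := by
  simp only [fibreSum, Finset.mul_sum]
  rw [Finset.sum_sigma' (lowerIn U)]
  -- Truncated subtraction sends the zero fibre to `0`, which is the default value off `U \ D`, so
  -- the shift respects the extension by `0`.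
  refine Finset.sum_bij'
    (fun f _ => ⟨U.filter fun x => f x = 0, fun x => f x - 1⟩)
    (fun p _ x => if x ∈ U \ p.1 then p.2 x + 1 else 0) ?_ ?_ ?_ ?_ ?_
  · intro f hf
    rw [mem_monoFuns] at hf
    simp only [Finset.mem_sigma, lowerIn, Finset.mem_filter, Finset.mem_powerset, mem_monoFuns,
      Finset.mem_sdiff, not_and]
    refine ⟨⟨Finset.filter_subset _ _, fun a ha b hb hba => ⟨hb, ?_⟩⟩, ?_, ?_, ?_⟩
    · have := hf.2.2 b hb a ha.1 hba
      omega
    · intro x hx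
      have := hf.1 x hx.1
      have := hx.2 hx.1
      omega
    · intro x hx
      by_cases hxU : x ∈ U
      · have := hx hxU
        omega
      · simp [hf.2.1 x hxU]
    · intro x hx y hy hxy
      have := hf.2.2 x hx.1 y hy.1 hxy
      omega
  · rintro ⟨D, f⟩ h
    simp only [Finset.mem_sigma, lowerIn, Finset.mem_filter, Finset.mem_powerset, mem_monoFuns] at h
    obtain ⟨⟨hDU, hD⟩, h1, h2, h3⟩ := h
    rw [mem_monoFuns]
    refine ⟨fun x _ => ?_, fun x hx => ?_, fun x hx y hy hxy => ?_⟩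
    · simp only
      split_ifs with hx
      · have := h1 x hx
        omega
      · omega
    · simp [hx]
    · by_cases hxD : x ∈ D
      · simp [hxD]
      · have hyD : y ∉ D := fun h => hxD (hD y h x hx hxy)
        simpa [hx, hy, hxD, hyD] using h3 x (by simp [hx, hxD]) y (by simp [hy, hyD]) hxy
  · intro f hf
    rw [mem_monoFuns] at hf
    ext x
    simp only [Finset.mem_sdiff, Finset.mem_filter, not_and]
    split_ifs with hx
    · have := hx.2 hx.1
      omega
    · by_cases hxU : x ∈ U
      · simp only [hxU, true_and, forall_const, not_not] at hx
        exact hx.symm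
      · exact (hf.2.1 x hxU).symm
  · rintro ⟨D, f⟩ h
    simp only [Finset.mem_sigma, lowerIn, Finset.mem_filter, Finset.mem_powerset, mem_monoFuns] at h
    obtain ⟨⟨hDU, hD⟩, h1, h2, h3⟩ := h
    have e1 : (U.filter fun x => (if x ∈ U \ D then f x + 1 else 0) = 0) = D := by
      ext x
      simp only [Finset.mem_filter, Finset.mem_sdiff]
      have := @hDU x
      split_ifs with hx
      · simp; tauto
      · tauto
    have e2 : (fun x => (if x ∈ U \ D then f x + 1 else 0) - 1) = f := by
      ext x
      split_ifs with hx
      · omega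
      · rw [h2 x hx]
    simp only [e1, e2]
  · intro f hf
    rw [mem_monoFuns] at hf
    rw [Finset.prod_range_succ', mul_comm]
    congr 1
    refine Finset.prod_congr rfl fun l _ => congrArg m ?_
    ext x
    simp only [Finset.mem_filter, Finset.mem_sdiff, not_and]
    constructor
    · rintro ⟨hx, h⟩; exact ⟨⟨hx, fun _ => by omega⟩, by omega⟩
    · rintro ⟨⟨hx, h⟩, h'⟩; exact ⟨hx, by have := h hx; omega⟩

end MonoFuns

/-- Each tensor factor takes the letters of one fibre: both sides remove one factor by summing over
the lower sets of `U`. -/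
lemma pairing_shuffleTuple_subword_tensorPow {k : ℕ} (τ : Fin k → Word d) (n : ℕ)
    (U : Finset (Pos τ)) (x : TensorSeries d) :
    pairing (shuffleTuple (subword τ U)) (tensorPow x n) =
      fibreSum (fun B => pairing (shuffleTuple (subword τ B)) x) n U := by
  induction n generalizing U with
  | zero =>
    rw [tensorPow, pairing_shuffleTuple_tensorOne, fibreSum_zero]
    exact if_congr eq_empty_iff_subword rfl rfl
  | succ n ih =>
    rw [tensorPow, pairing_shuffleTuple_subword_tensorMul, fibreSum_succ]
    simp only [ih]

end SigPolykay

namespace SigPolykay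

variable {d : ℕ}

/-! ### Partitions and kernels -/

section Kernels

variable {α : Type*} [Fintype α]

/-- The restriction to the image is needed because all other fibres are empty and hence coincide. -/
lemma IsKer.injOn_fibre {f : α → ℕ} :
    Set.InjOn (fun l => Finset.univ.filter fun x : α => f x = l) (Finset.univ.image f) := by
  intro l hl l' _ h
  simp only [Finset.coe_image, Finset.coe_univ, Set.image_univ, Set.mem_range] at hl
  obtain ⟨x, rfl⟩ := hl
  have : x ∈ Finset.univ.filter fun y : α => f y = f x := by simp
  simp only at h
  rw [h] at this
  simpa using this

variable [DecidableEq α]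

lemma setPart_ext {a b : SetPart α}
    (h : ∀ x y, (∃ B ∈ a.parts, x ∈ B ∧ y ∈ B) ↔ ∃ B ∈ b.parts, x ∈ B ∧ y ∈ B) : a = b := by
  have hp : ∀ x, a.part x = b.part x := by
    intro x
    ext y
    rw [Finpartition.mem_part_iff_exists, Finpartition.mem_part_iff_exists]
    exact h y x
  have key : ∀ a b : SetPart α, (∀ x, a.part x = b.part x) → a.parts ⊆ b.parts := by
    intro a b hp B hB
    obtain ⟨x, hx⟩ := a.nonempty_of_mem_parts hB
    rw [← a.part_eq_of_mem hB hx, hp x]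
    exact b.part_mem.2 (Finset.mem_univ x)
  exact Finpartition.ext (Finset.Subset.antisymm (key a b hp) (key b a fun x => (hp x).symm))

lemma IsKer.unique {β : Type*} {f : α → β} {a b : SetPart α} (ha : IsKer f a) (hb : IsKer f b) :
    a = b :=
  setPart_ext fun x y => (ha x y).symm.trans (hb x y)

lemma exists_isKer {β : Type*} (f : α → β) : ∃ a : SetPart α, IsKer f a := by
  classical
  refine ⟨Finpartition.ofSetoid (Setoid.ker f), fun x y => ?_⟩
  rw [← Finpartition.mem_part_iff_exists, Finpartition.mem_part_ofSetoid_iff_rel]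
  exact eq_comm

lemma IsKer.parts_eq {f : α → ℕ} {a : SetPart α} (ha : IsKer f a) :
    a.parts = (Finset.univ.image f).image fun l => Finset.univ.filter fun x => f x = l := by
  have hpart : ∀ x, a.part x = Finset.univ.filter fun y => f y = f x := by
    intro x
    ext y
    rw [Finpartition.mem_part_iff_exists, ← ha y x]
    simp
  ext B
  simp only [Finset.mem_image, Finset.mem_univ, true_and, exists_exists_eq_and]
  constructor
  · intro hB
    obtain ⟨x, hx⟩ := a.nonempty_of_mem_parts hB
    exact ⟨x, by rw [← hpart, a.part_eq_of_mem hB hx]⟩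
  · rintro ⟨x, rfl⟩
    rw [← hpart]
    exact a.part_mem.2 (Finset.mem_univ x)

lemma IsKer.card_parts {f : α → ℕ} {a : SetPart α} (ha : IsKer f a) :
    a.parts.card = (Finset.univ.image f).card := by
  rw [ha.parts_eq, Finset.card_image_of_injOn IsKer.injOn_fibre]

lemma IsKer.prod_parts {f : α → ℕ} {a : SetPart α} (ha : IsKer f a) (m : Finset α → ℝ) :
    ∏ B ∈ a.parts, m B = ∏ l ∈ Finset.univ.image f, m (Finset.univ.filter fun x => f x = l) := by
  rw [ha.parts_eq, Finset.prod_image IsKer.injOn_fibre]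

variable [PartialOrder α]

open Classical in
/-- Grouping order-preserving surjections by their kernel. -/
lemma fibreSum_univ {m : Finset α → ℝ} (hm : m ∅ = 0) (n : ℕ) :
    fibreSum m n Finset.univ = ∑ a ∈ (orp α).filter fun a => a.parts.card = n,
      (partFactorial a : ℝ) * ∏ B ∈ a.parts, m B := by
  let ker (f : α → ℕ) : SetPart α := (exists_isKer f).choose
  have hker : ∀ f : α → ℕ, IsKer f (ker f) := fun f => (exists_isKer f).choose_spec
  have himg : ∀ f ∈ monoFuns n (Finset.univ : Finset α),
      Finset.univ.image f ⊆ Finset.range n := by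
    intro f hf
    rw [mem_monoFuns] at hf
    intro l hl
    obtain ⟨x, -, rfl⟩ := Finset.mem_image.1 hl
    exact Finset.mem_range.2 (hf.1 x (Finset.mem_univ x))
  have hsurj : ∀ f ∈ monoFuns n (Finset.univ : Finset α), (ker f).parts.card = n →
      Finset.univ.image f = Finset.range n := by
    intro f hf h
    refine Finset.eq_of_subset_of_card_le (himg f hf) ?_
    rw [← (hker f).card_parts, h, Finset.card_range]
  -- A map that misses a value has an empty fibre and drops out because `m ∅ = 0`.
  have h1 : fibreSum m n Finset.univ =
      ∑ f ∈ (monoFuns n (Finset.univ : Finset α)).filter (fun f => (ker f).parts.card = n),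
        ∏ l ∈ Finset.range n, m (Finset.univ.filter fun x => f x = l) := by
    rw [fibreSum]
    symm
    refine Finset.sum_subset (Finset.filter_subset _ _) fun f hf hf' => ?_
    have hne : Finset.univ.image f ≠ Finset.range n := by
      intro h
      refine hf' (Finset.mem_filter.2 ⟨hf, ?_⟩)
      rw [(hker f).card_parts, h, Finset.card_range]
    obtain ⟨l, hl, hl'⟩ := Finset.exists_of_ssubset ((himg f hf).ssubset_of_ne hne)
    refine Finset.prod_eq_zero hl ?_
    rw [← hm]
    congr 1
    simpa [Finset.filter_eq_empty_iff] using hl'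
  rw [h1, ← Finset.sum_fiberwise_of_maps_to
    (g := ker) (t := (orp α).filter fun a => a.parts.card = n)]
  · refine Finset.sum_congr rfl fun a ha => ?_
    simp only [orp, Finset.mem_filter, Finset.mem_univ, true_and] at ha
    have hconst : ∀ f ∈ ((monoFuns n (Finset.univ : Finset α)).filter
        fun f => (ker f).parts.card = n).filter (fun f => ker f = a),
        ∏ l ∈ Finset.range n, m (Finset.univ.filter fun x => f x = l) = ∏ B ∈ a.parts, m B := by
      intro f hf
      simp only [Finset.mem_filter] at hf
      obtain ⟨⟨hf, hc⟩, rfl⟩ := hf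
      rw [(hker f).prod_parts, hsurj f hf hc]
    rw [Finset.sum_congr rfl hconst, Finset.sum_const, nsmul_eq_mul]
    congr 2
    rw [partFactorial, ← Nat.card_eq_finsetCard]
    -- Since `|a| = n`, maps with values below `n` and kernel `a` are exactly the maps into `Fin
    -- |a|` counted by `a!`.
    refine Nat.card_congr ?_
    refine
      { toFun := fun f => ⟨⟨fun x => ⟨f.1 x, ?_⟩, ?_⟩, ?_⟩
        invFun := fun g => ⟨fun x => (g.1 x : ℕ), ?_⟩
        left_inv := fun f => rfl
        right_inv := fun g => rfl }
    · have := f.2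
      simp only [Finset.mem_filter, mem_monoFuns] at this
      rw [ha.2]
      exact this.1.1.1 x (Finset.mem_univ x)
    · have := f.2
      simp only [Finset.mem_filter, mem_monoFuns] at this
      exact fun x y hxy => this.1.1.2.2 x (Finset.mem_univ x) y (Finset.mem_univ y) hxy
    · have := f.2
      simp only [Finset.mem_filter] at this
      intro x y
      have h := hker f.1 x y
      rw [this.2] at h
      exact Fin.ext_iff.trans h
    · have hk : IsKer (fun x => (g.1 x : ℕ)) a := by
        intro x y
        rw [← g.2 x y, Fin.ext_iff]
      have hk' := (hker _).unique hk
      simp only [Finset.mem_filter, mem_monoFuns, hk', ha.2, and_true]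
      refine ⟨fun x _ => ?_, by simp, fun x _ y _ hxy => g.1.monotone hxy⟩
      exact ha.2 ▸ (g.1 x).2
  · intro f hf
    simp only [Finset.mem_filter, orp, Finset.mem_univ, true_and] at hf ⊢
    refine ⟨⟨⟨f, fun x y hxy => ?_⟩, hker f⟩, hf.2⟩
    exact (mem_monoFuns.1 hf.1).2.2 x (Finset.mem_univ x) y (Finset.mem_univ y) hxy

lemma sum_fibreSum_univ {m : Finset α → ℝ} (hm : m ∅ = 0) {M : ℕ} (hM : Fintype.card α ≤ M) :
    ∑ n ∈ Finset.Icc 1 M, (-1 : ℝ) ^ (n - 1) / n * fibreSum m n Finset.univ =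
      ∑ a ∈ orp α, orpCoeff a * ∏ B ∈ a.parts, m B := by
  classical
  have hle : ∀ a : SetPart α, a.parts.card ≤ M := fun a => a.card_parts_le_card.trans (by simpa)
  -- Partitions without blocks (empty poset) may be left out of the sum: `orpCoeff` divides by `|a|
  -- = 0` and is zero there.
  have h0 : ∑ a ∈ (orp α).filter (fun a => a.parts.card ∈ Finset.Icc 1 M),
      orpCoeff a * ∏ B ∈ a.parts, m B = ∑ a ∈ orp α, orpCoeff a * ∏ B ∈ a.parts, m B := by
    refine Finset.sum_subset (Finset.filter_subset _ _) fun a ha ha' => ?_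
    simp only [Finset.mem_filter, ha, true_and, Finset.mem_Icc, hle a, and_true, not_le,
      Nat.lt_one_iff] at ha'
    simp [orpCoeff, ha']
  rw [← h0, ← Finset.sum_fiberwise_of_maps_to (g := fun a : SetPart α => a.parts.card)
    (t := Finset.Icc 1 M) (fun a ha => (Finset.mem_filter.1 ha).2)
    fun a => orpCoeff a * ∏ B ∈ a.parts, m B]
  refine Finset.sum_congr rfl fun n hn => ?_
  rw [fibreSum_univ hm, Finset.mul_sum, Finset.filter_filter]
  refine Finset.sum_congr (Finset.filter_congr fun a _ => ?_) fun a ha => ?_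
  · exact ⟨fun h => ⟨h ▸ hn, h⟩, fun h => h.2⟩
  · rw [Finset.mem_filter] at ha
    rw [orpCoeff, ha.2.2]
    ring

end Kernels

/-! ### The logarithm of a tensor series -/

/-- Raising the truncation level adds only zero terms, so a single level can serve all words of a
tensor polynomial. -/
lemma tensorLog_eq_sum {x : TensorSeries d} (hx : x [] = 1) {w : Word d} {M : ℕ}
    (hM : w.length ≤ M) : tensorLog x w =
      ∑ n ∈ Finset.Icc 1 M, (-1 : ℝ) ^ (n - 1) / n * tensorPow (x - tensorOne) n w := by
  refine Finset.sum_subset (Finset.Icc_subset_Icc_right hM) fun n hn hn' => ?_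
  simp only [Finset.mem_Icc] at hn hn'
  rw [tensorPow_eq_zero _ (by simp [hx, tensorOne]) _ _ (by omega), mul_zero]

lemma pairing_sub_right (f : TensorPoly d) (s t : TensorSeries d) :
    pairing f (s - t) = pairing f s - pairing f t := by
  simp [pairing, mul_sub, Finsupp.sum_sub]

/-- The logarithm series is paired term by term, each power becomes a sum over order-preserving
maps, and these are grouped by kernel. -/
lemma pairing_shuffleTuple_tensorLog {k : ℕ} (τ : Fin k → Word d) {x : TensorSeries d}
    (hx : x [] = 1) : pairing (shuffleTuple τ) (tensorLog x) =
      ∑ a ∈ orp (Pos τ), orpCoeff a * ∏ B ∈ a.parts, pairing (shuffleTuple (subword τ B)) x := by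
  classical
  -- This level bounds both the number of blocks of a partition of the letters and the length of
  -- every word in the shuffle polynomial.
  set M := Fintype.card (Pos τ) + (shuffleTuple τ).support.sup List.length with hMdef
  have h1 : pairing (shuffleTuple τ) (tensorLog x) = ∑ n ∈ Finset.Icc 1 M,
      (-1 : ℝ) ^ (n - 1) / n * pairing (shuffleTuple τ) (tensorPow (x - tensorOne) n) := by
    rw [← Finset.sum_congr rfl fun n _ => pairing_smul_right _ _ _, ← pairing_finsetSum_right]
    refine Finsupp.sum_congr fun w hw => ?_
    rw [tensorLog_eq_sum hx (M := M)]
    · simp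
    · exact (Finset.le_sup (f := List.length) hw).trans (Nat.le_add_left _ _)
  have h2 : ∀ n, pairing (shuffleTuple τ) (tensorPow (x - tensorOne) n) =
      fibreSum (fun B => pairing (shuffleTuple (subword τ B)) (x - tensorOne)) n Finset.univ := by
    intro n
    rw [← pairing_shuffleTuple_subword_tensorPow]
    rw [show subword τ Finset.univ = τ from funext (subword_univ τ)]
  have hone : ∀ B : Finset (Pos τ), pairing (shuffleTuple (subword τ B)) (tensorOne) =
      if B = ∅ then 1 else 0 := fun B => by
    rw [pairing_shuffleTuple_tensorOne]
    exact if_congr eq_empty_iff_subword rfl rfl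
  rw [h1, Finset.sum_congr rfl fun n _ => by rw [h2], sum_fibreSum_univ _ (by omega)]
  -- Subtracting the unit does not affect nonempty blocks; it only makes the weight of the empty
  -- block vanish, as grouping by kernels requires.
  · refine Finset.sum_congr rfl fun a _ => congrArg _ (Finset.prod_congr rfl fun B hB => ?_)
    rw [pairing_sub_right, hone, if_neg (a.ne_empty hB), sub_zero]
  · have : ∀ k : ℕ, ∀ y : TensorSeries d,
        pairing (shuffleTuple fun _ : Fin k => ([] : Word d)) y = y [] := by
      intro k y
      induction k with
      | zero => exact pairing_shuffleTuple_zero _ _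
      | succ k ih =>
        rw [pairing_shuffleTuple_succ, shuffleAdj_nil]
        exact ih
    have h3 : subword τ ∅ = fun _ => [] := by ext1 j; exact subword_empty τ j
    rw [h3, this]
    simp only [Pi.sub_apply, hx]
    simp [tensorOne]

end SigPolykay

namespace SigPolykay

/-! ### Random variables with moments of all orders -/

section AllLp

variable {Ω : Type*} [MeasurableSpace Ω] {P : Measure Ω}

/-- `Y` lies in `L^q` for every finite `q`. -/
def AllLp (Y : Ω → ℝ) (P : Measure Ω) : Prop := ∀ q : ENNReal, q ≠ ⊤ → MemLp Y q P

lemma AllLp.integrable {Y : Ω → ℝ} (h : AllLp Y P) : Integrable Y P :=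
  memLp_one_iff_integrable.1 (h 1 (by simp))

lemma AllLp.aestronglyMeasurable {Y : Ω → ℝ} (h : AllLp Y P) : AEStronglyMeasurable Y P :=
  h.integrable.aestronglyMeasurable

lemma AllLp.aemeasurable {Y : Ω → ℝ} (h : AllLp Y P) : AEMeasurable Y P :=
  h.aestronglyMeasurable.aemeasurable

lemma AllLp.add {Y Z : Ω → ℝ} (hY : AllLp Y P) (hZ : AllLp Z P) :
    AllLp (fun ω => Y ω + Z ω) P := fun q hq => (hY q hq).add (hZ q hq)

lemma AllLp.sub {Y Z : Ω → ℝ} (hY : AllLp Y P) (hZ : AllLp Z P) :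
    AllLp (fun ω => Y ω - Z ω) P := fun q hq => (hY q hq).sub (hZ q hq)

/-- Hölder's inequality with doubled exponents is what makes variables with all moments closed under
products. -/
lemma holderTriple_two_mul (q : ENNReal) : ENNReal.HolderTriple (2 * q) (2 * q) q where
  inv_add_inv_eq_inv := by
    rw [ENNReal.mul_inv (by simp) (by simp), ← add_mul, ENNReal.inv_two_add_inv_two, one_mul]

lemma AllLp.mul {Y Z : Ω → ℝ} (hY : AllLp Y P) (hZ : AllLp Z P) :
    AllLp (fun ω => Y ω * Z ω) P := fun q hq => by
  have := holderTriple_two_mul q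
  exact (hZ (2 * q) (ENNReal.mul_ne_top (by simp) hq)).mul'
    (hY (2 * q) (ENNReal.mul_ne_top (by simp) hq))

lemma AllLp.const_mul {Y : Ω → ℝ} (hY : AllLp Y P) (c : ℝ) : AllLp (fun ω => c * Y ω) P :=
  fun q hq => (hY q hq).const_mul c

lemma allLp_const [IsFiniteMeasure P] (c : ℝ) : AllLp (fun _ => c) P := fun _ _ => memLp_const c

lemma AllLp.sum {β : Type*} {s : Finset β} {Y : β → Ω → ℝ}
    (h : ∀ b ∈ s, AllLp (Y b) P) : AllLp (fun ω => ∑ b ∈ s, Y b ω) P :=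
  fun q hq => memLp_finsetSum _ fun b hb => h b hb q hq

lemma AllLp.prod [IsFiniteMeasure P] {β : Type*} {s : Finset β} {Y : β → Ω → ℝ}
    (h : ∀ b ∈ s, AllLp (Y b) P) : AllLp (fun ω => ∏ b ∈ s, Y b ω) P := by
  classical
  induction s using Finset.induction_on with
  | empty => simpa using allLp_const 1
  | insert a s ha ih =>
    simp only [Finset.prod_insert ha]
    exact (h a (by simp)).mul (ih fun b hb => h b (by simp [hb]))

lemma AllLp.comp_hasLaw {E : Type*} [MeasurableSpace E] {ν : Measure E} {X : Ω → E}
    (hX : HasLaw X ν P) {Y : E → ℝ} (hY : AllLp Y ν) : AllLp (fun ω => Y (X ω)) P := fun q hq => by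
  have h := hY q hq
  rw [← hX.map_eq] at h
  exact h.comp_of_map hX.aemeasurable

/-- All `F n` lie in every `L^q`, and `F n → c` almost surely and in every `L^q`. -/
structure TendstoAllLp (F : ℕ → Ω → ℝ) (c : ℝ) (P : Measure Ω) : Prop where
  allLp : ∀ n, AllLp (F n) P
  ae : ∀ᵐ ω ∂P, Tendsto (fun n => F n ω) atTop (𝓝 c)
  eLpNorm : ∀ q : ENNReal, 1 ≤ q → q ≠ ⊤ →
    Tendsto (fun n => eLpNorm (fun ω => F n ω - c) q P) atTop (𝓝 0)

lemma TendstoAllLp.const_mul {F : ℕ → Ω → ℝ} {a : ℝ} (hF : TendstoAllLp F a P) (c : ℝ) :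
    TendstoAllLp (fun n ω => c * F n ω) (c * a) P where
  allLp n := (hF.allLp n).const_mul c
  ae := by filter_upwards [hF.ae] with ω h1 using h1.const_mul c
  eLpNorm q hq hq' := by
    have h : ∀ n, MeasureTheory.eLpNorm (fun ω => c * F n ω - c * a) q P =
        ‖c‖ₑ * MeasureTheory.eLpNorm (fun ω => F n ω - a) q P := fun n => by
      rw [← eLpNorm_const_smul]
      congr 1
      ext ω
      simp only [Pi.smul_apply, smul_eq_mul]
      ring
    simp only [h]
    simpa using ENNReal.Tendsto.const_mul (hF.eLpNorm q hq hq') (Or.inr (by simp))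

/-- Meant for the recursion of symmetric means, which holds only once `n` exceeds the number of
factors; the remaining `n` still need their moments, hence the hypothesis on all `G n`. -/
lemma TendstoAllLp.congr_eventually {F G : ℕ → Ω → ℝ} {c : ℝ} (hF : TendstoAllLp F c P)
    (hG : ∀ n, AllLp (G n) P) (h : ∀ᶠ n in atTop, F n = G n) : TendstoAllLp G c P where
  allLp := hG
  ae := by
    filter_upwards [hF.ae] with ω hω
    exact hω.congr' (h.mono fun n hn => by rw [hn])
  eLpNorm q hq hq' := (hF.eLpNorm q hq hq').congr' (h.mono fun n hn => by rw [hn])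

lemma eLpNorm_mul_le_two_mul {q : ENNReal} {f g : Ω → ℝ} (hf : AEStronglyMeasurable f P)
    (hg : AEStronglyMeasurable g P) :
    MeasureTheory.eLpNorm (fun ω => f ω * g ω) q P ≤
      MeasureTheory.eLpNorm f (2 * q) P * MeasureTheory.eLpNorm g (2 * q) P := by
  have := holderTriple_two_mul q
  have h := eLpNorm_smul_le_mul_eLpNorm (p := 2 * q) (q := 2 * q) (r := q) hg hf
  rw [smul_eq_mul] at h
  exact h

variable [IsProbabilityMeasure P]

lemma tendstoAllLp_const_seq {u : ℕ → ℝ} {c : ℝ} (hu : Tendsto u atTop (𝓝 c)) :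
    TendstoAllLp (fun n (_ : Ω) => u n) c P where
  allLp n := allLp_const _
  ae := Eventually.of_forall fun _ => hu
  eLpNorm q hq hq' := by
    have h : ∀ n, eLpNorm (fun _ : Ω => u n - c) q P = ‖u n - c‖ₑ := fun n => by
      rw [eLpNorm_const _ (by positivity) (NeZero.ne P)]
      simp
    simp only [h]
    have := (hu.sub_const c).enorm
    simpa using this

lemma TendstoAllLp.add {F G : ℕ → Ω → ℝ} {a b : ℝ} (hF : TendstoAllLp F a P)
    (hG : TendstoAllLp G b P) : TendstoAllLp (fun n ω => F n ω + G n ω) (a + b) P where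
  allLp n := (hF.allLp n).add (hG.allLp n)
  ae := by filter_upwards [hF.ae, hG.ae] with ω h1 h2 using h1.add h2
  eLpNorm q hq hq' := by
    refine tendsto_of_tendsto_of_tendsto_of_le_of_le tendsto_const_nhds
      (by simpa using (hF.eLpNorm q hq hq').add (hG.eLpNorm q hq hq'))
      (fun _ => zero_le) fun n => ?_
    refine le_trans (le_of_eq ?_) (eLpNorm_add_le
      ((hF.allLp n).sub (allLp_const a)).aestronglyMeasurable
      ((hG.allLp n).sub (allLp_const b)).aestronglyMeasurable hq)
    congr 1
    ext ω
    simp only [Pi.add_apply]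
    ring

lemma TendstoAllLp.mul {F G : ℕ → Ω → ℝ} {a b : ℝ} (hF : TendstoAllLp F a P)
    (hG : TendstoAllLp G b P) : TendstoAllLp (fun n ω => F n ω * G n ω) (a * b) P where
  allLp n := (hF.allLp n).mul (hG.allLp n)
  ae := by filter_upwards [hF.ae, hG.ae] with ω h1 h2 using h1.mul h2
  eLpNorm q hq hq' := by
    have h2q : (1 : ENNReal) ≤ 2 * q := hq.trans (le_mul_of_one_le_left (zero_le) (by norm_num))
    have h2q' : 2 * q ≠ ⊤ := ENNReal.mul_ne_top (by simp) hq'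
    have hf := fun n => ((hF.allLp n).sub (allLp_const a))
    have hg := fun n => ((hG.allLp n).sub (allLp_const b))
    -- The bound comes from `F G - a b = (F - a) (G - b) + a (G - b) + b (F - a)`; Hölder controls
    -- the first term by norms of exponent `2 * q`.
    have hlim : Tendsto (fun n =>
        MeasureTheory.eLpNorm (fun ω => F n ω - a) (2 * q) P *
          MeasureTheory.eLpNorm (fun ω => G n ω - b) (2 * q) P +
        MeasureTheory.eLpNorm (fun ω => a * G n ω - a * b) q P +
        MeasureTheory.eLpNorm (fun ω => b * F n ω - b * a) q P) atTop (𝓝 0) := by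
      have h1 := ENNReal.Tendsto.mul (hF.eLpNorm _ h2q h2q') (Or.inr (by simp))
        (hG.eLpNorm _ h2q h2q') (Or.inr (by simp))
      simpa using (h1.add ((hG.const_mul a).eLpNorm q hq hq')).add
        ((hF.const_mul b).eLpNorm q hq hq')
    refine tendsto_of_tendsto_of_tendsto_of_le_of_le tendsto_const_nhds hlim
      (fun _ => zero_le) fun n => ?_
    have e : (fun ω => F n ω * G n ω - a * b) =
        ((fun ω => (F n ω - a) * (G n ω - b)) + fun ω => a * G n ω - a * b) +
          fun ω => b * F n ω - b * a := by
      ext ω; simp only [Pi.add_apply]; ring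
    rw [e]
    have m1 := ((hf n).mul (hg n)).aestronglyMeasurable
    have m2 := (((hG.allLp n).const_mul a).sub (allLp_const (a * b))).aestronglyMeasurable
    have m3 := (((hF.allLp n).const_mul b).sub (allLp_const (b * a))).aestronglyMeasurable
    refine (eLpNorm_add_le (m1.add m2) m3 hq).trans (add_le_add_left ?_ _)
    refine (eLpNorm_add_le m1 m2 hq).trans (add_le_add_left ?_ _)
    exact eLpNorm_mul_le_two_mul (hf n).aestronglyMeasurable (hg n).aestronglyMeasurable

lemma TendstoAllLp.sum {β : Type*} {s : Finset β} {F : β → ℕ → Ω → ℝ} {a : β → ℝ}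
    (h : ∀ b ∈ s, TendstoAllLp (F b) (a b) P) :
    TendstoAllLp (fun n ω => ∑ b ∈ s, F b n ω) (∑ b ∈ s, a b) P := by
  classical
  induction s using Finset.induction_on with
  | empty => simpa using tendstoAllLp_const_seq (u := fun _ => 0) tendsto_const_nhds
  | insert b s hb ih =>
    simp only [Finset.sum_insert hb]
    exact (h b (by simp)).add (ih fun c hc => h c (by simp [hc]))

end AllLp

/-! ### Symmetric means -/

section SymmetricMeans

variable {E : Type*}

open Classical in
/-- The average of `∏_b Y_b(x_{i_b})` over all injective choices of indices `i_b`. -/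
noncomputable def ustat {β : Type*} [Fintype β] (Y : β → E → ℝ) {n : ℕ} (x : Fin n → E) : ℝ :=
  ((n.descFactorial (Fintype.card β) : ℝ))⁻¹ * ∑ i : β ↪ Fin n, ∏ b, Y b (x (i b))

lemma ustat_congr_equiv {β γ : Type*} [Fintype β] [Fintype γ] (e : β ≃ γ) (Y : γ → E → ℝ)
    {n : ℕ} (x : Fin n → E) : ustat (fun b => Y (e b)) x = ustat Y x := by
  classical
  rw [ustat, ustat, Fintype.card_congr e]
  congr 1
  refine Fintype.sum_equiv (Equiv.embeddingCongr e (Equiv.refl _)) _ _ fun i => ?_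
  exact Fintype.prod_equiv e _ _ fun b => by simp

lemma ustat_isEmpty {β : Type*} [Fintype β] [IsEmpty β] (Y : β → E → ℝ) {n : ℕ}
    (x : Fin n → E) : ustat Y x = 1 := by
  classical
  simp [ustat]

lemma ustat_comp_perm {β : Type*} [Fintype β] (Y : β → E → ℝ) {n : ℕ} (x : Fin n → E)
    (π : Equiv.Perm (Fin n)) : ustat Y (x ∘ π) = ustat Y x := by
  classical
  rw [ustat, ustat]
  congr 1
  exact Fintype.sum_equiv (Equiv.embeddingCongr (Equiv.refl _) π) _ _ fun i => by simp

/-- The sample mean. -/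
noncomputable def sampleMean (Y : E → ℝ) {n : ℕ} (x : Fin n → E) : ℝ :=
  (n : ℝ)⁻¹ * ∑ i, Y (x i)

open Classical in
/-- The recursion for symmetric means in the number of factors. -/
lemma ustat_option {β : Type*} [Fintype β] (Y : Option β → E → ℝ) {n : ℕ}
    (hn : Fintype.card β < n) (x : Fin n → E) :
    ustat Y x = ((n : ℝ) / (n - Fintype.card β)) *
        (ustat (fun b => Y (some b)) x * sampleMean (Y none) x) +
      ∑ s, -((n : ℝ) - Fintype.card β)⁻¹ *
        ustat (fun b => if b = s then fun z => Y (some b) z * Y none z else Y (some b)) x := by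
  have hn0 : (n : ℝ) ≠ 0 := by
    have : 0 < n := by omega
    positivity
  have hnl : (n : ℝ) - Fintype.card β ≠ 0 := by
    have : (Fintype.card β : ℝ) < n := by exact_mod_cast hn
    exact (sub_pos.2 this).ne'
  have hD : (n.descFactorial (Fintype.card β) : ℝ) ≠ 0 := by
    have := Nat.descFactorial_pos.2 hn.le
    positivity
  -- Extending an injection to one more index means choosing a value outside its range: the sum over
  -- all values minus the sum over the range.
  have h1 : ∑ i : Option β ↪ Fin n, ∏ b, Y b (x (i b)) =
      ∑ i : β ↪ Fin n, (∏ b, Y (some b) (x (i b))) *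
        ((∑ y, Y none (x y)) - ∑ s, Y none (x (i s))) := by
    rw [Fintype.sum_equiv (Function.Embedding.optionEmbeddingEquiv β (Fin n)) _
      (fun p => (∏ b, Y (some b) (x (p.1 b))) * Y none (x p.2)) fun i => by
        simp [Fintype.prod_option, mul_comm]]
    rw [Fintype.sum_sigma]
    refine Finset.sum_congr rfl fun i _ => ?_
    simp only [← Finset.mul_sum]
    congr 1
    have h2 : ∑ s, Y none (x (i s)) = ∑ y ∈ Finset.univ.map i, Y none (x y) := by
      rw [Finset.sum_map]
    rw [h2, eq_sub_iff_add_eq, ← Finset.sum_compl_add_sum (Finset.univ.map i)]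
    congr 1
    symm
    refine Finset.sum_subtype _ (fun y => ?_) _
    simp
  -- A coincidence with the index of `s` merges the new factor into the factor `s`.
  have h3 : ∀ s : β, ∀ i : β ↪ Fin n,
      ∏ b, (if b = s then fun z => Y (some b) z * Y none z else Y (some b)) (x (i b)) =
        (∏ b, Y (some b) (x (i b))) * Y none (x (i s)) := by
    intro s i
    rw [← Finset.mul_prod_erase _ _ (Finset.mem_univ s),
      ← Finset.mul_prod_erase Finset.univ (fun b => Y (some b) (x (i b))) (Finset.mem_univ s)]
    rw [if_pos rfl, Finset.prod_congr rfl fun b hb => by rw [if_neg (Finset.ne_of_mem_erase hb)]]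
    ring
  simp only [ustat, sampleMean, h3, h1, Fintype.card_option, Nat.descFactorial_succ, Nat.cast_mul,
    Nat.cast_sub hn.le]
  simp only [mul_sub, Finset.sum_sub_distrib, Finset.mul_sum]
  rw [Finset.sum_comm (s := (Finset.univ : Finset (β ↪ Fin n))) (t := (Finset.univ : Finset β))]
  rw [sub_eq_add_neg, ← Finset.sum_neg_distrib]
  congr 1
  · simp only [Finset.sum_mul, Finset.mul_sum]
    rw [Finset.sum_comm]
    refine Finset.sum_congr rfl fun i _ => Finset.sum_congr rfl fun y _ => ?_
    field_simp
  · refine Finset.sum_congr rfl fun s _ => ?_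
    rw [← Finset.sum_neg_distrib]
    refine Finset.sum_congr rfl fun i _ => ?_
    field_simp

end SymmetricMeans

end SigPolykay

namespace SigPolykay

/-! ### Expectations and strong laws for symmetric means of an i.i.d. sample. -/

section Sampling

variable {E : Type*} [MeasurableSpace E] {ν : Measure E} {Ω : Type*} [MeasurableSpace Ω]
  {P : Measure Ω}

lemma allLp_ustat [IsProbabilityMeasure P] {n : ℕ} {x : Fin n → Ω → E}
    (hx : ∀ i, HasLaw (x i) ν P) {β : Type*} [Fintype β] {Y : β → E → ℝ}
    (hY : ∀ b, AllLp (Y b) ν) : AllLp (fun ω => ustat Y fun i => x i ω) P := by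
  classical
  exact (AllLp.sum fun i _ => AllLp.prod fun b _ => (hY b).comp_hasLaw (hx _)).const_mul _

lemma allLp_sampleMean [IsProbabilityMeasure P] {n : ℕ} {x : Fin n → Ω → E}
    (hx : ∀ i, HasLaw (x i) ν P) {Y : E → ℝ} (hY : AllLp Y ν) :
    AllLp (fun ω => sampleMean Y fun i => x i ω) P :=
  (AllLp.sum fun _ _ => hY.comp_hasLaw (hx _)).const_mul _

/-- Symmetric means are unbiased for products of expectations. -/
lemma integral_ustat [IsProbabilityMeasure P] {n : ℕ} {x : Fin n → Ω → E}
    (hx : ∀ i, HasLaw (x i) ν P) (hind : iIndepFun x P) {β : Type*} [Fintype β] {Y : β → E → ℝ}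
    (hY : ∀ b, AllLp (Y b) ν) (hn : Fintype.card β ≤ n) :
    ∫ ω, ustat Y (fun i => x i ω) ∂P = ∏ b, ∫ z, Y b z ∂ν := by
  classical
  simp only [ustat]
  rw [integral_const_mul, integral_finsetSum _ fun i _ =>
    (AllLp.prod fun b _ => (hY b).comp_hasLaw (hx _)).integrable]
  -- Injectivity makes the sampled variables distinct members of an independent family, so the
  -- expectation factors.
  have h : ∀ i : β ↪ Fin n, ∫ ω, ∏ b, Y b (x (i b) ω) ∂P = ∏ b, ∫ z, Y b z ∂ν := by
    intro i
    rw [(hind.precomp i.injective).integral_fun_prod_comp (fun b => (hx _).aemeasurable)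
      (fun b => by rw [(hx _).map_eq]; exact (hY b).aestronglyMeasurable)]
    refine Finset.prod_congr rfl fun b _ => ?_
    exact (hx (i b)).integral_comp (hY b).aestronglyMeasurable
  rw [Finset.sum_congr rfl fun i _ => h i, Finset.sum_const, nsmul_eq_mul, Finset.card_univ,
    Fintype.card_embedding_eq, Fintype.card_fin, ← mul_assoc, inv_mul_cancel₀, one_mul]
  have := Nat.descFactorial_pos.2 hn
  positivity

lemma HasLaw.identDistrib_comp {X X' : Ω → E} (hX : HasLaw X ν P) (hX' : HasLaw X' ν P)
    {Y : E → ℝ} (hY : AllLp Y ν) : IdentDistrib (fun ω => Y (X ω)) (fun ω => Y (X' ω)) P P where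
  aemeasurable_fst := (hY.comp_hasLaw hX).aemeasurable
  aemeasurable_snd := (hY.comp_hasLaw hX').aemeasurable
  map_eq := by
    have h : ∀ {Z : Ω → E}, HasLaw Z ν P → P.map (fun ω => Y (Z ω)) = ν.map Y := by
      intro Z hZ
      rw [← hZ.map_eq, AEMeasurable.map_map_of_aemeasurable _ hZ.aemeasurable]
      · rfl
      · rw [hZ.map_eq]; exact hY.aemeasurable
    rw [h hX, h hX']

lemma iIndepFun_comp_of_allLp {X : ℕ → Ω → E} (hX : ∀ i, HasLaw (X i) ν P) (hind : iIndepFun X P) {Y : E → ℝ}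
    (hY : AllLp Y ν) : iIndepFun (fun i ω => Y (X i ω)) P :=
  hind.comp₀ (fun _ => Y) (fun i => (hX i).aemeasurable)
    (fun i => by rw [(hX i).map_eq]; exact hY.aemeasurable)

variable [IsProbabilityMeasure P] {X : ℕ → Ω → E}

lemma tendstoAllLp_sampleMean (hX : ∀ i, HasLaw (X i) ν P) (hind : iIndepFun X P) {Y : E → ℝ}
    (hY : AllLp Y ν) :
    TendstoAllLp (fun n ω => sampleMean Y fun i : Fin n => X i ω) (∫ z, Y z ∂ν) P where
  allLp n := allLp_sampleMean (fun _ => hX _) hY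
  ae := by
    have h := strong_law_ae (μ := P) (fun i ω => Y (X i ω)) (hY.comp_hasLaw (hX 0)).integrable
      (fun i j hij => (iIndepFun_comp_of_allLp hX hind hY).indepFun hij)
      (fun i => HasLaw.identDistrib_comp (hX i) (hX 0) hY)
    have e : ∫ ω, Y (X 0 ω) ∂P = ∫ z, Y z ∂ν := (hX 0).integral_comp hY.aestronglyMeasurable
    rw [e] at h
    filter_upwards [h] with ω hω
    simpa [sampleMean, Finset.sum_range] using hω
  eLpNorm q hq hq' := by
    have h := strong_law_Lp (μ := P) hq hq' (fun i ω => Y (X i ω)) (hY.comp_hasLaw (hX 0) q hq')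
      (fun i j hij => (iIndepFun_comp_of_allLp hX hind hY).indepFun hij)
      (fun i => HasLaw.identDistrib_comp (hX i) (hX 0) hY)
    have e : ∫ ω, Y (X 0 ω) ∂P = ∫ z, Y z ∂ν := (hX 0).integral_comp hY.aestronglyMeasurable
    rw [e] at h
    simpa [sampleMean, Finset.sum_range] using h

lemma tendsto_div_sub_atTop (c : ℝ) : Tendsto (fun n : ℕ => (n : ℝ) / (n - c)) atTop (𝓝 1) := by
  have h : Tendsto (fun n : ℕ => ((n : ℝ) - c)) atTop atTop :=
    tendsto_atTop_add_const_right _ _ tendsto_natCast_atTop_atTop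
  have h2 : Tendsto (fun n : ℕ => 1 + c * ((n : ℝ) - c)⁻¹) atTop (𝓝 (1 + c * 0)) :=
    (h.inv_tendsto_atTop.const_mul c).const_add 1
  simp only [mul_zero, add_zero] at h2
  refine h2.congr' ?_
  filter_upwards [h.eventually_gt_atTop 0] with n hn
  field_simp
  ring

lemma tendsto_inv_sub_atTop (c : ℝ) : Tendsto (fun n : ℕ => ((n : ℝ) - c)⁻¹) atTop (𝓝 0) :=
  (tendsto_atTop_add_const_right _ _ tendsto_natCast_atTop_atTop).inv_tendsto_atTop

/-- The corrections in `ustat_option` have order `1/n`, which is negligible even after scaling by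
`√n`. -/
lemma tendsto_sqrt_mul_inv_sub_atTop (c : ℝ) :
    Tendsto (fun n : ℕ => √(n : ℝ) * ((n : ℝ) - c)⁻¹) atTop (𝓝 0) := by
  have h1 : Tendsto (fun n : ℕ => (√(n : ℝ))⁻¹) atTop (𝓝 0) :=
    (Real.tendsto_sqrt_atTop.comp tendsto_natCast_atTop_atTop).inv_tendsto_atTop
  have h := h1.mul (tendsto_div_sub_atTop c)
  rw [zero_mul] at h
  refine h.congr' ?_
  filter_upwards [eventually_gt_atTop 0] with n hn
  have hs : √(n : ℝ) ≠ 0 := by positivity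
  rw [div_eq_mul_inv, ← mul_assoc]
  congr 1
  rw [inv_mul_eq_div, div_eq_iff hs, Real.mul_self_sqrt (by positivity)]

/-- The strong law for symmetric means. -/
theorem tendstoAllLp_ustat (hX : ∀ i, HasLaw (X i) ν P) (hind : iIndepFun X P)
    {β : Type*} [Fintype β] (Y : β → E → ℝ) (hY : ∀ b, AllLp (Y b) ν) :
    TendstoAllLp (fun n ω => ustat Y fun i : Fin n => X i ω) (∏ b, ∫ z, Y b z ∂ν) P := by
  classical
  revert Y
  -- Induction on the number of factors; `Y` must stay general because the recursion multiplies two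
  -- of the factors together.
  refine Fintype.induction_empty_option (P := fun β _ => ∀ Y : β → E → ℝ, (∀ b, AllLp (Y b) ν) →
    TendstoAllLp (fun n ω => ustat Y fun i : Fin n => X i ω) (∏ b, ∫ z, Y b z ∂ν) P) ?_ ?_ ?_ β
  · intro β γ _ e ih Y hY
    let _ : Fintype β := Fintype.ofEquiv γ e.symm
    have h := ih (fun b => Y (e b)) fun b => hY _
    simp only [ustat_congr_equiv e] at h
    rwa [Fintype.prod_equiv e _ (fun c => ∫ z, Y c z ∂ν) fun b => rfl] at h
  · intro Y _
    simp only [ustat_isEmpty]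
    simpa using tendstoAllLp_const_seq (u := fun _ => 1) tendsto_const_nhds
  · intro β _ ih Y hY
    have hmod : ∀ s b, AllLp (if b = s then fun z => Y (some b) z * Y none z else Y (some b)) ν := by
      intro s b
      split_ifs
      · exact (hY _).mul (hY _)
      · exact hY _
    -- The leading term of the recursion has the product of the limits as its limit; the other
    -- terms, in `h2`, carry `(n - l)⁻¹` and vanish.
    have h1 := (tendstoAllLp_const_seq (P := P) (tendsto_div_sub_atTop (Fintype.card β))).mul
      ((ih (fun b => Y (some b)) fun b => hY _).mul (tendstoAllLp_sampleMean hX hind (hY none)))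
    have h2 := TendstoAllLp.sum (s := Finset.univ) fun (s : β) _ =>
      (tendstoAllLp_const_seq (P := P) (tendsto_inv_sub_atTop (Fintype.card β)).neg).mul
        (ih (fun b => if b = s then fun z => Y (some b) z * Y none z else Y (some b)) (hmod s))
    have h3 := h1.add h2
    simp only [neg_zero, zero_mul, Finset.sum_const_zero, add_zero, one_mul] at h3
    rw [Fintype.prod_option, mul_comm]
    refine h3.congr_eventually (fun n => allLp_ustat (fun _ => hX _) hY) ?_
    filter_upwards [eventually_gt_atTop (Fintype.card β)] with n hn
    ext ω
    exact (ustat_option Y hn _).symm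

/-! ### First-order expansion of symmetric means -/

/-- The first-order term of the symmetric mean of `Y` around the product of expectations. -/
noncomputable def hajek (ν : Measure E) {β : Type*} [Fintype β] (Y : β → E → ℝ) (z : E) : ℝ :=
  open Classical in
  ∑ b, (Y b z - ∫ u, Y b u ∂ν) * ∏ c ∈ Finset.univ.erase b, ∫ u, Y c u ∂ν

lemma hajek_eq {β : Type*} [Fintype β] [DecidableEq β] (Y : β → E → ℝ) (z : E) :
    hajek ν Y z =
      ∑ b, (Y b z - ∫ u, Y b u ∂ν) * ∏ c ∈ Finset.univ.erase b, ∫ u, Y c u ∂ν := by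
  unfold hajek
  congr!

lemma allLp_hajek [IsProbabilityMeasure ν] {β : Type*} [Fintype β] {Y : β → E → ℝ}
    (hY : ∀ b, AllLp (Y b) ν) : AllLp (hajek ν Y) ν := by
  classical
  exact AllLp.sum fun b _ => ((hY b).sub (allLp_const _)).mul (allLp_const _)

lemma integral_hajek [IsProbabilityMeasure ν] {β : Type*} [Fintype β] {Y : β → E → ℝ}
    (hY : ∀ b, AllLp (Y b) ν) : ∫ z, hajek ν Y z ∂ν = 0 := by
  classical
  simp only [hajek]
  rw [integral_finsetSum _ fun b _ =>
    (((hY b).sub (allLp_const _)).mul (allLp_const _)).integrable]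
  refine Finset.sum_eq_zero fun b _ => ?_
  rw [integral_mul_const, integral_sub (hY b).integrable (integrable_const _)]
  simp

lemma hajek_congr_equiv {β γ : Type*} [Fintype β] [Fintype γ] (e : β ≃ γ) (Y : γ → E → ℝ)
    (z : E) : hajek ν (fun b => Y (e b)) z = hajek ν Y z := by
  classical
  refine Fintype.sum_equiv e _ _ fun b => ?_
  congr 1
  refine Finset.prod_bij (fun c _ => e c) ?_ ?_ ?_ ?_
  · simp
  · simp
  · intro c hc
    exact ⟨e.symm c, by simpa [Equiv.symm_apply_eq] using hc, by simp⟩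
  · simp

/-- The product rule for the linearisation of a product of expectations: either one of the old
factors fluctuates or the new one does. -/
lemma hajek_option {β : Type*} [Fintype β] (Y : Option β → E → ℝ) (z : E) :
    hajek ν Y z = (∫ u, Y none u ∂ν) * hajek ν (fun b => Y (some b)) z +
      (Y none z - ∫ u, Y none u ∂ν) * ∏ b, ∫ u, Y (some b) u ∂ν := by
  classical
  rw [hajek_eq, hajek_eq, Fintype.sum_option]
  rw [add_comm, Finset.mul_sum]
  congr 1
  · refine Finset.sum_congr rfl fun b _ => ?_
    have h : (Finset.univ.erase (some b) : Finset (Option β)) =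
        insert none ((Finset.univ.erase b).map Function.Embedding.some) := by
      ext c; cases c <;> simp
    rw [h, Finset.prod_insert (by simp), Finset.prod_map]
    simp only [Function.Embedding.some_apply]
    ring
  · congr 1
    have h : (Finset.univ.erase none : Finset (Option β)) =
        Finset.univ.map Function.Embedding.some := by
      ext c; cases c <;> simp
    rw [h, Finset.prod_map]
    rfl

/-- `F n → 0` in `L¹`. -/
def TendstoZeroL1 (F : ℕ → Ω → ℝ) (P : Measure Ω) : Prop :=
  (∀ n, AllLp (F n) P) ∧ Tendsto (fun n => eLpNorm (F n) 1 P) atTop (𝓝 0)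


end Sampling

end SigPolykay

namespace SigPolykay

/-! ### First-order expansion of symmetric means and the multivariate central limit theorem. -/

section Expansion

variable {Ω : Type*} [MeasurableSpace Ω] {P : Measure Ω}

lemma TendstoZeroL1.congr_eventually {F G : ℕ → Ω → ℝ} (hF : TendstoZeroL1 F P)
    (hG : ∀ n, AllLp (G n) P) (h : ∀ᶠ n in atTop, F n = G n) : TendstoZeroL1 G P :=
  ⟨hG, hF.2.congr' (h.mono fun n hn => by rw [hn])⟩

lemma TendstoZeroL1.add {F G : ℕ → Ω → ℝ} (hF : TendstoZeroL1 F P) (hG : TendstoZeroL1 G P) :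
    TendstoZeroL1 (fun n ω => F n ω + G n ω) P := by
  refine ⟨fun n => (hF.1 n).add (hG.1 n), ?_⟩
  refine tendsto_of_tendsto_of_tendsto_of_le_of_le tendsto_const_nhds
    (by simpa using hF.2.add hG.2) (fun _ => zero_le) fun n => ?_
  exact eLpNorm_add_le (hF.1 n).aestronglyMeasurable (hG.1 n).aestronglyMeasurable le_rfl

lemma TendstoZeroL1.const_mul {F : ℕ → Ω → ℝ} (hF : TendstoZeroL1 F P) (c : ℝ) :
    TendstoZeroL1 (fun n ω => c * F n ω) P := by
  refine ⟨fun n => (hF.1 n).const_mul c, ?_⟩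
  have h : ∀ n, eLpNorm (fun ω => c * F n ω) 1 P = ‖c‖ₑ * eLpNorm (F n) 1 P := fun n =>
    eLpNorm_const_smul c (F n) 1 P
  simp only [h]
  simpa using ENNReal.Tendsto.const_mul hF.2 (Or.inr (by simp))

lemma TendstoAllLp.tendstoZeroL1 {F : ℕ → Ω → ℝ} (hF : TendstoAllLp F 0 P) : TendstoZeroL1 F P :=
  ⟨hF.allLp, by simpa using hF.eLpNorm 1 le_rfl (by simp)⟩

variable [IsProbabilityMeasure P]

lemma TendstoZeroL1.sum {β : Type*} {s : Finset β} {F : β → ℕ → Ω → ℝ}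
    (h : ∀ b ∈ s, TendstoZeroL1 (F b) P) : TendstoZeroL1 (fun n ω => ∑ b ∈ s, F b n ω) P := by
  classical
  induction s using Finset.induction_on with
  | empty => exact ⟨fun n => by simpa using allLp_const 0, by simp⟩
  | insert b s hb ih =>
    simp only [Finset.sum_insert hb]
    exact (h b (by simp)).add (ih fun c hc => h c (by simp [hc]))

variable {E : Type*} [MeasurableSpace E] {ν : Measure E} {X : ℕ → Ω → E}

/-- A mean of `n` independent copies has variance `Var / n`, so the scaled fluctuation is bounded in
`L²` uniformly in `n`. This bound makes products of two fluctuations negligible. -/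
lemma eLpNorm_sqrt_mul_sampleMean_le (hX : ∀ i, HasLaw (X i) ν P) (hind : iIndepFun X P)
    {Y : E → ℝ} (hY : AllLp Y ν) (n : ℕ) :
    eLpNorm (fun ω => √(n : ℝ) * (sampleMean Y (fun i : Fin n => X i ω) - ∫ z, Y z ∂ν)) 2 P ≤
      ENNReal.ofReal (Var[fun ω => Y (X 0 ω); P] ^ (2⁻¹ : ℝ)) := by
  have hmem : MemLp (fun ω => √(n : ℝ) *
      (sampleMean Y (fun i : Fin n => X i ω) - ∫ z, Y z ∂ν)) 2 P :=
    (((allLp_sampleMean (fun _ => hX _) hY).sub (allLp_const _)).const_mul _) 2 (by simp)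
  rcases Nat.eq_zero_or_pos n with rfl | hn
  · simp
  rw [hmem.eLpNorm_eq_integral_rpow_norm (by simp) (by simp)]
  refine ENNReal.ofReal_le_ofReal (le_of_eq ?_)
  simp only [ENNReal.toReal_ofNat]
  congr 1
  have hm : ∀ i, ∫ ω, Y (X i ω) ∂P = ∫ z, Y z ∂ν := fun i =>
    (hX i).integral_comp hY.aestronglyMeasurable
  have hmean : ∫ ω, sampleMean Y (fun i : Fin n => X i ω) ∂P = ∫ z, Y z ∂ν := by
    simp only [sampleMean]
    rw [integral_const_mul, integral_finsetSum _ fun (i : Fin n) _ => (hY.comp_hasLaw (hX i)).integrable]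
    simp only [hm]
    simp
    field_simp
  have h1 : ∫ ω, ‖√(n : ℝ) * (sampleMean Y (fun i : Fin n => X i ω) - ∫ z, Y z ∂ν)‖ ^ (2 : ℝ) ∂P =
      n * Var[fun ω => sampleMean Y (fun i : Fin n => X i ω); P] := by
    rw [variance_eq_integral (allLp_sampleMean (fun _ => hX _) hY).aemeasurable, hmean,
      ← integral_const_mul]
    refine integral_congr_ae (Eventually.of_forall fun ω => ?_)
    simp only [Real.rpow_two, Real.norm_eq_abs, sq_abs]
    rw [mul_pow, Real.sq_sqrt (by positivity)]
  rw [h1]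
  have h2 : (fun ω => sampleMean Y (fun i : Fin n => X i ω)) =
      (n : ℝ)⁻¹ • ∑ i ∈ Finset.range n, fun ω => Y (X i ω) := by
    ext ω
    simp [sampleMean, Finset.sum_range]
  rw [h2, variance_smul, IndepFun.variance_sum
    (fun i _ => hY.comp_hasLaw (hX i) 2 (by simp))
    (fun i _ j _ hij => (iIndepFun_comp_of_allLp hX hind hY).indepFun hij),
    Finset.sum_congr rfl fun i _ => (HasLaw.identDistrib_comp (hX i) (hX 0) hY).variance_eq]
  simp
  field_simp

/-- Symmetric means agree with their first-order expansion up to `o(n^{-1/2})` in `L¹`. -/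
theorem tendstoZeroL1_ustat [IsProbabilityMeasure ν] (hX : ∀ i, HasLaw (X i) ν P) (hind : iIndepFun X P)
    {β : Type*} [Fintype β] (Y : β → E → ℝ) (hY : ∀ b, AllLp (Y b) ν) :
    TendstoZeroL1 (fun n ω => √(n : ℝ) * (ustat Y (fun i : Fin n => X i ω) -
      ∏ b, ∫ z, Y b z ∂ν - sampleMean (hajek ν Y) fun i : Fin n => X i ω)) P := by
  classical
  revert Y
  refine Fintype.induction_empty_option (P := fun β _ => ∀ Y : β → E → ℝ, (∀ b, AllLp (Y b) ν) →
    TendstoZeroL1 (fun n ω => √(n : ℝ) * (ustat Y (fun i : Fin n => X i ω) -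
      ∏ b, ∫ z, Y b z ∂ν - sampleMean (hajek ν Y) fun i : Fin n => X i ω)) P) ?_ ?_ ?_ β
  · intro β γ _ e ih Y hY
    let _ : Fintype β := Fintype.ofEquiv γ e.symm
    have h := ih (fun b => Y (e b)) fun b => hY _
    have h2 : hajek ν (fun b => Y (e b)) = hajek ν Y := funext fun z => hajek_congr_equiv e Y z
    simp only [ustat_congr_equiv e, h2] at h
    rwa [Fintype.prod_equiv e _ (fun c => ∫ z, Y c z ∂ν) fun b => rfl] at h
  · intro Y _
    refine ⟨fun n => ?_, ?_⟩ <;> simp [ustat_isEmpty, sampleMean, hajek]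
    simpa using allLp_const (P := P) 0
  · intro β _ ih Y hY
    set l : ℝ := (Fintype.card β : ℝ)
    set m := ∫ z, Y none z ∂ν with hmdef
    set M := ∏ b, ∫ z, Y (some b) z ∂ν with hMdef
    let U : ℕ → Ω → ℝ := fun n ω => ustat (fun b => Y (some b)) fun i : Fin n => X i ω
    let B : ℕ → Ω → ℝ := fun n ω => sampleMean (Y none) fun i : Fin n => X i ω
    let V : β → ℕ → Ω → ℝ := fun s n ω => ustat (fun b => if b = s then
      fun z => Y (some b) z * Y none z else Y (some b)) fun i : Fin n => X i ω
    have hmod : ∀ s b, AllLp (if b = s then fun z => Y (some b) z * Y none z else Y (some b)) ν := by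
      intro s b
      split_ifs
      · exact (hY _).mul (hY _)
      · exact hY _
    have hU : TendstoAllLp U M P := tendstoAllLp_ustat hX hind _ fun b => hY _
    have hB : TendstoAllLp B m P := tendstoAllLp_sampleMean hX hind (hY none)
    have hV : ∀ s, TendstoAllLp (V s) _ P := fun s => tendstoAllLp_ustat hX hind _ (hmod s)
    have hseq := tendstoAllLp_const_seq (P := P) (tendsto_sqrt_mul_inv_sub_atTop l)
    -- The cost of replacing `n / (n - l)` by `1`, together with the coincidences of indices:
    -- bounded terms times `√n / (n - l)`.
    have hcorr : TendstoZeroL1 (fun n ω => (√(n : ℝ) * ((n : ℝ) - l)⁻¹) *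
        (l * (U n ω * B n ω) + (-1) * ∑ s, V s n ω)) P := by
      have h := hseq.mul (((hU.mul hB).const_mul l).add
        ((TendstoAllLp.sum (s := Finset.univ) fun s _ => hV s).const_mul (-1)))
      rw [zero_mul] at h
      exact h.tendstoZeroL1
    -- After scaling, the first fluctuation stays bounded in `L²` while the second tends to zero in
    -- `L²`; Cauchy-Schwarz gives `L¹`.
    have hprod : TendstoZeroL1 (fun n ω => (√(n : ℝ) * (B n ω - m)) * (U n ω - M)) P := by
      refine ⟨fun n => ((((hB.allLp n).sub (allLp_const m))).const_mul _).mul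
        ((hU.allLp n).sub (allLp_const M)), ?_⟩
      have h2 := hU.eLpNorm 2 (by norm_num) (by simp)
      refine tendsto_of_tendsto_of_tendsto_of_le_of_le tendsto_const_nhds
        (h := fun n => ENNReal.ofReal (Var[fun ω => Y none (X 0 ω); P] ^ (2⁻¹ : ℝ)) *
          eLpNorm (fun ω => U n ω - M) 2 P) ?_ (fun _ => zero_le) fun n => ?_
      · simpa using ENNReal.Tendsto.const_mul h2 (Or.inr (by simp))
      · have h3 := eLpNorm_mul_le_two_mul (P := P) (q := 1)
          ((((hB.allLp n).sub (allLp_const m))).const_mul √(n : ℝ)).aestronglyMeasurable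
          ((hU.allLp n).sub (allLp_const M)).aestronglyMeasurable
        rw [mul_one] at h3
        exact h3.trans (mul_le_mul_left (eLpNorm_sqrt_mul_sampleMean_le hX hind (hY none) n) _)
    -- With `h'` the sample mean of the linearisation of `U`, the algebra is `U B - m M - (m h' + M
    -- (B - m)) = (B - m) (U - M) + m (U - M - h')`.
    have h := (hprod.add ((ih (fun b => Y (some b)) fun b => hY _).const_mul m)).add hcorr
    refine h.congr_eventually (fun n => ((((allLp_ustat (fun _ => hX _) hY).sub
      (allLp_const _)).sub (allLp_sampleMean (fun _ => hX _) (allLp_hajek hY))).const_mul _)) ?_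
    filter_upwards [eventually_gt_atTop (Fintype.card β)] with n hn
    ext ω
    have hn0 : (n : ℝ) ≠ 0 := by
      have : 0 < n := by omega
      positivity
    have hnl : (n : ℝ) - l ≠ 0 := by
      have : l < n := by simp only [l]; exact_mod_cast hn
      exact (sub_pos.2 this).ne'
    have e1 : sampleMean (hajek ν Y) (fun i : Fin n => X i ω) =
        m * sampleMean (hajek ν fun b => Y (some b)) (fun i : Fin n => X i ω) +
          M * (B n ω - m) := by
      simp only [sampleMean, hajek_option, B, Finset.sum_add_distrib, ← Finset.mul_sum,
        ← Finset.sum_mul, Finset.sum_sub_distrib, Finset.sum_const, Finset.card_univ,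
        Fintype.card_fin, nsmul_eq_mul]
      rw [← hmdef, ← hMdef]
      field_simp
    rw [ustat_option Y hn, e1, Fintype.prod_option, ← Finset.mul_sum]
    simp only [← hmdef, ← hMdef]
    change _ = √(n : ℝ) * ((n : ℝ) / (n - l) * (U n ω * B n ω) + -((n : ℝ) - l)⁻¹ * ∑ s, V s n ω -
      m * M - _)
    change _ + m * (√(n : ℝ) * (U n ω - M - _)) + _ = _
    have e2 : (n : ℝ) / (n - l) = 1 + l * ((n : ℝ) - l)⁻¹ := by field_simp; ring
    rw [e2]
    ring

/-- A vector of statistics with first-order expansion `h` is asymptotically normal with the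
covariance of `h`. -/
theorem tendstoInDistribution_of_expansion (hX : ∀ i, HasLaw (X i) ν P) (hind : iIndepFun X P)
    {m : ℕ} {F : Fin m → ℕ → Ω → ℝ} {θ : Fin m → ℝ} {h : Fin m → E → ℝ}
    (hh : ∀ s, AllLp (h s) ν) (h0 : ∀ s, ∫ z, h s z ∂ν = 0)
    (hF : ∀ s n, AllLp (F s n) P)
    (hexp : ∀ s, TendstoZeroL1 (fun n ω => √(n : ℝ) * (F s n ω - θ s -
      sampleMean (h s) fun i : Fin n => X i ω)) P) :
    (Matrix.of fun s t => ∫ z, h s z * h t z ∂ν).PosSemidef ∧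
    TendstoInDistribution
      (fun (n : ℕ) (ω : Ω) => WithLp.toLp 2 fun s : Fin m => √(n : ℝ) * (F s n ω - θ s))
      atTop (id : EuclideanSpace ℝ (Fin m) → EuclideanSpace ℝ (Fin m)) (fun _ => P)
      (multivariateGaussian 0 (Matrix.of fun s t => ∫ z, h s z * h t z ∂ν)) := by
  set S : Matrix (Fin m) (Fin m) ℝ := Matrix.of fun s t => ∫ z, h s z * h t z ∂ν with hS
  have hcomb : ∀ t : Fin m → ℝ, AllLp (fun z => ∑ s, t s * h s z) ν := fun t =>
    AllLp.sum fun s _ => (hh s).const_mul _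
  -- The quadratic form is the second moment of a linear combination; this gives positivity and,
  -- below, the variance in the limit.
  have hquad : ∀ t : Fin m → ℝ, t ⬝ᵥ S.mulVec t = ∫ z, (∑ s, t s * h s z) ^ 2 ∂ν := by
    intro t
    simp only [sq, Finset.sum_mul_sum]
    rw [integral_finsetSum _ fun i _ => (AllLp.sum fun j _ =>
      ((hh i).const_mul _).mul ((hh j).const_mul _)).integrable]
    simp only [dotProduct, Matrix.mulVec, hS, Matrix.of_apply, Finset.mul_sum]
    refine Finset.sum_congr rfl fun i _ => ?_
    rw [integral_finsetSum _ fun j _ => (((hh i).const_mul _).mul ((hh j).const_mul _)).integrable]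
    refine Finset.sum_congr rfl fun j _ => ?_
    rw [← integral_mul_const, ← integral_const_mul]
    congr 1
    ext z
    ring
  have hpsd : S.PosSemidef := by
    refine Matrix.PosSemidef.of_dotProduct_mulVec_nonneg ?_ fun t => ?_
    · ext s t
      simp [hS, mul_comm]
    · have : star t = t := rfl
      rw [this, hquad]
      exact integral_nonneg fun z => sq_nonneg _
  refine ⟨hpsd, ?_⟩
  have hmeas : ∀ n : ℕ, AEMeasurable
      (fun ω : Ω => WithLp.toLp 2 fun s : Fin m => √(n : ℝ) * (F s n ω - θ s)) P := fun n =>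
    (WithLp.measurable_toLp 2 _).comp_aemeasurable (aemeasurable_pi_lambda _ fun s =>
      (((hF s n).sub (allLp_const _)).const_mul _).aemeasurable)
  refine ⟨hmeas, aemeasurable_id, ?_⟩
  -- Cramér-Wold: at a fixed `t` only the scalar combination with coefficients `t` matters, and the
  -- one-dimensional central limit theorem applies to it.
  refine ProbabilityMeasure.tendsto_iff_tendsto_charFun.2 fun t => ?_
  have hZ := hcomb t
  set Z : E → ℝ := fun z => ∑ s, t s * h s z with hZdef
  have hZ0 : ∫ z, Z z ∂ν = 0 := by
    rw [hZdef, integral_finsetSum _ fun s _ => ((hh s).const_mul _).integrable]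
    simp [integral_const_mul, h0]
  have hZP : ∫ ω, Z (X 0 ω) ∂P = 0 := by
    rw [← hZ0]; exact (hX 0).integral_comp hZ.aestronglyMeasurable
  have hvar : Var[fun ω => Z (X 0 ω); P] = t ⬝ᵥ S.mulVec t := by
    rw [hquad, variance_of_integral_eq_zero (hZ.comp_hasLaw (hX 0)).aemeasurable hZP]
    exact (hX 0).integral_comp (f := fun z => Z z ^ 2) (by
      simpa only [sq] using (hZ.mul hZ).aestronglyMeasurable)
  have hclt := tendstoInDistribution_inv_sqrt_mul_sum_sub (P := P)
    (X := fun i ω => Z (X i ω)) (Y := id)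
    (HasLaw.id (μ := gaussianReal 0 Var[fun ω => Z (X 0 ω); P].toNNReal))
    (hZ.comp_hasLaw (hX 0) 2 (by simp)) (iIndepFun_comp_of_allLp hX hind hZ)
    (fun i => HasLaw.identDistrib_comp (hX i) (hX 0) hZ)
  simp only [hZP, mul_zero, sub_zero] at hclt
  have hmeas2 : ∀ n : ℕ, AEMeasurable (fun ω => ∑ s, t s * (√(n : ℝ) * (F s n ω - θ s))) P :=
    fun n => (AllLp.sum fun s _ =>
      ((((hF s n).sub (allLp_const _)).const_mul _).const_mul _)).aemeasurable
  have hdist : TendstoInDistribution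
      (fun (n : ℕ) ω => ∑ s, t s * (√(n : ℝ) * (F s n ω - θ s))) atTop id (fun _ => P)
      (gaussianReal 0 Var[fun ω => Z (X 0 ω); P].toNNReal) := by
    -- The statistic and the normalised sum differ by a combination of the expansion errors, which
    -- vanishes in `L¹` and hence in probability.
    refine tendstoInDistribution_of_tendstoInMeasure_sub _ _ hclt ?_ hmeas2
    have hsum := TendstoZeroL1.sum (s := Finset.univ) fun s _ => (hexp s).const_mul (t s)
    have hmeas3 : ∀ n : ℕ, AEStronglyMeasurable
        (fun ω => (√(n : ℝ))⁻¹ * ∑ k ∈ Finset.range n, Z (X k ω)) P := fun n =>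
      ((AllLp.sum fun k _ => hZ.comp_hasLaw (hX k)).const_mul _).aestronglyMeasurable
    refine tendstoInMeasure_of_tendsto_eLpNorm one_ne_zero
      (fun n => (hmeas2 n).aestronglyMeasurable.sub (hmeas3 n)) aestronglyMeasurable_const ?_
    refine hsum.2.congr fun n => ?_
    congr 1
    ext ω
    simp only [Pi.sub_apply, Pi.zero_apply, sub_zero]
    have e : (√(n : ℝ))⁻¹ * ∑ k ∈ Finset.range n, Z (X k ω) =
        ∑ s, t s * (√(n : ℝ) * sampleMean (h s) fun i : Fin n => X i ω) := by
      simp only [sampleMean, hZdef]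
      rw [Finset.sum_comm, Finset.mul_sum]
      refine Finset.sum_congr rfl fun s _ => ?_
      rw [← Finset.mul_sum, Finset.sum_range]
      rcases Nat.eq_zero_or_pos n with rfl | hn
      · simp
      · have hs : √(n : ℝ) ≠ 0 := by positivity
        have : (n : ℝ)⁻¹ = (√(n : ℝ))⁻¹ * (√(n : ℝ))⁻¹ := by
          rw [← mul_inv, Real.mul_self_sqrt (by positivity)]
        rw [this]
        field_simp
    rw [e, ← Finset.sum_sub_distrib]
    refine Finset.sum_congr rfl fun s _ => ?_
    ring
  -- The characteristic function of the vector at `t` is that of the scalar combination at `1`.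
  have hchar := ProbabilityMeasure.tendsto_iff_tendsto_charFun.1 hdist.tendsto 1
  simp only [ProbabilityMeasure.coe_mk, Measure.map_id, charFun_gaussianReal] at hchar
  simp only [ProbabilityMeasure.coe_mk, Measure.map_id, charFun_multivariateGaussian hpsd]
  have hvn : 0 ≤ t ⬝ᵥ S.mulVec t := hvar ▸ variance_nonneg _ _
  convert hchar using 2
  · rename_i n
    rw [charFun_apply, charFun_apply, integral_map (hmeas n) (by fun_prop),
      integral_map (hmeas2 n) (by fun_prop)]
    congr 1
    ext ω
    congr 3
    simp [PiLp.inner_apply, mul_comm]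
  · rw [hvar]
    simp [hvn]

end Expansion

end SigPolykay

namespace SigPolykay

/-! ### Signature coordinates -/

section Signature

variable {d : ℕ} {p T : ℝ}

lemma signature_nil (hT : 0 < T) (x : RoughPath d p T) : signature hT x [] = 1 :=
  x.incr_nil _ _ hT

lemma pairing_shuffle_signature (hT : 0 < T) (x : RoughPath d p T) (f g : TensorPoly d) :
    pairing (shuffle f g) (signature hT x) =
      pairing f (signature hT x) * pairing g (signature hT x) :=
  x.incr_shuffle _ _ hT f g

/-- The product of the signature coordinates of the subwords in a block. -/
noncomputable def blockVar {ι : Type*} [Fintype ι] [DecidableEq ι] (hT : 0 < T) (τ : ι → Word d)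
    (B : Finset (Pos τ)) (x : RoughPath d p T) : ℝ :=
  ∏ j ∈ blockSupport τ B, signature hT x (subword τ B j)

/-- Words that miss the block contribute the coordinate at the empty word, which is `1`. -/
lemma blockVar_eq_prod {ι : Type*} [Fintype ι] [DecidableEq ι] (hT : 0 < T) (τ : ι → Word d)
    (B : Finset (Pos τ)) (x : RoughPath d p T) :
    blockVar hT τ B x = ∏ j, signature hT x (subword τ B j) := by
  refine Finset.prod_subset (Finset.subset_univ _) fun j _ hj => ?_
  have : subword τ B j = [] := by simpa [blockSupport] using hj
  rw [this, signature_nil]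

/-- The shuffle identity linearises a product of coordinates; its expectation is therefore the same
linear functional of the signature moments. -/
lemma blockVar_eq_pairing (hT : 0 < T) {k : ℕ} (τ : Fin k → Word d) (B : Finset (Pos τ))
    (x : RoughPath d p T) :
    blockVar hT τ B x = pairing (shuffleTuple (subword τ B)) (signature hT x) := by
  rw [blockVar_eq_prod, pairing_shuffleTuple_of_character (signature_nil hT x)
    (pairing_shuffle_signature hT x)]

lemma evalSample_polykay (hT : 0 < T) {ι : Type*} [Fintype ι] [DecidableEq ι] (τ : ι → Word d)
    {n : ℕ} (x : Fin n → RoughPath d p T) :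
    evalSample (polykay n τ) (fun i => signature hT (x i)) =
      ∑ a ∈ orp (Pos τ), orpCoeff a * ustat (fun B : a.parts => blockVar hT τ B.1) x := by
  classical
  simp only [evalSample, polykay, symMean, map_sum, map_mul, MvPolynomial.eval_C, map_prod,
    MvPolynomial.eval_X, ustat, blockVar, Fintype.card_coe]
variable [MeasurableSpace (RoughPath d p T)] {hT : 0 < T} {ν : Measure (RoughPath d p T)}

lemma HasSigMoments.integrable_pairing (hν : HasSigMoments hT ν) (f : TensorPoly d) :
    Integrable (fun x => pairing f (signature hT x)) ν :=
  integrable_finsetSum _ fun w _ => (hν w).const_mul _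

lemma HasSigMoments.integral_pairing (hν : HasSigMoments hT ν) (f : TensorPoly d) :
    ∫ x, pairing f (signature hT x) ∂ν = pairing f (sigMoment ν (signature hT)) := by
  simp only [pairing, Finsupp.sum]
  rw [integral_finsetSum _ fun w _ => (hν w).const_mul _]
  simp only [integral_const_mul, sigMoment]

/-- A power of a coordinate is itself a linear combination of coordinates, by the shuffle identity.
-/
lemma HasSigMoments.integrable_pow (hν : HasSigMoments hT ν) (w : Word d) (m : ℕ) :
    Integrable (fun x => signature hT x w ^ m) ν := by
  have h : ∃ f : TensorPoly d, ∀ x : RoughPath d p T,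
      pairing f (signature hT x) = signature hT x w ^ m := by
    induction m with
    | zero => exact ⟨Finsupp.single [] 1, fun x => by simp [pairing_single, signature_nil]⟩
    | succ m ih =>
      obtain ⟨f, hf⟩ := ih
      exact ⟨shuffle f (Finsupp.single w 1), fun x => by
        rw [pairing_shuffle_signature, hf, pairing_single, one_mul, pow_succ]⟩
  obtain ⟨f, hf⟩ := h
  simpa only [hf] using hν.integrable_pairing f

lemma HasSigMoments.integral_blockVar (hν : HasSigMoments hT ν) {k : ℕ} (τ : Fin k → Word d)
    (B : Finset (Pos τ)) : ∫ x, blockVar hT τ B x ∂ν =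
      pairing (shuffleTuple (subword τ B)) (sigMoment ν (signature hT)) := by
  simp only [blockVar_eq_pairing, hν.integral_pairing]

variable [IsProbabilityMeasure ν]

lemma HasSigMoments.allLp (hν : HasSigMoments hT ν) (w : Word d) :
    AllLp (fun x => signature hT x w) ν := by
  intro q hq
  obtain ⟨m, hm⟩ := exists_nat_ge q.toReal
  -- An even exponent above `q` makes the absolute value disappear; `m + 1` keeps it nonzero.
  have h1 : MemLp (fun x => signature hT x w) ((2 * (m + 1) : ℕ) : ENNReal) ν := by
    rw [← integrable_norm_rpow_iff (hν w).aestronglyMeasurable (by simp)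
      (ENNReal.natCast_ne_top _)]
    have h2 := hν.integrable_pow w (2 * (m + 1))
    refine h2.congr (Eventually.of_forall fun x => ?_)
    simp only [ENNReal.toReal_natCast, Real.rpow_natCast, Real.norm_eq_abs]
    rw [pow_mul, pow_mul, sq_abs]
  refine h1.mono_exponent ?_
  rw [← ENNReal.ofReal_toReal hq, ← ENNReal.ofReal_natCast]
  refine ENNReal.ofReal_le_ofReal (hm.trans ?_)
  push_cast
  linarith [(Nat.cast_nonneg m : (0 : ℝ) ≤ m)]

lemma HasSigMoments.allLp_blockVar (hν : HasSigMoments hT ν) {ι : Type*} [Fintype ι]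
    [DecidableEq ι] (τ : ι → Word d) (B : Finset (Pos τ)) : AllLp (blockVar hT τ B) ν :=
  AllLp.prod fun _ _ => hν.allLp _

/-- The signature cumulant functional in terms of products of moments over ordered partitions. -/
theorem HasSigMoments.estimand_eq (hν : HasSigMoments hT ν) {k : ℕ} (τ : Fin k → Word d) :
    estimand hT τ ν =
      ∑ a ∈ orp (Pos τ), orpCoeff a * ∏ B : a.parts, ∫ x, blockVar hT τ B.1 x ∂ν := by
  have h1 : sigMoment ν (signature hT) [] = 1 := by simp [sigMoment, signature_nil]
  rw [estimand, sigCumulant, pairing_shuffleTuple_tensorLog τ h1]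
  refine Finset.sum_congr rfl fun a _ => ?_
  congr 1
  rw [← Finset.prod_coe_sort]
  exact Finset.prod_congr rfl fun B _ => (hν.integral_blockVar τ B.1).symm

variable {Ω : Type*} [MeasurableSpace Ω] {P : Measure Ω} [IsProbabilityMeasure P]

lemma HasSigMoments.allLp_evalSample (hν : HasSigMoments hT ν) {n : ℕ}
    {x : Fin n → Ω → RoughPath d p T} (hx : ∀ i, HasLaw (x i) ν P)
    (g : MvPolynomial (Fin n × Word d) ℝ) :
    AllLp (fun ω => evalSample g fun i => signature hT (x i ω)) P := by
  simp only [evalSample]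
  induction g using MvPolynomial.induction_on with
  | C c => simpa using allLp_const c
  | add f g hf hg => simpa using hf.add hg
  | mul_X f v hf => simpa using hf.mul ((hν.allLp v.2).comp_hasLaw (hx v.1))

lemma HasSigMoments.allLp_blockVar_parts (hν : HasSigMoments hT ν) {ι : Type*} [Fintype ι]
    [DecidableEq ι] (τ : ι → Word d) (a : SetPart (Pos τ)) (B : a.parts) :
    AllLp (blockVar hT τ B.1) ν :=
  hν.allLp_blockVar τ B.1

/-- Here `n ≥ N_τ` enters: no partition has more blocks than there are samples, so each symmetric
mean averages over a nonempty set of injections. -/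
lemma card_parts_le_of_le {k n : ℕ} {τ : Fin k → Word d} (hn : ∑ j, (τ j).length ≤ n)
    (a : SetPart (Pos τ)) : a.parts.card ≤ n :=
  a.card_parts_le_card.trans (by simpa using hn)

/-- Signature polykays are unbiased. -/
theorem HasSigMoments.integral_polykay (hν : HasSigMoments hT ν) {n : ℕ}
    {x : Fin n → Ω → RoughPath d p T} (hx : ∀ i, HasLaw (x i) ν P) (hind : iIndepFun x P)
    {k : ℕ} (τ : Fin k → Word d) (hn : ∑ j, (τ j).length ≤ n) :
    ∫ ω, evalSample (polykay n τ) (fun i => signature hT (x i ω)) ∂P = estimand hT τ ν := by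
  simp only [evalSample_polykay]
  have hY := hν.allLp_blockVar_parts τ
  rw [integral_finsetSum _ fun a _ => ((allLp_ustat hx (hY a)).const_mul _).integrable,
    hν.estimand_eq]
  refine Finset.sum_congr rfl fun a _ => ?_
  rw [integral_const_mul, integral_ustat hx hind (hY a)]
  rw [Fintype.card_coe]
  exact card_parts_le_of_le hn a

/-- The coordinate projections of the product space are themselves an i.i.d. sample. -/
lemma isUnbiasedPolyEstimator_polykay {k : ℕ} (τ : Fin k → Word d) {n : ℕ}
    (hn : ∑ j, (τ j).length ≤ n) :
    IsUnbiasedPolyEstimator (p := p) hT n (estimand hT τ) (polykay n τ) := by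
  intro ν hν hmom
  have hx : ∀ i, HasLaw (fun x : Fin n → RoughPath d p T => x i) ν (Measure.pi fun _ => ν) :=
    fun i => (measurePreserving_eval (fun _ : Fin n => ν) i).hasLaw
  have hind : iIndepFun (fun i (x : Fin n → RoughPath d p T) => x i) (Measure.pi fun _ => ν) :=
    iIndepFun_pi (X := fun _ x => x) fun _ => aemeasurable_id
  exact ⟨(hmom.allLp_evalSample hx _).integrable, hmom.integral_polykay hx hind τ hn⟩

/-- Signature polykays converge to their estimand almost surely and in every `L^q`. -/
theorem HasSigMoments.tendstoAllLp_polykay (hν : HasSigMoments hT ν)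
    {X : ℕ → Ω → RoughPath d p T} (hX : ∀ i, HasLaw (X i) ν P) (hind : iIndepFun X P)
    {k : ℕ} (τ : Fin k → Word d) :
    TendstoAllLp (fun n => estimator hT X (polykay n τ)) (estimand hT τ ν) P := by
  have h : (fun n => estimator hT X (polykay n τ)) = fun n ω => ∑ a ∈ orp (Pos τ),
      orpCoeff a * ustat (fun B : a.parts => blockVar hT τ B.1) fun i : Fin n => X i ω := by
    ext n ω
    exact evalSample_polykay hT τ _
  rw [h, hν.estimand_eq]
  exact TendstoAllLp.sum (F := fun a n ω =>
      orpCoeff a * ustat (fun B : a.parts => blockVar hT τ B.1) fun i : Fin n => X i ω)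
    (a := fun a => orpCoeff a * ∏ B : a.parts, ∫ x, blockVar hT τ B.1 x ∂ν) fun a _ =>
    (tendstoAllLp_ustat hX hind _ (hν.allLp_blockVar_parts τ a)).const_mul _

/-- The first-order term of a signature polykay. -/
noncomputable def polykayInfluence (hT : 0 < T) (ν : Measure (RoughPath d p T)) {k : ℕ}
    (τ : Fin k → Word d) (z : RoughPath d p T) : ℝ :=
  ∑ a ∈ orp (Pos τ), orpCoeff a * hajek ν (fun B : a.parts => blockVar hT τ B.1) z

lemma HasSigMoments.allLp_polykayInfluence (hν : HasSigMoments hT ν) {k : ℕ}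
    (τ : Fin k → Word d) : AllLp (polykayInfluence hT ν τ) ν :=
  AllLp.sum (Y := fun a z => orpCoeff a * hajek ν (fun B : a.parts => blockVar hT τ B.1) z)
    fun a _ => (allLp_hajek (hν.allLp_blockVar_parts τ a)).const_mul _

lemma HasSigMoments.integral_polykayInfluence (hν : HasSigMoments hT ν) {k : ℕ}
    (τ : Fin k → Word d) : ∫ z, polykayInfluence hT ν τ z ∂ν = 0 := by
  simp only [polykayInfluence]
  rw [integral_finsetSum _ fun a _ =>
    ((allLp_hajek (hν.allLp_blockVar_parts τ a)).const_mul _).integrable]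
  refine Finset.sum_eq_zero fun a _ => ?_
  rw [integral_const_mul, integral_hajek (hν.allLp_blockVar_parts τ a), mul_zero]

/-- Polykay, estimand and influence function are combinations with the same coefficients, so the
expansions of the symmetric means add up. -/
lemma HasSigMoments.tendstoZeroL1_polykay (hν : HasSigMoments hT ν)
    {X : ℕ → Ω → RoughPath d p T} (hX : ∀ i, HasLaw (X i) ν P) (hind : iIndepFun X P)
    {k : ℕ} (τ : Fin k → Word d) :
    TendstoZeroL1 (fun n ω => √(n : ℝ) * (estimator hT X (polykay n τ) ω - estimand hT τ ν -
      sampleMean (polykayInfluence hT ν τ) fun i : Fin n => X i ω)) P := by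
  have h := TendstoZeroL1.sum (s := orp (Pos τ)) (F := fun a n ω => orpCoeff a * (√(n : ℝ) *
    (ustat (fun B : a.parts => blockVar hT τ B.1) (fun i : Fin n => X i ω) -
      ∏ B : a.parts, ∫ z, blockVar hT τ B.1 z ∂ν -
      sampleMean (hajek ν fun B : a.parts => blockVar hT τ B.1) fun i : Fin n => X i ω)))
    fun a _ => (tendstoZeroL1_ustat hX hind
    (fun B : a.parts => blockVar hT τ B.1) (hν.allLp_blockVar_parts τ a)).const_mul (orpCoeff a)
  convert h using 3 with n ω
  rw [hν.estimand_eq, estimator, evalSample_polykay]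
  have e : sampleMean (polykayInfluence hT ν τ) (fun i : Fin n => X i ω) =
      ∑ a ∈ orp (Pos τ), orpCoeff a *
        sampleMean (hajek ν fun B : a.parts => blockVar hT τ B.1) fun i : Fin n => X i ω := by
    simp only [sampleMean, polykayInfluence]
    rw [Finset.sum_comm, Finset.mul_sum]
    refine Finset.sum_congr rfl fun a _ => ?_
    rw [← Finset.mul_sum]
    ring
  rw [e, ← Finset.sum_sub_distrib, ← Finset.sum_sub_distrib, Finset.mul_sum]
  refine Finset.sum_congr rfl fun a _ => ?_
  ring

end Signature

end SigPolykay

namespace SigPolykay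

/-! ### Minimum variance -/

/-- If all the sums of `H` over functions into subsets vanish, then so does the sum over
permutations. -/
lemma sum_perm_eq_zero {n : ℕ} (hn : n ≠ 0) (H : (Fin n → Fin n) → ℝ)
    (h : ∀ S : Finset (Fin n), S.Nonempty → ∑ f ∈ Fintype.piFinset fun _ => S, H f = 0) :
    ∑ π : Equiv.Perm (Fin n), H π = 0 := by
  classical
  -- Inclusion-exclusion: the vanishing sums are weighted by `(-1)^|S|`. The empty `S` admits no
  -- functions because `n ≠ 0`.
  have h1 : ∑ S : Finset (Fin n), (-1 : ℝ) ^ S.card *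
      ∑ f ∈ Fintype.piFinset fun _ : Fin n => S, H f = 0 := by
    refine Finset.sum_eq_zero fun S _ => ?_
    rcases S.eq_empty_or_nonempty with rfl | hS
    · have : Nonempty (Fin n) := ⟨⟨0, Nat.pos_of_ne_zero hn⟩⟩
      simp
    · rw [h S hS, mul_zero]
  have h2 : ∑ S : Finset (Fin n), (-1 : ℝ) ^ S.card *
      ∑ f ∈ Fintype.piFinset fun _ : Fin n => S, H f =
      ∑ f : Fin n → Fin n, H f *
        ∑ S ∈ Finset.univ.filter (fun S => Finset.univ.image f ⊆ S), (-1 : ℝ) ^ S.card := by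
    simp only [Finset.mul_sum, Finset.sum_filter]
    rw [Finset.sum_comm' (t' := Finset.univ)
      (s' := fun f => Finset.univ.filter fun S => Finset.univ.image f ⊆ S)]
    · refine Finset.sum_congr rfl fun f _ => ?_
      rw [Finset.sum_filter]
      refine Finset.sum_congr rfl fun S _ => ?_
      split_ifs <;> ring
    · intro S f
      simp [Fintype.mem_piFinset, Finset.image_subset_iff]
  -- The alternating sum over the supersets of the image of `f` vanishes unless `f` is surjective,
  -- which on `Fin n` means a permutation.
  have h3 : ∀ R : Finset (Fin n), ∑ S ∈ Finset.univ.filter (fun S => R ⊆ S), (-1 : ℝ) ^ S.card =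
      if R = Finset.univ then (-1) ^ n else 0 := by
    intro R
    have e : ∑ S ∈ Finset.univ.filter (fun S => R ⊆ S), (-1 : ℝ) ^ S.card =
        ∑ U ∈ Rᶜ.powerset, (-1 : ℝ) ^ R.card * (-1) ^ U.card := by
      refine Finset.sum_bij' (fun S _ => S \ R) (fun U _ => R ∪ U) ?_ ?_ ?_ ?_ ?_
      · intro S _
        simp only [Finset.mem_powerset]
        intro y hy
        simp at hy ⊢
        exact hy.2
      · intro U _
        simp
      · intro S hS
        simp only [Finset.mem_filter] at hS
        exact Finset.union_sdiff_of_subset hS.2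
      · intro U hU
        rw [Finset.mem_powerset] at hU
        ext y
        have := @hU y
        simp at this ⊢
        tauto
      · intro S hS
        simp only [Finset.mem_filter] at hS
        rw [← pow_add, add_comm, Finset.card_sdiff_add_card_eq_card hS.2]
    rw [e, ← Finset.mul_sum]
    have := Finset.sum_powerset_neg_one_pow_card (x := Rᶜ)
    have h4 : ∑ U ∈ Rᶜ.powerset, (-1 : ℝ) ^ U.card = if Rᶜ = ∅ then 1 else 0 := by
      exact_mod_cast this
    rw [h4]
    simp only [Finset.compl_eq_empty_iff]
    split_ifs with hR
    · rw [hR]; simp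
    · simp
  rw [h2] at h1
  simp only [h3, mul_ite, mul_zero] at h1
  rw [← Finset.sum_filter, ← Finset.sum_mul] at h1
  have h5 := (mul_eq_zero.1 h1).resolve_right (by simp)
  rw [← h5]
  refine Finset.sum_bij (fun π _ => ⇑π) ?_ ?_ ?_ ?_
  · intro π _
    simp only [Finset.mem_filter, Finset.mem_univ, true_and]
    exact Finset.image_univ_of_surjective π.surjective
  · intro π _ σ _ h
    exact DFunLike.coe_injective h
  · intro f hf
    simp only [Finset.mem_filter, Finset.mem_univ, true_and] at hf
    have hs : Function.Surjective f := by
      intro y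
      have : y ∈ Finset.univ.image f := by rw [hf]; exact Finset.mem_univ y
      simpa using this
    exact ⟨Equiv.ofBijective f (Finite.injective_iff_bijective.1
      (Finite.injective_iff_surjective.2 hs)), Finset.mem_univ _, rfl⟩
  · intros; rfl

/-! ### Symmetrisation of unbiased estimators and comparison of variances. -/

section MinimumVariance

variable {d : ℕ} {p T : ℝ} {hT : 0 < T}

lemma evalSample_polykay_perm {k n : ℕ} (τ : Fin k → Word d) (x : Fin n → RoughPath d p T)
    (π : Equiv.Perm (Fin n)) :
    evalSample (polykay n τ) (fun i => signature hT (x (π i))) =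
      evalSample (polykay n τ) (fun i => signature hT (x i)) := by
  rw [evalSample_polykay hT τ (fun i => x (π i)), evalSample_polykay]
  exact Finset.sum_congr rfl fun a _ => congrArg _ (ustat_comp_perm _ x π)

variable [MeasurableSpace (RoughPath d p T)]

/-- Sampling uniformly from the paths `x i` with `i ∈ S` is an admissible law. Under it, the
expectation of a statistic is its average over all functions into `S`, and both statistics have the
same expectation. -/
lemma sum_piFinset_eq_zero {n : ℕ} {θ : Measure (RoughPath d p T) → ℝ}
    (hmeas : ∀ w : Word d, Measurable fun x : RoughPath d p T => signature hT x w)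
    {g g' : MvPolynomial (Fin n × Word d) ℝ} (hg : IsUnbiasedPolyEstimator (p := p) hT n θ g)
    (hg' : IsUnbiasedPolyEstimator (p := p) hT n θ g') (x : Fin n → RoughPath d p T)
    {S : Finset (Fin n)} (hS : S.Nonempty) :
    ∑ f ∈ Fintype.piFinset fun _ : Fin n => S,
      (evalSample g (fun i => signature hT (x (f i))) -
        evalSample g' (fun i => signature hT (x (f i)))) = 0 := by
  classical
  -- The uniform law lives on the indices and is pushed forward along `x`; so paths may repeat, and
  -- no measurability of points of path space is needed.
  let μ : Measure (Fin n) := (PMF.uniformOfFinset S hS).toMeasure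
  have hx : Measurable x := measurable_from_top
  let ν := μ.map x
  have hν : IsProbabilityMeasure ν := Measure.isProbabilityMeasure_map hx.aemeasurable
  have hmom : HasSigMoments hT ν := fun w =>
    (integrable_map_measure (hmeas w).aestronglyMeasurable hx.aemeasurable).2 Integrable.of_finite
  have hpi : (Measure.pi fun _ : Fin n => ν) =
      (Measure.pi fun _ : Fin n => μ).map fun f i => x (f i) :=
    (Measure.pi_map_pi fun _ => hx.aemeasurable).symm
  have hval : ∀ g, IsUnbiasedPolyEstimator (p := p) hT n θ g →
      ∑ f ∈ Fintype.piFinset (fun _ : Fin n => S),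
        evalSample g (fun i => signature hT (x (f i))) = (S.card : ℝ) ^ n * θ ν := by
    intro g hg
    obtain ⟨hi, he⟩ := hg ν hν hmom
    have hm : Measurable fun (f : Fin n → Fin n) (i : Fin n) => x (f i) := measurable_of_finite _
    rw [hpi] at hi he
    rw [integral_map hm.aemeasurable hi.aestronglyMeasurable,
      integral_fintype Integrable.of_finite] at he
    rw [← he, Finset.mul_sum, ← Finset.sum_subset (Finset.subset_univ
      (Fintype.piFinset fun _ : Fin n => S))]
    · refine Finset.sum_congr rfl fun f hf => ?_
      rw [Fintype.mem_piFinset] at hf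
      have hc : (S.card : ℝ) ≠ 0 := by
        have := hS.card_pos
        positivity
      -- Each function into `S` has weight `|S|^{-n}`; any other has a coordinate outside `S` and
      -- weight zero.
      have : (Measure.pi fun _ : Fin n => μ).real {f} = ((S.card : ℝ)⁻¹) ^ n := by
        rw [measureReal_def, Measure.pi_singleton]
        simp [μ, PMF.uniformOfFinset_apply, hf]
      rw [this, smul_eq_mul, ← mul_assoc, ← mul_pow, mul_inv_cancel₀ hc, one_pow, one_mul]
    · intro f _ hf
      simp only [Fintype.mem_piFinset, not_forall] at hf
      obtain ⟨i, hi⟩ := hf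
      have : (Measure.pi fun _ : Fin n => μ).real {f} = 0 := by
        rw [measureReal_def, Measure.pi_singleton, Finset.prod_eq_zero (Finset.mem_univ i)]
        · simp
        · simp [μ, PMF.uniformOfFinset_apply, hi]
      rw [this, zero_smul, mul_zero]
  rw [Finset.sum_sub_distrib, hval g hg, hval g' hg', sub_self]

/-- The symmetrisation of any unbiased polynomial estimator is the signature polykay. -/
lemma sum_perm_evalSample {k n : ℕ} {τ : Fin k → Word d} (hn : ∑ j, (τ j).length ≤ n)
    (hmeas : ∀ w : Word d, Measurable fun x : RoughPath d p T => signature hT x w)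
    {g : MvPolynomial (Fin n × Word d) ℝ}
    (hg : IsUnbiasedPolyEstimator (p := p) hT n (estimand hT τ) g)
    {ν : Measure (RoughPath d p T)} [IsProbabilityMeasure ν] (hν : HasSigMoments hT ν)
    (x : Fin n → RoughPath d p T) :
    ∑ π : Equiv.Perm (Fin n), evalSample g (fun i => signature hT (x (π i))) =
      n.factorial * evalSample (polykay n τ) (fun i => signature hT (x i)) := by
  have hκ := isUnbiasedPolyEstimator_polykay (p := p) (hT := hT) τ hn
  -- Without samples both statistics are constants, and unbiasedness under the given `ν` fixes both
  -- of them as its estimand.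
  rcases Nat.eq_zero_or_pos n with rfl | hpos
  · have h : ∀ g : MvPolynomial (Fin 0 × Word d) ℝ,
        IsUnbiasedPolyEstimator (p := p) hT 0 (estimand hT τ) g →
        evalSample g (fun i => signature hT (x i)) = estimand hT τ ν := by
      intro g hg
      rw [← (hg ν inferInstance hν).2]
      have : ∀ y : Fin 0 → RoughPath d p T, y = x := fun y => Subsingleton.elim _ _
      simp [this]
    have hx : ∀ π : Equiv.Perm (Fin 0), (fun i => signature hT (x (π i))) =
        fun i => signature hT (x i) := fun π => Subsingleton.elim _ _
    simp only [hx, h g hg, h _ hκ]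
    simp
  · have h := sum_perm_eq_zero hpos.ne' (fun f => evalSample g (fun i => signature hT (x (f i))) -
      evalSample (polykay n τ) (fun i => signature hT (x (f i))))
      fun S hS => sum_piFinset_eq_zero hmeas hg hκ x hS
    simp only [evalSample_polykay_perm] at h
    rw [Finset.sum_sub_distrib, sub_eq_zero] at h
    rw [h]
    simp [Finset.card_univ, Fintype.card_perm]

variable {ν : Measure (RoughPath d p T)} [IsProbabilityMeasure ν] {Ω : Type*}
  [MeasurableSpace Ω] {P : Measure Ω} [IsProbabilityMeasure P]

/-- Signature polykays have minimum variance among unbiased polynomial estimators. -/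
theorem variance_polykay_le {k n : ℕ} {τ : Fin k → Word d} (hn : ∑ j, (τ j).length ≤ n)
    (hmeas : ∀ w : Word d, Measurable fun x : RoughPath d p T => signature hT x w)
    {g : MvPolynomial (Fin n × Word d) ℝ}
    (hg : IsUnbiasedPolyEstimator (p := p) hT n (estimand hT τ) g)
    (hν : HasSigMoments hT ν) {X : ℕ → Ω → RoughPath d p T} (hX : ∀ i, HasLaw (X i) ν P)
    (hind : iIndepFun X P) :
    variance (estimator hT X (polykay n τ)) P ≤ variance (estimator hT X g) P := by
  have hL : ∀ g : MvPolynomial (Fin n × Word d) ℝ, ∀ π : Equiv.Perm (Fin n),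
      AllLp (fun ω => evalSample g fun i => signature hT (X (π i) ω)) P :=
    fun g π => hν.allLp_evalSample (fun i => hX (π i)) g
  have hE : ∀ g : MvPolynomial (Fin n × Word d) ℝ, AllLp (estimator hT X g) P := fun g => hL g 1
  -- A permuted i.i.d. sample has the same law, so all permuted versions of `g` share one second
  -- moment.
  have hlaw : ∀ π : Equiv.Perm (Fin n),
      HasLaw (fun ω (i : Fin n) => X (π i) ω) (Measure.pi fun _ => ν) P := by
    intro π
    have hinj : Function.Injective fun i : Fin n => ((π i : Fin n) : ℕ) :=
      Fin.val_injective.comp π.injective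
    refine ⟨aemeasurable_pi_lambda _ fun i => (hX _).aemeasurable, ?_⟩
    rw [(hind.precomp hinj).map_fun_eq_pi_map fun i => (hX _).aemeasurable]
    simp only [(hX _).map_eq]
  have hpi : ∀ g : MvPolynomial (Fin n × Word d) ℝ,
      AllLp (fun x : Fin n → RoughPath d p T => evalSample g fun i => signature hT (x i))
        (Measure.pi fun _ => ν) := fun g =>
    hν.allLp_evalSample (fun i => (measurePreserving_eval (fun _ : Fin n => ν) i).hasLaw) g
  have hsq : ∀ π : Equiv.Perm (Fin n),
      ∫ ω, (evalSample g fun i => signature hT (X (π i) ω)) ^ 2 ∂P =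
        ∫ ω, (estimator hT X g ω) ^ 2 ∂P := by
    have h : ∀ π : Equiv.Perm (Fin n),
        ∫ ω, (evalSample g fun i => signature hT (X (π i) ω)) ^ 2 ∂P =
        ∫ x, (evalSample g fun i => signature hT (x i)) ^ 2 ∂(Measure.pi fun _ => ν) := fun π =>
      (hlaw π).integral_comp
        (f := fun x : Fin n → RoughPath d p T => (evalSample g fun i => signature hT (x i)) ^ 2)
        (by simpa only [sq] using ((hpi g).mul (hpi g)).aestronglyMeasurable)
    intro π
    rw [h π]
    exact (h 1).symm
  have hmean : ∀ g : MvPolynomial (Fin n × Word d) ℝ,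
      IsUnbiasedPolyEstimator (p := p) hT n (estimand hT τ) g →
      ∫ ω, estimator hT X g ω ∂P = estimand hT τ ν := by
    intro g hg
    rw [← (hg ν inferInstance hν).2]
    exact (hlaw 1).integral_comp
      (f := fun x : Fin n → RoughPath d p T => evalSample g fun i => signature hT (x i))
      (hpi g).aestronglyMeasurable
  have hfac : (0 : ℝ) < n.factorial := by positivity
  have hkey : ∫ ω, (estimator hT X (polykay n τ) ω) ^ 2 ∂P ≤
      ∫ ω, (estimator hT X g ω) ^ 2 ∂P := by
    -- Cauchy-Schwarz, as the polykay is the average of the permuted versions of `g`.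
    have hpt : ∀ ω, (n.factorial : ℝ) * (estimator hT X (polykay n τ) ω) ^ 2 ≤
        ∑ π : Equiv.Perm (Fin n), (evalSample g fun i => signature hT (X (π i) ω)) ^ 2 := by
      intro ω
      have h1 := sq_sum_le_card_mul_sum_sq (s := (Finset.univ : Finset (Equiv.Perm (Fin n))))
        (f := fun π => evalSample g fun i => signature hT (X (π i) ω))
      rw [sum_perm_evalSample hn hmeas hg hν (fun i => X i ω), Finset.card_univ,
        Fintype.card_perm, Fintype.card_fin, mul_pow, sq (n.factorial : ℝ), mul_assoc] at h1
      exact le_of_mul_le_mul_left h1 hfac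
    have hint : ∀ π : Equiv.Perm (Fin n),
        Integrable (fun ω => (evalSample g fun i => signature hT (X (π i) ω)) ^ 2) P := fun π => by
      simpa only [sq] using ((hL g π).mul (hL g π)).integrable
    have hintκ : Integrable (fun ω => (estimator hT X (polykay n τ) ω) ^ 2) P := by
      simpa only [sq] using ((hE (polykay n τ)).mul (hE (polykay n τ))).integrable
    have h2 := integral_mono (hintκ.const_mul (n.factorial : ℝ))
      (integrable_finsetSum _ fun π _ => hint π) hpt
    rw [integral_const_mul, integral_finsetSum _ fun π _ => hint π,
      Finset.sum_congr rfl fun π _ => hsq π, Finset.sum_const, Finset.card_univ,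
      Fintype.card_perm, Fintype.card_fin, nsmul_eq_mul] at h2
    exact le_of_mul_le_mul_left h2 hfac
  -- The two means agree, so comparing variances is comparing second moments.
  rw [variance_eq_sub (hE (polykay n τ) 2 (by simp)), variance_eq_sub (hE g 2 (by simp))]
  have e1 := hmean g hg
  have e2 := hmean _ (isUnbiasedPolyEstimator_polykay (p := p) (hT := hT) τ hn)
  change ∫ ω, (estimator hT X (polykay n τ) ω) ^ 2 ∂P - (∫ ω, estimator hT X (polykay n τ) ω ∂P) ^ 2
    ≤ ∫ ω, (estimator hT X g ω) ^ 2 ∂P - (∫ ω, estimator hT X g ω ∂P) ^ 2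
  rw [e1, e2]
  linarith

end MinimumVariance

end SigPolykay

namespace SigPolykay

/-! ### Sums over set partitions -/

section PartitionSums

variable {α : Type*} [DecidableEq α]

/-- The set partitions of `Q`, as families of blocks. -/
def partsOf (Q : Finset α) : Finset (Finset (Finset α)) :=
  Finset.univ.image fun π : Finpartition Q => π.parts

/-- Bare families of blocks allow partitions of different sets to be united, cut and compared inside
one type. -/
lemma mem_partsOf {Q : Finset α} {p : Finset (Finset α)} :
    p ∈ partsOf Q ↔ ∅ ∉ p ∧ (p : Set (Finset α)).PairwiseDisjoint id ∧ p.sup id = Q := by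
  simp only [partsOf, Finset.mem_image, Finset.mem_univ, true_and]
  constructor
  · rintro ⟨π, rfl⟩
    exact ⟨π.empty_notMem_parts, π.disjoint, π.sup_parts⟩
  · rintro ⟨h0, h1, h2⟩
    exact ⟨⟨p, Finset.supIndep_iff_pairwiseDisjoint.2 h1, h2, h0⟩, rfl⟩

lemma sum_partsOf {M : Type*} [AddCommMonoid M] (Q : Finset α) (F : Finset (Finset α) → M) :
    ∑ p ∈ partsOf Q, F p = ∑ π : Finpartition Q, F π.parts :=
  Finset.sum_image fun _ _ _ _ h => Finpartition.ext h

lemma partsOf_empty : partsOf (∅ : Finset α) = {∅} := by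
  ext p
  rw [mem_partsOf, Finset.mem_singleton]
  constructor
  · rintro ⟨h0, -, h2⟩
    refine Finset.eq_empty_of_forall_notMem fun B hB => h0 ?_
    have : B ⊆ ∅ := h2 ▸ Finset.le_sup (f := id) hB
    rwa [Finset.subset_empty.1 this] at hB
  · rintro rfl
    simp

lemma subset_of_mem_partsOf {Q B : Finset α} {p : Finset (Finset α)} (hp : p ∈ partsOf Q)
    (hB : B ∈ p) : B ⊆ Q := by
  rw [mem_partsOf] at hp
  exact hp.2.2 ▸ Finset.le_sup (f := id) hB

lemma nonempty_of_mem_partsOf {Q B : Finset α} {p : Finset (Finset α)} (hp : p ∈ partsOf Q)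
    (hB : B ∈ p) : B.Nonempty := by
  rw [mem_partsOf] at hp
  exact Finset.nonempty_iff_ne_empty.2 fun h => hp.1 (h ▸ hB)

lemma eq_of_mem_partsOf {Q B B' : Finset α} {p : Finset (Finset α)} (hp : p ∈ partsOf Q)
    (hB : B ∈ p) (hB' : B' ∈ p) {x : α} (hx : x ∈ B) (hx' : x ∈ B') : B = B' := by
  rw [mem_partsOf] at hp
  by_contra h
  exact Finset.disjoint_left.1 (hp.2.1 hB hB' h) hx hx'

lemma exists_mem_of_mem_partsOf {Q : Finset α} {p : Finset (Finset α)} (hp : p ∈ partsOf Q)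
    {x : α} (hx : x ∈ Q) : ∃ B ∈ p, x ∈ B := by
  rw [mem_partsOf] at hp
  rw [← hp.2.2, Finset.mem_sup] at hx
  exact hx

lemma erase_mem_partsOf {Q K : Finset α} {p : Finset (Finset α)} (hp : p ∈ partsOf Q)
    (hK : K ∈ p) : p.erase K ∈ partsOf (Q \ K) := by
  have hp' := hp
  rw [mem_partsOf] at hp ⊢
  refine ⟨fun h => hp.1 (Finset.mem_of_mem_erase h),
    hp.2.1.subset (by simp), ?_⟩
  ext x
  simp only [Finset.mem_sup, Finset.mem_erase, Finset.mem_sdiff, id]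
  constructor
  · rintro ⟨B, ⟨hne, hB⟩, hx⟩
    exact ⟨subset_of_mem_partsOf hp' hB hx, fun hxK => hne (eq_of_mem_partsOf hp' hB hK hx hxK)⟩
  · rintro ⟨hxQ, hxK⟩
    obtain ⟨B, hB, hx⟩ := exists_mem_of_mem_partsOf hp' hxQ
    exact ⟨B, ⟨fun h => hxK (h ▸ hx), hB⟩, hx⟩

lemma notMem_of_mem_partsOf_sdiff {Q K : Finset α} {p : Finset (Finset α)}
    (hp : p ∈ partsOf (Q \ K)) (hK : K.Nonempty) : K ∉ p := by
  intro h
  obtain ⟨x, hx⟩ := hK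
  exact (Finset.mem_sdiff.1 (subset_of_mem_partsOf hp h hx)).2 hx

lemma insert_mem_partsOf {Q K : Finset α} {p : Finset (Finset α)} (hKQ : K ⊆ Q)
    (hK : K.Nonempty) (hp : p ∈ partsOf (Q \ K)) : insert K p ∈ partsOf Q := by
  have hp' := hp
  rw [mem_partsOf] at hp ⊢
  refine ⟨?_, ?_, ?_⟩
  · rw [Finset.mem_insert, not_or]
    exact ⟨fun h => hK.ne_empty h.symm, hp.1⟩
  · rw [Finset.coe_insert]
    refine hp.2.1.insert fun B hB _ => ?_
    refine Finset.disjoint_left.2 fun x hx hxB => ?_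
    exact (Finset.mem_sdiff.1 (subset_of_mem_partsOf hp' hB hxB)).2 hx
  · rw [Finset.sup_insert, hp.2.2]
    exact Finset.union_sdiff_of_subset hKQ

/-- Removing a distinguished block from a partition. -/
lemma sum_partsOf_sum_mem {M : Type*} [AddCommMonoid M] (Q : Finset α)
    (G : Finset α → Finset (Finset α) → M) :
    ∑ p ∈ partsOf Q, ∑ K ∈ p, G K (p.erase K) =
      ∑ K ∈ Q.powerset.filter Finset.Nonempty, ∑ p ∈ partsOf (Q \ K), G K p := by
  rw [Finset.sum_sigma', Finset.sum_sigma']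
  refine Finset.sum_bij' (fun q _ => ⟨q.2, q.1.erase q.2⟩) (fun q _ => ⟨insert q.1 q.2, q.1⟩)
    ?_ ?_ ?_ ?_ ?_
  · rintro ⟨p, K⟩ h
    simp only [Finset.mem_sigma, Finset.mem_filter, Finset.mem_powerset] at h ⊢
    exact ⟨⟨subset_of_mem_partsOf h.1 h.2, nonempty_of_mem_partsOf h.1 h.2⟩,
      erase_mem_partsOf h.1 h.2⟩
  · rintro ⟨K, p⟩ h
    simp only [Finset.mem_sigma, Finset.mem_filter, Finset.mem_powerset] at h ⊢
    exact ⟨insert_mem_partsOf h.1.1 h.1.2 h.2, Finset.mem_insert_self _ _⟩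
  · rintro ⟨p, K⟩ h
    simp only [Finset.mem_sigma] at h
    simp [Finset.insert_erase h.2]
  · rintro ⟨K, p⟩ h
    simp only [Finset.mem_sigma, Finset.mem_filter, Finset.mem_powerset] at h
    simp [Finset.erase_insert (notMem_of_mem_partsOf_sdiff h.2 h.1.2)]
  · rintro ⟨p, K⟩ _
    rfl

/-- Removing the block of a given element from a partition. -/
lemma sum_partsOf_root {M : Type*} [AddCommMonoid M] {Q : Finset α} {x : α} (hx : x ∈ Q)
    (H : Finset (Finset α) → M) :
    ∑ p ∈ partsOf Q, H p =
      ∑ K ∈ Q.powerset.filter (x ∈ ·), ∑ p ∈ partsOf (Q \ K), H (insert K p) := by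
  have h1 : ∑ p ∈ partsOf Q, H p =
      ∑ p ∈ partsOf Q, ∑ K ∈ p, if x ∈ K then H (insert K (p.erase K)) else 0 := by
    refine Finset.sum_congr rfl fun p hp => ?_
    obtain ⟨B, hB, hxB⟩ := exists_mem_of_mem_partsOf hp hx
    rw [Finset.sum_eq_single_of_mem B hB, if_pos hxB, Finset.insert_erase hB]
    intro B' hB' hne
    exact if_neg fun hx' => hne (eq_of_mem_partsOf hp hB' hB hx' hxB)
  rw [h1, sum_partsOf_sum_mem Q fun K p => if x ∈ K then H (insert K p) else 0]
  rw [Finset.sum_filter, Finset.sum_filter]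
  refine Finset.sum_congr rfl fun K _ => ?_
  by_cases hxK : x ∈ K
  · rw [if_pos ⟨x, hxK⟩, if_pos hxK]
    simp [hxK]
  · simp [hxK]

/-! ### Moments and cumulants -/

/-- The cumulant transform of a set function. -/
noncomputable def cumulantFn (m : Finset α → ℝ) (J : Finset α) : ℝ :=
  ∑ p ∈ partsOf J, (-1 : ℝ) ^ (p.card - 1) * ((p.card - 1).factorial : ℝ) * ∏ K ∈ p, m K

/-- The convolution inverse of a set function. -/
noncomputable def inverseFn (m : Finset α → ℝ) (J : Finset α) : ℝ :=
  ∑ p ∈ partsOf J, (-1 : ℝ) ^ p.card * (p.card.factorial : ℝ) * ∏ K ∈ p, m K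

lemma inverseFn_empty (m : Finset α → ℝ) : inverseFn m ∅ = 1 := by
  simp [inverseFn, partsOf_empty]

/-- A partition with `k + 1` blocks arises `k + 1` times by singling out a block, and `(k + 1)
(-1)^k k! = -(-1)^{k+1} (k + 1)!`; so the nonempty `K` cancel the term `K = ∅`. -/
lemma sum_mul_inverseFn {m : Finset α → ℝ} (hm : m ∅ = 1) {Q : Finset α} (hQ : Q.Nonempty) :
    ∑ K ∈ Q.powerset, m K * inverseFn m (Q \ K) = 0 := by
  have h1 : ∑ K ∈ Q.powerset.filter Finset.Nonempty, m K * inverseFn m (Q \ K) =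
      -inverseFn m Q := by
    simp only [inverseFn, Finset.mul_sum]
    rw [← sum_partsOf_sum_mem Q fun K p =>
      m K * ((-1 : ℝ) ^ p.card * (p.card.factorial : ℝ) * ∏ L ∈ p, m L), ← Finset.sum_neg_distrib]
    refine Finset.sum_congr rfl fun p hp => ?_
    obtain ⟨x, hx⟩ := hQ
    obtain ⟨B, hB, -⟩ := exists_mem_of_mem_partsOf hp hx
    obtain ⟨k, hk⟩ : ∃ k, p.card = k + 1 :=
      Nat.exists_eq_succ_of_ne_zero (Finset.card_ne_zero_of_mem hB)
    have h2 : ∀ K ∈ p, m K * ((-1 : ℝ) ^ (p.erase K).card * ((p.erase K).card.factorial : ℝ) *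
        ∏ L ∈ p.erase K, m L) = (-1 : ℝ) ^ k * (k.factorial : ℝ) * ∏ L ∈ p, m L := by
      intro K hK
      rw [← Finset.mul_prod_erase p m hK, Finset.card_erase_of_mem hK, hk, Nat.add_sub_cancel]
      ring
    rw [Finset.sum_congr rfl h2, Finset.sum_const, hk, nsmul_eq_mul, Nat.factorial_succ]
    push_cast
    ring
  rw [← Finset.sum_filter_add_sum_filter_not _ Finset.Nonempty, h1]
  have h3 : Q.powerset.filter (fun K => ¬ K.Nonempty) = {∅} := by
    ext K
    simp only [Finset.mem_filter, Finset.mem_powerset, Finset.not_nonempty_iff_eq_empty,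
      Finset.mem_singleton]
    exact ⟨fun h => h.2, fun h => ⟨h ▸ Finset.empty_subset _, h⟩⟩
  rw [h3, Finset.sum_singleton, hm]
  simp

/-- Once the block of `j` is removed, the cumulant weight of `p` is the weight of the convolution
inverse in the number of remaining blocks. -/
lemma cumulantFn_root (m : Finset α → ℝ) {J : Finset α} {j : α} (hj : j ∈ J) :
    cumulantFn m J = ∑ K ∈ J.powerset.filter (j ∈ ·), m K * inverseFn m (J \ K) := by
  rw [cumulantFn, sum_partsOf_root hj]
  refine Finset.sum_congr rfl fun K hK => ?_
  rw [inverseFn, Finset.mul_sum]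
  refine Finset.sum_congr rfl fun p hp => ?_
  have hKp : K ∉ p := notMem_of_mem_partsOf_sdiff hp ⟨j, (Finset.mem_filter.1 hK).2⟩
  rw [Finset.card_insert_of_notMem hKp, Finset.prod_insert hKp, Nat.add_sub_cancel]
  ring

/-- Moments in terms of cumulants, by the block of a given element. -/
lemma eq_sum_cumulantFn_root {m : Finset α → ℝ} (hm : m ∅ = 1) {J : Finset α} {j : α}
    (hj : j ∈ J) : m J = ∑ K ∈ J.powerset.filter (j ∈ ·), cumulantFn m K * m (J \ K) := by
  have h1 : ∀ K ∈ J.powerset.filter (j ∈ ·), cumulantFn m K * m (J \ K) =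
      ∑ L ∈ K.powerset.filter (j ∈ ·), m L * inverseFn m (K \ L) * m (J \ K) := by
    intro K hK
    rw [cumulantFn_root m (Finset.mem_filter.1 hK).2, Finset.sum_mul]
  rw [Finset.sum_congr rfl h1]
  -- The set `J` is split into `L`, `K \ L` and `J \ K`; fixing `L` and summing over `R = J \ K`
  -- exposes the convolution of `m` with its inverse on `J \ L`, which vanishes unless `L = J`.
  have h2 : ∑ K ∈ J.powerset.filter (j ∈ ·), ∑ L ∈ K.powerset.filter (j ∈ ·),
      m L * inverseFn m (K \ L) * m (J \ K) =
      ∑ L ∈ J.powerset.filter (j ∈ ·), ∑ R ∈ (J \ L).powerset,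
        m L * (m R * inverseFn m ((J \ L) \ R)) := by
    rw [Finset.sum_sigma', Finset.sum_sigma']
    refine Finset.sum_bij' (fun q _ => ⟨q.2, J \ q.1⟩) (fun q _ => ⟨J \ q.2, q.1⟩) ?_ ?_ ?_ ?_ ?_
    · rintro ⟨K, L⟩ h
      simp only [Finset.mem_sigma, Finset.mem_filter, Finset.mem_powerset] at h ⊢
      exact ⟨⟨h.2.1.trans h.1.1, h.2.2⟩, Finset.sdiff_subset_sdiff le_rfl h.2.1⟩
    · rintro ⟨L, R⟩ h
      simp only [Finset.mem_sigma, Finset.mem_filter, Finset.mem_powerset, Finset.mem_sdiff] at h ⊢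
      have h3 : ∀ x ∈ R, x ∈ J ∧ x ∉ L := fun x hx => Finset.mem_sdiff.1 (h.2 hx)
      refine ⟨⟨Finset.sdiff_subset, hj, fun hR => (h3 j hR).2 h.1.2⟩, fun x hx => ?_, h.1.2⟩
      exact Finset.mem_sdiff.2 ⟨h.1.1 hx, fun hR => (h3 x hR).2 hx⟩
    · rintro ⟨K, L⟩ h
      simp only [Finset.mem_sigma, Finset.mem_filter, Finset.mem_powerset] at h
      simp [Finset.sdiff_sdiff_eq_self h.1.1]
    · rintro ⟨L, R⟩ h
      simp only [Finset.mem_sigma, Finset.mem_filter, Finset.mem_powerset] at h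
      simp [Finset.sdiff_sdiff_eq_self (h.2.trans Finset.sdiff_subset)]
    · rintro ⟨K, L⟩ h
      simp only [Finset.mem_sigma, Finset.mem_filter, Finset.mem_powerset] at h
      have e : (J \ L) \ (J \ K) = K \ L := by
        ext x
        have := @h.1.1 x
        simp only [Finset.mem_sdiff]
        tauto
      simp only [e]
      ring
  rw [h2, Finset.sum_eq_single_of_mem J (by simp [hj])]
  · simp [hm, inverseFn_empty]
  · intro L hL hne
    rw [← Finset.mul_sum, sum_mul_inverseFn hm, mul_zero]
    rw [Finset.mem_filter, Finset.mem_powerset] at hL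
    exact Finset.sdiff_nonempty.2 fun h => hne (hL.1.antisymm h)

end PartitionSums

/-! ### Signature moments in terms of cumulants -/

section BlockMoments

variable {d : ℕ} {ι : Type*} [Fintype ι] [DecidableEq ι] {E : Type*} [MeasurableSpace E]

/-- The moment `𝔼[∏_j ⟨S, e_{C^j}⟩]` of a set of letters. -/
noncomputable def blockMoment (ν : Measure E) (S : E → TensorSeries d) (τ : ι → Word d)
    (C : Finset (Pos τ)) : ℝ := ∫ x, ∏ j ∈ blockSupport τ C, S x (subword τ C j) ∂ν

/-- The joint cumulant of the variables `⟨S, e_{C^j}⟩`. -/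
noncomputable def blockCumulant (ν : Measure E) (S : E → TensorSeries d) (τ : ι → Word d)
    (C : Finset (Pos τ)) : ℝ := jointCumulant ν (blockSupport τ C) fun j x => S x (subword τ C j)

lemma jointCumulant_eq (ν : Measure E) (J : Finset ι) (Y : ι → E → ℝ) :
    jointCumulant ν J Y = cumulantFn (fun K => ∫ x, ∏ j ∈ K, Y j x ∂ν) J := by
  rw [cumulantFn, sum_partsOf]
  rfl

lemma mem_blockSupport {τ : ι → Word d} {C : Finset (Pos τ)} {j : ι} :
    j ∈ blockSupport τ C ↔ ∃ x ∈ C, x.1 = j := by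
  rw [blockSupport, Finset.mem_filter, ne_eq, subword_eq_nil_iff]
  simp only [Finset.mem_univ, true_and, not_forall, not_not]
  constructor
  · rintro ⟨i, hi⟩
    exact ⟨⟨j, i⟩, hi, rfl⟩
  · rintro ⟨⟨j, i⟩, hi, rfl⟩
    exact ⟨i, hi⟩

lemma subword_congr {τ : ι → Word d} {B C : Finset (Pos τ)} {j : ι}
    (h : ∀ i, (⟨j, i⟩ : Pos τ) ∈ B ↔ (⟨j, i⟩ : Pos τ) ∈ C) : subword τ B j = subword τ C j := by
  simp only [subword, h]

lemma jointCumulant_congr {ν : Measure E} {J : Finset ι} {Y Z : ι → E → ℝ}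
    (h : ∀ j ∈ J, Y j = Z j) : jointCumulant ν J Y = jointCumulant ν J Z := by
  rw [jointCumulant_eq, jointCumulant_eq, cumulantFn, cumulantFn]
  refine Finset.sum_congr rfl fun p hp => ?_
  congr 1
  refine Finset.prod_congr rfl fun K hK => integral_congr_ae (Eventually.of_forall fun x => ?_)
  refine Finset.prod_congr rfl fun j hj => ?_
  rw [h j (subset_of_mem_partsOf hp hK hj)]

/-- `B` contains with a letter all letters of the same word that lie in `C`. -/
def KeepsWords {τ : ι → Word d} (C B : Finset (Pos τ)) : Prop :=
  ∀ x ∈ B, ∀ y ∈ C, y.1 = x.1 → y ∈ B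

open Classical in
/-- The moments of a set of letters in terms of joint cumulants. -/
lemma blockMoment_eq_sum (ν : Measure E) [IsProbabilityMeasure ν] (S : E → TensorSeries d)
    (τ : ι → Word d) (C : Finset (Pos τ)) :
    blockMoment ν S τ C = ∑ p ∈ partsOf C,
      ∏ B ∈ p, if KeepsWords C B then blockCumulant ν S τ B else 0 := by
  induction C using Finset.strongInduction with
  | H C ih =>
  rcases C.eq_empty_or_nonempty with rfl | ⟨x, hx⟩
  · have : blockSupport τ (∅ : Finset (Pos τ)) = ∅ := by
      ext j; simp [mem_blockSupport]
    simp [partsOf_empty, blockMoment, this]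
  · rw [sum_partsOf_root hx]
    have hxJ : x.1 ∈ blockSupport τ C := mem_blockSupport.2 ⟨x, hx, rfl⟩
    -- The recursion runs over sets of word indices containing that of `x`; these correspond to the
    -- sets `B ∋ x` of letters that keep words together. The normalisation `m ∅ = 1` is the total
    -- mass of `ν`.
    have h1 := eq_sum_cumulantFn_root
      (m := fun K => ∫ z, ∏ j ∈ K, S z (subword τ C j) ∂ν) (by simp) hxJ
    refine h1.trans ?_
    have hzero : ∀ B ∈ C.powerset.filter (x ∈ ·), ¬ KeepsWords C B →
        (∑ p ∈ partsOf (C \ B), ∏ B' ∈ insert B p,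
          if KeepsWords C B' then blockCumulant ν S τ B' else 0) = 0 := by
      intro B _ hB
      refine Finset.sum_eq_zero fun p _ => Finset.prod_eq_zero (Finset.mem_insert_self B p) ?_
      rw [if_neg hB]
    rw [← Finset.sum_filter_of_ne (p := KeepsWords C) fun B hB hne => by
      by_contra h; exact hne (hzero B hB h)]
    let ext (K : Finset ι) : Finset (Pos τ) := C.filter fun y => y.1 ∈ K
    have hext : ∀ K ⊆ blockSupport τ C, blockSupport τ (ext K) = K := by
      intro K hK
      ext j
      rw [mem_blockSupport]
      constructor
      · rintro ⟨y, hy, rfl⟩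
        exact (Finset.mem_filter.1 hy).2
      · intro hj
        obtain ⟨y, hy, rfl⟩ := mem_blockSupport.1 (hK hj)
        exact ⟨y, Finset.mem_filter.2 ⟨hy, hj⟩, rfl⟩
    refine Finset.sum_bij' (fun K _ => ext K) (fun B _ => blockSupport τ B) ?_ ?_ ?_ ?_ ?_
    · intro K hK
      simp only [Finset.mem_filter, Finset.mem_powerset] at hK ⊢
      refine ⟨⟨Finset.filter_subset _ _, ?_⟩, ?_⟩
      · exact Finset.mem_filter.2 ⟨hx, hK.2⟩
      · intro y hy z hz hzy
        exact Finset.mem_filter.2 ⟨hz, hzy ▸ (Finset.mem_filter.1 hy).2⟩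
    · intro B hB
      simp only [Finset.mem_filter, Finset.mem_powerset] at hB ⊢
      refine ⟨fun j hj => ?_, mem_blockSupport.2 ⟨x, hB.1.2, rfl⟩⟩
      obtain ⟨y, hy, rfl⟩ := mem_blockSupport.1 hj
      exact mem_blockSupport.2 ⟨y, hB.1.1 hy, rfl⟩
    · intro K hK
      simp only [Finset.mem_filter, Finset.mem_powerset] at hK
      exact hext K hK.1
    · intro B hB
      simp only [Finset.mem_filter, Finset.mem_powerset] at hB
      ext y
      simp only [ext, Finset.mem_filter, mem_blockSupport]
      constructor
      · rintro ⟨hy, z, hz, hzy⟩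
        exact hB.2 z hz y hy hzy.symm
      · intro hy
        exact ⟨hB.1.1 hy, y, hy, rfl⟩
    · intro K hK
      simp only [Finset.mem_filter, Finset.mem_powerset] at hK
      have hKW : KeepsWords C (ext K) := fun y hy z hz hzy =>
        Finset.mem_filter.2 ⟨hz, hzy ▸ (Finset.mem_filter.1 hy).2⟩
      have hxK : x ∈ ext K := Finset.mem_filter.2 ⟨hx, hK.2⟩
      have hcum : blockCumulant ν S τ (ext K) =
          cumulantFn (fun K => ∫ z, ∏ j ∈ K, S z (subword τ C j) ∂ν) K := by
        rw [blockCumulant, hext K hK.1, ← jointCumulant_eq]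
        refine jointCumulant_congr fun j hj => ?_
        ext z
        rw [subword_congr (C := C) fun i => by simp [ext, hj]]
      have hsupp : blockSupport τ (C \ ext K) = blockSupport τ C \ K := by
        ext j
        rw [mem_blockSupport, Finset.mem_sdiff, mem_blockSupport]
        constructor
        · rintro ⟨y, hy, rfl⟩
          simp only [ext, Finset.mem_sdiff, Finset.mem_filter, not_and] at hy
          exact ⟨⟨y, hy.1, rfl⟩, hy.2 hy.1⟩
        · rintro ⟨⟨y, hy, rfl⟩, hj⟩
          exact ⟨y, by simp [ext, hy, hj], rfl⟩
      have hmom : blockMoment ν S τ (C \ ext K) =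
          ∫ z, ∏ j ∈ blockSupport τ C \ K, S z (subword τ C j) ∂ν := by
        rw [blockMoment, hsupp]
        refine integral_congr_ae (Eventually.of_forall fun z => Finset.prod_congr rfl fun j hj => ?_)
        rw [subword_congr (C := C) fun i => by
          have := (Finset.mem_sdiff.1 hj).2
          simp [ext, this]]
      rw [← hcum, ← hmom, ih (C \ ext K) (Finset.sdiff_ssubset (Finset.filter_subset _ _) ⟨x, hxK⟩),
        Finset.mul_sum]
      refine Finset.sum_congr rfl fun p hp => ?_
      rw [Finset.prod_insert (notMem_of_mem_partsOf_sdiff hp ⟨x, hxK⟩), if_pos hKW]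
      congr 1
      -- Words of `C` lie entirely inside or outside the removed block, so not cutting words means
      -- the same in `C` and in the remainder.
      refine Finset.prod_congr rfl fun B hB => if_congr ?_ rfl rfl
      have hBs := subset_of_mem_partsOf hp hB
      constructor
      · intro h y hy z hz hzy
        refine h y hy z (Finset.mem_sdiff.2 ⟨hz, fun hzK => ?_⟩) hzy
        have hyC := Finset.mem_sdiff.1 (hBs hy)
        exact hyC.2 (hKW z hzK y hyC.1 hzy.symm)
      · intro h y hy z hz hzy
        exact h y hy z (Finset.mem_sdiff.1 hz).1 hzy

end BlockMoments

end SigPolykay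

namespace SigPolykay

/-! ### Splitting set partitions -/

section Splitting

variable {α : Type*} [DecidableEq α]

lemma mem_partsOf_of_forall {Q : Finset α} {p : Finset (Finset α)} (h0 : ∀ B ∈ p, B.Nonempty)
    (h1 : ∀ B ∈ p, ∀ B' ∈ p, ∀ x ∈ B, x ∈ B' → B = B') (h2 : ∀ x, x ∈ Q ↔ ∃ B ∈ p, x ∈ B) :
    p ∈ partsOf Q := by
  rw [mem_partsOf]
  refine ⟨fun h => Finset.not_nonempty_empty (h0 _ h), fun B hB B' hB' hne => ?_, ?_⟩
  · exact Finset.disjoint_left.2 fun x hx hx' => hne (h1 B hB B' hB' x hx hx')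
  · ext x
    rw [Finset.mem_sup, h2]
    rfl

/-- The smaller family already covers `Q`, so a further block would overlap one of its blocks.
Equality of partitions is mostly proved by this one inclusion. -/
lemma eq_of_subset_of_mem_partsOf {Q : Finset α} {p q : Finset (Finset α)} (hp : p ∈ partsOf Q)
    (hq : q ∈ partsOf Q) (h : p ⊆ q) : p = q := by
  refine h.antisymm fun B hB => ?_
  obtain ⟨x, hx⟩ := nonempty_of_mem_partsOf hq hB
  obtain ⟨A, hA, hxA⟩ := exists_mem_of_mem_partsOf hp (subset_of_mem_partsOf hq hB hx)
  rwa [eq_of_mem_partsOf hq hB (h hA) hx hxA]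

lemma union_mem_partsOf {Q U : Finset α} {q r : Finset (Finset α)} (hU : U ⊆ Q)
    (hq : q ∈ partsOf U) (hr : r ∈ partsOf (Q \ U)) : q ∪ r ∈ partsOf Q := by
  refine mem_partsOf_of_forall (fun B hB => ?_) (fun B hB B' hB' x hx hx' => ?_) fun x => ?_
  · rcases Finset.mem_union.1 hB with h | h
    exacts [nonempty_of_mem_partsOf hq h, nonempty_of_mem_partsOf hr h]
  · rcases Finset.mem_union.1 hB with h | h <;> rcases Finset.mem_union.1 hB' with h' | h'
    · exact eq_of_mem_partsOf hq h h' hx hx'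
    · exact absurd (subset_of_mem_partsOf hq h hx)
        (Finset.mem_sdiff.1 (subset_of_mem_partsOf hr h' hx')).2
    · exact absurd (subset_of_mem_partsOf hq h' hx')
        (Finset.mem_sdiff.1 (subset_of_mem_partsOf hr h hx)).2
    · exact eq_of_mem_partsOf hr h h' hx hx'
  · constructor
    · intro hx
      by_cases hxU : x ∈ U
      · obtain ⟨B, hB, hxB⟩ := exists_mem_of_mem_partsOf hq hxU
        exact ⟨B, Finset.mem_union_left _ hB, hxB⟩
      · obtain ⟨B, hB, hxB⟩ := exists_mem_of_mem_partsOf hr (Finset.mem_sdiff.2 ⟨hx, hxU⟩)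
        exact ⟨B, Finset.mem_union_right _ hB, hxB⟩
    · rintro ⟨B, hB, hx⟩
      rcases Finset.mem_union.1 hB with h | h
      exacts [hU (subset_of_mem_partsOf hq h hx), (Finset.mem_sdiff.1
        (subset_of_mem_partsOf hr h hx)).1]

lemma disjoint_of_mem_partsOf {U V : Finset α} {q r : Finset (Finset α)} (h : Disjoint U V)
    (hq : q ∈ partsOf U) (hr : r ∈ partsOf V) : Disjoint q r := by
  refine Finset.disjoint_left.2 fun B hB hB' => ?_
  obtain ⟨x, hx⟩ := nonempty_of_mem_partsOf hq hB
  exact Finset.disjoint_left.1 h (subset_of_mem_partsOf hq hB hx) (subset_of_mem_partsOf hr hB' hx)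

lemma filter_mem_partsOf {Q U : Finset α} {p : Finset (Finset α)} (hp : p ∈ partsOf Q)
    (Z : Finset α → Prop) [DecidablePred Z] (hU : ∀ x, x ∈ U ↔ ∃ B ∈ p, Z B ∧ x ∈ B) :
    p.filter Z ∈ partsOf U := by
  refine mem_partsOf_of_forall (fun B hB => nonempty_of_mem_partsOf hp (Finset.mem_filter.1 hB).1)
    (fun B hB B' hB' x hx hx' => eq_of_mem_partsOf hp (Finset.mem_filter.1 hB).1
      (Finset.mem_filter.1 hB').1 hx hx') fun x => ?_
  simp only [hU, Finset.mem_filter, and_assoc]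

/-- The blocks with a given property and the other blocks of a partition. -/
lemma sum_partsOf_split {M : Type*} [AddCommMonoid M] (Q : Finset α) (Z : Finset α → Prop)
    [DecidablePred Z] (H : Finset (Finset α) → M) :
    ∑ p ∈ partsOf Q, H p = ∑ U ∈ Q.powerset, ∑ q ∈ (partsOf U).filter (fun q => ∀ B ∈ q, Z B),
      ∑ r ∈ (partsOf (Q \ U)).filter (fun r => ∀ B ∈ r, ¬ Z B), H (q ∪ r) := by
  simp only [Finset.sum_sigma']
  refine Finset.sum_bij' (fun p _ => ⟨(p.filter Z).sup id, p.filter Z, p.filter (¬ Z ·)⟩)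
    (fun s _ => s.2.1 ∪ s.2.2) ?_ ?_ ?_ ?_ ?_
  · intro p hp
    simp only [Finset.mem_sigma, Finset.mem_filter, Finset.mem_powerset]
    refine ⟨fun x hx => ?_, ⟨?_, fun B hB => hB.2⟩, ?_, fun B hB => hB.2⟩
    · obtain ⟨B, hB, hxB⟩ := Finset.mem_sup.1 hx
      exact subset_of_mem_partsOf hp (Finset.mem_filter.1 hB).1 hxB
    · refine filter_mem_partsOf hp Z fun x => ?_
      simp only [Finset.mem_sup, Finset.mem_filter, and_assoc, id]
    · refine filter_mem_partsOf hp (¬ Z ·) fun x => ?_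
      simp only [Finset.mem_sdiff, Finset.mem_sup, Finset.mem_filter, id]
      constructor
      · rintro ⟨hx, h⟩
        obtain ⟨B, hB, hxB⟩ := exists_mem_of_mem_partsOf hp hx
        exact ⟨B, hB, fun hZ => h ⟨B, ⟨hB, hZ⟩, hxB⟩, hxB⟩
      · rintro ⟨B, hB, hZ, hx⟩
        refine ⟨subset_of_mem_partsOf hp hB hx, ?_⟩
        rintro ⟨B', ⟨hB', hZ'⟩, hx'⟩
        exact hZ (eq_of_mem_partsOf hp hB hB' hx hx' ▸ hZ')
  · rintro ⟨U, q, r⟩ h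
    simp only [Finset.mem_sigma, Finset.mem_filter, Finset.mem_powerset] at h
    exact union_mem_partsOf h.1 h.2.1.1 h.2.2.1
  · intro p _
    exact Finset.filter_union_filter_not_eq _ _
  · rintro ⟨U, q, r⟩ h
    simp only [Finset.mem_sigma, Finset.mem_filter, Finset.mem_powerset] at h
    have e1 : (q ∪ r).filter Z = q := by
      rw [Finset.filter_union, Finset.filter_true_of_mem h.2.1.2, Finset.filter_false_of_mem h.2.2.2,
        Finset.union_empty]
    have e2 : (q ∪ r).filter (¬ Z ·) = r := by
      rw [Finset.filter_union, Finset.filter_true_of_mem h.2.2.2, Finset.filter_false_of_mem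
        (fun B hB => not_not.2 (h.2.1.2 B hB)), Finset.empty_union]
    have e3 : q.sup id = U := (mem_partsOf.1 h.2.1.1).2.2
    simp only [e1, e2, e3]
  · intro p _
    simp only [Finset.filter_union_filter_not_eq]

/-- Partitions that refine a two-block partition. -/
lemma sum_partsOf_union {M : Type*} [AddCommMonoid M] {Q U : Finset α} (hU : U ⊆ Q)
    (H : Finset (Finset α) → M) :
    ∑ p ∈ (partsOf Q).filter (fun p => ∀ B ∈ p, B ⊆ U ∨ B ⊆ Q \ U), H p =
      ∑ q ∈ partsOf U, ∑ r ∈ partsOf (Q \ U), H (q ∪ r) := by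
  rw [Finset.sum_sigma']
  have hne : ∀ B : Finset α, B.Nonempty → B ⊆ U → ¬ B ⊆ Q \ U := by
    rintro B ⟨x, hx⟩ h1 h2
    exact (Finset.mem_sdiff.1 (h2 hx)).2 (h1 hx)
  refine Finset.sum_bij' (fun p _ => ⟨p.filter (· ⊆ U), p.filter (· ⊆ Q \ U)⟩)
    (fun s _ => s.1 ∪ s.2) ?_ ?_ ?_ ?_ ?_
  · intro p hp
    rw [Finset.mem_filter] at hp
    rw [Finset.mem_sigma]
    constructor
    · refine filter_mem_partsOf hp.1 _ fun x => ⟨fun hx => ?_, ?_⟩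
      · obtain ⟨B, hB, hxB⟩ := exists_mem_of_mem_partsOf hp.1 (hU hx)
        refine ⟨B, hB, (hp.2 B hB).resolve_right fun h => ?_, hxB⟩
        exact (Finset.mem_sdiff.1 (h hxB)).2 hx
      · rintro ⟨B, -, h, hx⟩
        exact h hx
    · refine filter_mem_partsOf hp.1 _ fun x => ⟨fun hx => ?_, ?_⟩
      · obtain ⟨B, hB, hxB⟩ := exists_mem_of_mem_partsOf hp.1 (Finset.mem_sdiff.1 hx).1
        refine ⟨B, hB, (hp.2 B hB).resolve_left fun h => ?_, hxB⟩
        exact (Finset.mem_sdiff.1 hx).2 (h hxB)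
      · rintro ⟨B, -, h, hx⟩
        exact h hx
  · rintro ⟨q, r⟩ h
    rw [Finset.mem_sigma] at h
    rw [Finset.mem_filter]
    refine ⟨union_mem_partsOf hU h.1 h.2, fun B hB => ?_⟩
    exact (Finset.mem_union.1 hB).imp (subset_of_mem_partsOf h.1) (subset_of_mem_partsOf h.2)
  · intro p hp
    rw [Finset.mem_filter] at hp
    rw [← Finset.filter_or, Finset.filter_true_of_mem hp.2]
  · rintro ⟨q, r⟩ h
    rw [Finset.mem_sigma] at h
    have e1 : (q ∪ r).filter (· ⊆ U) = q := by
      rw [Finset.filter_union, Finset.filter_true_of_mem fun B => subset_of_mem_partsOf h.1,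
        Finset.filter_false_of_mem fun B hB hBU => hne B (nonempty_of_mem_partsOf h.2 hB) hBU
          (subset_of_mem_partsOf h.2 hB), Finset.union_empty]
    have e2 : (q ∪ r).filter (· ⊆ Q \ U) = r := by
      rw [Finset.filter_union, Finset.filter_true_of_mem (s := r) fun B => subset_of_mem_partsOf h.2,
        Finset.filter_false_of_mem fun B hB => hne B (nonempty_of_mem_partsOf h.1 hB)
          (subset_of_mem_partsOf h.1 hB), Finset.empty_union]
    simp only [e1, e2]
  · intro p hp
    rw [Finset.mem_filter] at hp
    rw [← Finset.filter_or, Finset.filter_true_of_mem hp.2]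

lemma map_mem_partsOf {β : Type*} [DecidableEq β] (e : α ↪ β) {Q : Finset α}
    {p : Finset (Finset α)} (hp : p ∈ partsOf Q) :
    p.map (Finset.mapEmbedding e).toEmbedding ∈ partsOf (Q.map e) := by
  refine mem_partsOf_of_forall ?_ ?_ ?_
  · simp only [Finset.forall_mem_map]
    intro B hB
    exact (nonempty_of_mem_partsOf hp hB).map
  · simp only [Finset.forall_mem_map]
    intro B hB B' hB' y hy hy'
    obtain ⟨x, hx, rfl⟩ := Finset.mem_map.1 hy
    rw [eq_of_mem_partsOf hp hB hB' hx (by simpa using hy')]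
  · intro y
    simp only [Finset.mem_map, RelEmbedding.coe_toEmbedding, Finset.mapEmbedding_apply,
      exists_exists_and_eq_and]
    constructor
    · rintro ⟨x, hx, rfl⟩
      obtain ⟨B, hB, hxB⟩ := exists_mem_of_mem_partsOf hp hx
      exact ⟨B, hB, x, hxB, rfl⟩
    · rintro ⟨B, hB, x, hx, rfl⟩
      exact ⟨x, subset_of_mem_partsOf hp hB hx, rfl⟩

lemma partsOf_map {β : Type*} [DecidableEq β] (e : α ↪ β) (Q : Finset α) :
    partsOf (Q.map e) =
      (partsOf Q).map (Finset.mapEmbedding (Finset.mapEmbedding e).toEmbedding).toEmbedding := by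
  ext p
  rw [Finset.mem_map]
  constructor
  · intro hp
    have hpre : ∀ B ∈ p, (Q.filter fun x => e x ∈ B).map e = B := by
      intro B hB
      ext y
      simp only [Finset.mem_map, Finset.mem_filter]
      constructor
      · rintro ⟨x, hx, rfl⟩
        exact hx.2
      · intro hy
        obtain ⟨x, hx, rfl⟩ := Finset.mem_map.1 (subset_of_mem_partsOf hp hB hy)
        exact ⟨x, ⟨hx, hy⟩, rfl⟩
    refine ⟨p.image fun B => Q.filter fun x => e x ∈ B, mem_partsOf_of_forall ?_ ?_ ?_, ?_⟩
    · simp only [Finset.forall_mem_image]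
      intro B hB
      have := nonempty_of_mem_partsOf hp hB
      rwa [← hpre B hB, Finset.map_nonempty] at this
    · simp only [Finset.forall_mem_image, Finset.mem_filter]
      intro B hB B' hB' x hx hx'
      rw [eq_of_mem_partsOf hp hB hB' hx.2 hx'.2]
    · intro x
      simp only [Finset.mem_image, exists_exists_and_eq_and, Finset.mem_filter]
      constructor
      · intro hx
        obtain ⟨B, hB, h⟩ := exists_mem_of_mem_partsOf hp (Finset.mem_map_of_mem e hx)
        exact ⟨B, hB, hx, h⟩
      · rintro ⟨B, -, hx, -⟩
        exact hx
    · ext B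
      simp only [RelEmbedding.coe_toEmbedding, Finset.mapEmbedding_apply, Finset.mem_map,
        Finset.mem_image, exists_exists_and_eq_and]
      constructor
      · rintro ⟨B', hB', rfl⟩
        rwa [hpre B' hB']
      · intro hB
        exact ⟨B, hB, hpre B hB⟩
  · rintro ⟨q, hq, rfl⟩
    exact map_mem_partsOf e hq

lemma cumulantFn_map {β : Type*} [DecidableEq β] (e : α ↪ β) (m : Finset β → ℝ) (Q : Finset α) :
    cumulantFn m (Q.map e) = cumulantFn (fun K => m (K.map e)) Q := by
  simp [cumulantFn, partsOf_map]

end Splitting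

/-! ### Sums of products over partitions that keep words together -/

section PartMoments

variable {d : ℕ} {ι : Type*} [DecidableEq ι] {τ : ι → Word d} {R : Type*} [CommRing R]

/-- As `U` contains with a letter all letters of its word in `Q`, nothing outside `U` can be missing
from `B`. -/
lemma keepsWords_iff {Q U B : Finset (Pos τ)} (h : KeepsWords Q U) (hU : U ⊆ Q) (hB : B ⊆ U) :
    KeepsWords Q B ↔ KeepsWords U B :=
  ⟨fun h' x hx y hy hyx => h' x hx y (hU hy) hyx,
    fun h' x hx y hy hyx => h' x hx y (h x (hB hx) y hy hyx) hyx⟩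

lemma KeepsWords.sdiff {Q U : Finset (Pos τ)} (h : KeepsWords Q U) :
    KeepsWords Q (Q \ U) := fun x hx y hy hyx =>
  Finset.mem_sdiff.2 ⟨hy, fun hyU => (Finset.mem_sdiff.1 hx).2
    (h y hyU x (Finset.mem_sdiff.1 hx).1 hyx.symm)⟩

open Classical in
/-- The sum of `∏_B g(B)` over the partitions of `C` that do not cut a word. -/
noncomputable def partMoment (g : Finset (Pos τ) → R) (C : Finset (Pos τ)) : R :=
  ∑ p ∈ partsOf C, ∏ B ∈ p, if KeepsWords C B then g B else 0

/-- `B` meets both `P` and its complement. -/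
def Mixed {α : Type*} (P B : Finset α) : Prop := (∃ x ∈ B, x ∈ P) ∧ ∃ x ∈ B, x ∉ P

open Classical in
/-- The part of `partMoment g C` from partitions into mixed blocks. -/
noncomputable def mixedMoment (P : Finset (Pos τ)) (g : Finset (Pos τ) → R)
    (C : Finset (Pos τ)) : R :=
  ∑ p ∈ (partsOf C).filter (fun p => ∀ B ∈ p, Mixed P B),
    ∏ B ∈ p, if KeepsWords C B then g B else 0

lemma mixedMoment_empty (P : Finset (Pos τ)) (g : Finset (Pos τ) → R) :
    mixedMoment P g ∅ = 1 := by
  simp [mixedMoment, partsOf_empty, Finset.filter_singleton]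

lemma mixedMoment_eq_zero {P C : Finset (Pos τ)} (g : Finset (Pos τ) → R) (hC : C.Nonempty)
    (h : ¬ Mixed P C) : mixedMoment P g C = 0 := by
  classical
  rw [mixedMoment]
  refine Finset.sum_eq_zero fun p hp => absurd ?_ h
  rw [Finset.mem_filter] at hp
  obtain ⟨x, hx⟩ := hC
  obtain ⟨B, hB, -⟩ := exists_mem_of_mem_partsOf hp.1 hx
  obtain ⟨⟨y, hy, hyP⟩, ⟨z, hz, hzP⟩⟩ := hp.2 B hB
  exact ⟨⟨y, subset_of_mem_partsOf hp.1 hB hy, hyP⟩, ⟨z, subset_of_mem_partsOf hp.1 hB hz, hzP⟩⟩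

open Classical in
-- Blocks that are not mixed lie in `P` or in its complement, so these partitions are pairs of
-- partitions of the two sides. By `hP` the set `P` is made of whole words, hence the condition on
-- words splits too.
lemma sum_not_mixed {P : Finset (Pos τ)} (hP : ∀ x y : Pos τ, x.1 = y.1 → x ∈ P → y ∈ P)
    (g : Finset (Pos τ) → R) (C : Finset (Pos τ)) :
    (∑ p ∈ (partsOf C).filter (fun p => ∀ B ∈ p, ¬ Mixed P B),
      ∏ B ∈ p, if KeepsWords C B then g B else 0) =
      partMoment g (C ∩ P) * partMoment g (C \ P) := by
  have hU : C ∩ P ⊆ C := Finset.inter_subset_left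
  have hKW : KeepsWords C (C ∩ P) := fun x hx y hy hyx =>
    Finset.mem_inter.2 ⟨hy, hP x y hyx.symm (Finset.mem_inter.1 hx).2⟩
  have hKW' := hKW.sdiff
  have hfilter : (partsOf C).filter (fun p => ∀ B ∈ p, ¬ Mixed P B) =
      (partsOf C).filter (fun p => ∀ B ∈ p, B ⊆ C ∩ P ∨ B ⊆ C \ (C ∩ P)) := by
    refine Finset.filter_congr fun p hp => forall₂_congr fun B hB => ?_
    have hBC := subset_of_mem_partsOf hp hB
    constructor
    · intro h
      by_cases hx : ∃ x ∈ B, x ∈ P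
      · left
        intro y hy
        by_contra hyP
        exact h ⟨hx, y, hy, fun h' => hyP (Finset.mem_inter.2 ⟨hBC hy, h'⟩)⟩
      · right
        intro y hy
        exact Finset.mem_sdiff.2 ⟨hBC hy, fun h' => hx ⟨y, hy, (Finset.mem_inter.1 h').2⟩⟩
    · rintro (h | h) ⟨⟨y, hy, hyP⟩, ⟨z, hz, hzP⟩⟩
      · exact hzP (Finset.mem_inter.1 (h hz)).2
      · exact (Finset.mem_sdiff.1 (h hy)).2 (Finset.mem_inter.2 ⟨hBC hy, hyP⟩)
  rw [hfilter, sum_partsOf_union hU, ← Finset.sdiff_inter_self_left C P, partMoment, partMoment,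
    Finset.sum_mul_sum]
  refine Finset.sum_congr rfl fun q hq => Finset.sum_congr rfl fun r hr => ?_
  rw [Finset.prod_union (disjoint_of_mem_partsOf Finset.disjoint_sdiff hq hr)]
  congr 1
  · exact Finset.prod_congr rfl fun B hB =>
      if_congr (keepsWords_iff hKW hU (subset_of_mem_partsOf hq hB)) rfl rfl
  · exact Finset.prod_congr rfl fun B hB =>
      if_congr (keepsWords_iff hKW' Finset.sdiff_subset (subset_of_mem_partsOf hr hB)) rfl rfl

open Classical in
/-- Separating the mixed blocks of the partitions of `C`. -/
lemma partMoment_eq_sum_mixedMoment {P : Finset (Pos τ)}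
    (hP : ∀ x y : Pos τ, x.1 = y.1 → x ∈ P → y ∈ P) (g : Finset (Pos τ) → R)
    (C : Finset (Pos τ)) :
    partMoment g C = ∑ U ∈ C.powerset.filter (KeepsWords C ·),
      mixedMoment P g U * (partMoment g ((C \ U) ∩ P) * partMoment g ((C \ U) \ P)) := by
  rw [partMoment, sum_partsOf_split C (Mixed P), Finset.sum_filter]
  refine Finset.sum_congr rfl fun U hU => ?_
  rw [Finset.mem_powerset] at hU
  split_ifs with hKW
  · rw [← sum_not_mixed hP, mixedMoment, Finset.sum_mul_sum]
    refine Finset.sum_congr rfl fun q hq => Finset.sum_congr rfl fun r hr => ?_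
    rw [Finset.mem_filter] at hq hr
    rw [Finset.prod_union (disjoint_of_mem_partsOf Finset.disjoint_sdiff hq.1 hr.1)]
    congr 1
    · exact Finset.prod_congr rfl fun B hB =>
        if_congr (keepsWords_iff hKW hU (subset_of_mem_partsOf hq.1 hB)) rfl rfl
    · exact Finset.prod_congr rfl fun B hB => if_congr
        (keepsWords_iff (hKW.sdiff) Finset.sdiff_subset (subset_of_mem_partsOf hr.1 hB)) rfl rfl
  -- If the union `U` of the mixed blocks cuts a word, then so does one of these blocks, and its
  -- factor is zero.
  · refine Finset.sum_eq_zero fun q hq => Finset.sum_eq_zero fun r _ => ?_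
    rw [Finset.mem_filter] at hq
    by_contra hne
    refine hKW fun x hx y hy hyx => ?_
    obtain ⟨B, hB, hxB⟩ := exists_mem_of_mem_partsOf hq.1 hx
    have hBK : KeepsWords C B := by
      by_contra h
      exact hne (Finset.prod_eq_zero (Finset.mem_union_left r hB) (if_neg h))
    exact subset_of_mem_partsOf hq.1 hB (hBK x hxB y hy hyx)

open Classical in
/-- A product of sums over partitions is a sum over refinements. -/
lemma prod_partMoment (g : Finset (Pos τ) → R) {s : Finset (Finset (Pos τ))}
    {Q : Finset (Pos τ)} (hs : s ∈ partsOf Q) :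
    ∏ A ∈ s, partMoment g A =
      ∑ p ∈ partsOf Q, ∏ B ∈ p, if ∃ A ∈ s, B ⊆ A ∧ KeepsWords A B then g B else 0 := by
  induction s using Finset.induction_on generalizing Q with
  | empty =>
    have : Q = ∅ := by simpa using ((mem_partsOf.1 hs).2.2).symm
    subst this
    simp [partsOf_empty]
  | insert A s hA ih =>
    have hAs := Finset.mem_insert_self A s
    have hAQ : A ⊆ Q := subset_of_mem_partsOf hs hAs
    have hs' : s ∈ partsOf (Q \ A) := by
      have := erase_mem_partsOf hs hAs
      rwa [Finset.erase_insert hA] at this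
    -- Partitions with a block meeting both `A` and `Q \ A` have a zero factor, so only refinements
    -- of the two-block partition count.
    rw [Finset.prod_insert hA, ih hs', partMoment, Finset.sum_mul_sum,
      ← Finset.sum_filter_of_ne (s := partsOf Q) (p := fun p => ∀ B ∈ p, B ⊆ A ∨ B ⊆ Q \ A),
      sum_partsOf_union hAQ]
    · refine Finset.sum_congr rfl fun q hq => Finset.sum_congr rfl fun r hr => ?_
      rw [Finset.prod_union (disjoint_of_mem_partsOf Finset.disjoint_sdiff hq hr)]
      congr 1
      · refine Finset.prod_congr rfl fun B hB => if_congr ?_ rfl rfl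
        have hBA := subset_of_mem_partsOf hq hB
        constructor
        · exact fun h => ⟨A, hAs, hBA, h⟩
        · rintro ⟨A', hA', hB', h⟩
          obtain ⟨x, hx⟩ := nonempty_of_mem_partsOf hq hB
          rwa [eq_of_mem_partsOf hs hAs hA' (hBA hx) (hB' hx)]
      · refine Finset.prod_congr rfl fun B hB => if_congr ?_ rfl rfl
        have hBA := subset_of_mem_partsOf hr hB
        constructor
        · rintro ⟨A', hA', h⟩
          exact ⟨A', Finset.mem_insert_of_mem hA', h⟩
        · rintro ⟨A', hA', hB', h⟩
          refine ⟨A', (Finset.mem_insert.1 hA').resolve_left ?_, hB', h⟩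
          rintro rfl
          obtain ⟨x, hx⟩ := nonempty_of_mem_partsOf hr hB
          exact (Finset.mem_sdiff.1 (hBA hx)).2 (hB' hx)
    · intro p hp hne B hB
      have : ∃ A' ∈ insert A s, B ⊆ A' ∧ KeepsWords A' B := by
        by_contra h
        exact hne (Finset.prod_eq_zero hB (if_neg h))
      obtain ⟨A', hA', hB', -⟩ := this
      rcases Finset.mem_insert.1 hA' with rfl | h
      · exact Or.inl hB'
      · exact Or.inr (hB'.trans (subset_of_mem_partsOf hs' h))

end PartMoments

end SigPolykay

namespace SigPolykay

lemma parts_mem_partsOf {α : Type*} [DecidableEq α] {Q : Finset α} (π : Finpartition Q) :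
    π.parts ∈ partsOf Q := Finset.mem_image_of_mem _ (Finset.mem_univ π)

lemma mem_trace_parts {α : Type*} [Fintype α] [DecidableEq α] {a : SetPart α} {U B : Finset α} :
    B ∈ (trace a U).parts ↔ B.Nonempty ∧ ∃ A ∈ a.parts, A ∩ U = B := by
  rw [trace, Finpartition.restrict]
  simp [Finset.nonempty_iff_ne_empty]

/-! ### Refinements that keep words together -/

section Refinements

variable {d : ℕ} {ι : Type*} [Fintype ι] [DecidableEq ι] {τ : ι → Word d}

lemma fst_eq_of_le {x y : Pos τ} (h : x ≤ y) : x.1 = y.1 := by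
  obtain ⟨h, -⟩ := Sigma.le_def.1 h
  exact h

lemma le_or_le_of_fst_eq {x y : Pos τ} (h : x.1 = y.1) : x ≤ y ∨ y ≤ x := by
  obtain ⟨j, x⟩ := x
  obtain ⟨j', y⟩ := y
  obtain rfl : j = j' := h
  exact (le_total x y).imp (Sigma.mk_le_mk_iff.2) (Sigma.mk_le_mk_iff.2)

/-- Chains lie inside single words, and two-element chains suffice: equal traces on `{x, y}` mean
that letters of a word sharing a block of `a` are not separated by `b`. -/
lemma le_and_sameOnChains_iff {a b : SetPart (Pos τ)} :
    b ≤ a ∧ SameOnChains b a ↔ ∀ B ∈ b.parts, ∃ A ∈ a.parts, B ⊆ A ∧ KeepsWords A B := by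
  constructor
  · rintro ⟨hle, hs⟩ B hB
    obtain ⟨A, hA, hBA⟩ := hle hB
    refine ⟨A, hA, hBA, fun x hx y hy hyx => ?_⟩
    have hC : IsChain (· ≤ ·) (({x, y} : Finset (Pos τ)) : Set (Pos τ)) := by
      rw [Finset.coe_pair]
      exact (Set.subsingleton_singleton.isChain).insert fun z hz _ => by
        rw [Set.mem_singleton_iff.1 hz]
        exact le_or_le_of_fst_eq hyx.symm
    have h1 : A ∩ {x, y} ∈ (trace a {x, y}).parts :=
      mem_trace_parts.2 ⟨⟨x, by simp [hBA hx]⟩, A, hA, rfl⟩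
    rw [← hs _ hC, mem_trace_parts] at h1
    obtain ⟨-, B', hB', h2⟩ := h1
    have h3 : ∀ z, z = x ∨ z = y → z ∈ A → z ∈ B' := by
      intro z hz hzA
      have : z ∈ A ∩ {x, y} := by simp [hz, hzA]
      rw [← h2] at this
      exact (Finset.mem_inter.1 this).1
    rw [b.eq_of_mem_parts hB hB' hx (h3 x (Or.inl rfl) (hBA hx))]
    exact h3 y (Or.inr rfl) hy
  · intro h
    refine ⟨fun B hB => ?_, fun C hC => ?_⟩
    · obtain ⟨A, hA, hBA, -⟩ := h B hB
      exact ⟨A, hA, hBA⟩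
    · refine Finpartition.ext (eq_of_subset_of_mem_partsOf (parts_mem_partsOf _)
        (parts_mem_partsOf _) fun D hD => ?_)
      rw [mem_trace_parts] at hD ⊢
      obtain ⟨hne, B, hB, rfl⟩ := hD
      obtain ⟨A, hA, hBA, hKW⟩ := h B hB
      refine ⟨hne, A, hA, (Finset.inter_subset_inter_right hBA).antisymm' fun y hy => ?_⟩
      obtain ⟨x, hx⟩ := hne
      rw [Finset.mem_inter] at hx hy ⊢
      refine ⟨hKW x hx.1 y hy.1 ?_, hy.2⟩
      rcases hC.total hx.2 hy.2 with h' | h'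
      exacts [(fst_eq_of_le h').symm, fst_eq_of_le h']

/-- Inside the fibres of a monotone `f` the blocks of `b` may be ordered arbitrarily: comparable
letters with equal `f`-value belong to one word and one block of `a`, so `b` keeps them together. -/
lemma mem_orp_of_sameOnChains {a b : SetPart (Pos τ)} (ha : a ∈ orp (Pos τ)) (hle : b ≤ a)
    (hs : SameOnChains b a) : b ∈ orp (Pos τ) := by
  classical
  have hKW := le_and_sameOnChains_iff.1 ⟨hle, hs⟩
  rw [orp, Finset.mem_filter] at ha ⊢
  obtain ⟨-, f, hf⟩ := ha
  refine ⟨Finset.mem_univ _, ?_⟩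
  have hpart : ∀ x, b.part x ∈ b.parts := fun x => b.part_mem.2 (Finset.mem_univ x)
  let e := b.parts.equivFin
  let idx : Pos τ → Fin b.parts.card := fun x => e ⟨b.part x, hpart x⟩
  have hidx : ∀ x y, idx x = idx y ↔ ∃ B ∈ b.parts, x ∈ B ∧ y ∈ B := by
    intro x y
    rw [← Finpartition.mem_part_iff_exists, e.injective.eq_iff, Subtype.mk.injEq]
    constructor
    · intro h
      rw [← h]
      exact b.mem_part (Finset.mem_univ x)
    · intro h
      exact b.part_eq_of_mem (hpart y) h
  have hlt : ∀ x, (idx x : ℕ) < b.parts.card := fun x => (idx x).2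
  -- The code `f x * |b| + idx x` is lexicographic, because `idx x < |b|`; it separates the blocks
  -- of `b` and stays monotone.
  have hmono : ∀ x y, x ≤ y → f x * b.parts.card + idx x ≤ f y * b.parts.card + idx y := by
    intro x y hxy
    rcases (f.monotone hxy).lt_or_eq with h | h
    · have h1 : (f x + 1) * b.parts.card ≤ f y * b.parts.card := Nat.mul_le_mul_right _ h
      have := hlt x
      nlinarith
    · obtain ⟨A, hA, hxA, hyA⟩ := (hf x y).1 h
      obtain ⟨A', hA', hBA, hkw⟩ := hKW _ (hpart x)
      have hxB := b.mem_part (Finset.mem_univ x)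
      obtain rfl := a.eq_of_mem_parts hA hA' hxA (hBA hxB)
      have : idx x = idx y :=
        (hidx x y).2 ⟨_, hpart x, hxB, hkw x hxB y hyA (fst_eq_of_le hxy).symm⟩
      rw [h, this]
  refine ⟨⟨fun x => f x * b.parts.card + idx x, fun x y => hmono x y⟩, fun x y => ?_⟩
  rw [← hidx]
  show f x * b.parts.card + idx x = f y * b.parts.card + idx y ↔ _
  constructor
  · intro h
    have h1 := congrArg (· % b.parts.card) h
    simpa [Nat.mul_add_mod', Nat.mod_eq_of_lt, Fin.ext_iff] using h1
  · intro h
    obtain ⟨B, hB, hx, hy⟩ := (hidx x y).1 h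
    obtain ⟨A, hA, hBA, -⟩ := hKW B hB
    rw [h, (hf x y).2 ⟨A, hA, hBA hx, hBA hy⟩]

open Polynomial in
-- The linear coefficient of a product of linear polynomials marks one of its factors; polynomials
-- thus serve as generating functions for marked blocks.
lemma eval_derivative_prod {β : Type*} [DecidableEq β] (s : Finset β) (u v : β → ℝ) :
    (derivative (∏ b ∈ s, (C (u b) + X * C (v b)))).eval 0 =
      ∑ b ∈ s, v b * ∏ c ∈ s.erase b, u c := by
  rw [derivative_prod_finset, eval_finsetSum]
  refine Finset.sum_congr rfl fun b _ => ?_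
  rw [mul_comm]
  simp [eval_prod]

open Classical in
/-- Marking a block of a refinement. -/
lemma sum_refinements_sum_mem (a : SetPart (Pos τ)) (κ φ : Finset (Pos τ) → ℝ) :
    ∑ b : SetPart (Pos τ) with b ≤ a ∧ SameOnChains b a,
      ∑ D ∈ b.parts, φ D * ∏ B ∈ b.parts.erase D, κ B =
    ∑ A ∈ a.parts, (∑ D ∈ A.powerset with D.Nonempty ∧ KeepsWords A D,
      φ D * partMoment κ (A \ D)) * ∏ B ∈ a.parts.erase A, partMoment κ B := by
  -- The weight `κ + X φ` lets the coefficient of `X` mark one block; the identity is the derivative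
  -- at `0` of `prod_partMoment` over the polynomial ring.
  let g : Finset (Pos τ) → Polynomial ℝ := fun B => Polynomial.C (κ B) +
    Polynomial.X * Polynomial.C (φ B)
  have hite : ∀ (c : Prop) [Decidable c] (B : Finset (Pos τ)), (if c then g B else 0) =
      Polynomial.C (if c then κ B else 0) + Polynomial.X * Polynomial.C (if c then φ B else 0) := by
    intro c _ B
    split_ifs <;> simp [g]
  have heval : ∀ A, (partMoment g A).eval 0 = partMoment κ A := by
    intro A
    simp [partMoment, hite, Polynomial.eval_finsetSum, Polynomial.eval_prod]
  have hder : ∀ A, (Polynomial.derivative (partMoment g A)).eval 0 =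
      ∑ D ∈ A.powerset with D.Nonempty ∧ KeepsWords A D, φ D * partMoment κ (A \ D) := by
    intro A
    simp only [partMoment, hite, Polynomial.derivative_sum, Polynomial.eval_finsetSum,
      eval_derivative_prod]
    rw [sum_partsOf_sum_mem A fun D r => (if KeepsWords A D then φ D else 0) *
      ∏ B ∈ r, if KeepsWords A B then κ B else 0, ← Finset.filter_filter,
      Finset.sum_filter (p := KeepsWords A)]
    refine Finset.sum_congr rfl fun D hD => ?_
    split_ifs with hKW
    · rw [Finset.mul_sum]
      refine Finset.sum_congr rfl fun r hr => ?_
      congr 1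
      exact Finset.prod_congr rfl fun B hB => if_congr
        (keepsWords_iff hKW.sdiff Finset.sdiff_subset (subset_of_mem_partsOf hr hB)) rfl rfl
    · simp
  have h1 := congrArg (fun q => (Polynomial.derivative q).eval 0)
    (prod_partMoment g (parts_mem_partsOf a))
  simp only [Polynomial.derivative_sum, Polynomial.eval_finsetSum] at h1
  rw [Polynomial.derivative_prod_finset, Polynomial.eval_finsetSum, sum_partsOf] at h1
  simp only [Polynomial.eval_mul, Polynomial.eval_prod, heval, hder] at h1
  rw [Finset.sum_filter]
  refine Eq.trans ?_ (h1.symm.trans (Finset.sum_congr rfl fun A _ => mul_comm _ _))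
  refine Finset.sum_congr rfl fun b _ => ?_
  simp only [hite, eval_derivative_prod]
  by_cases h : ∀ B ∈ b.parts, ∃ A ∈ a.parts, B ⊆ A ∧ KeepsWords A B
  · rw [if_pos (le_and_sameOnChains_iff.2 h)]
    refine Finset.sum_congr rfl fun D hD => ?_
    rw [if_pos (h D hD)]
    congr 1
    exact Finset.prod_congr rfl fun B hB => (if_pos (h B (Finset.mem_of_mem_erase hB))).symm
  · rw [if_neg fun h' => h (le_and_sameOnChains_iff.1 h')]
    push Not at h
    obtain ⟨B, hB, hBn⟩ := h
    have hBn' : ¬ ∃ A ∈ a.parts, B ⊆ A ∧ KeepsWords A B := by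
      rintro ⟨A, hA, h1, h2⟩
      exact hBn A hA h1 h2
    refine (Finset.sum_eq_zero fun D hD => ?_).symm
    by_cases hBD : B = D
    · rw [if_neg (hBD ▸ hBn'), zero_mul]
    · rw [Finset.prod_eq_zero (Finset.mem_erase.2 ⟨hBD, hB⟩) (if_neg hBn'), mul_zero]

end Refinements

end SigPolykay

namespace SigPolykay

/-! ### Merging a block of one partition with a block of another -/

lemma singleton_mem_partsOf {α : Type*} [DecidableEq α] {Q : Finset α} (hQ : Q.Nonempty) :
    {Q} ∈ partsOf Q := by
  refine mem_partsOf_of_forall ?_ ?_ ?_ <;> simp [hQ]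

lemma exists_parts_eq {α : Type*} [Fintype α] [DecidableEq α] {p : Finset (Finset α)}
    (hp : p ∈ partsOf Finset.univ) : ∃ c : SetPart α, c.parts = p := by
  simpa [partsOf] using hp

section Merging

variable {α : Type*} [Fintype α] [DecidableEq α] {P : Finset α} {F S : Finset (Finset α)}

lemma not_mixed_of_subset {B : Finset α} (h : B ⊆ P) : ¬ Mixed P B :=
  fun hm => by
    obtain ⟨x, hx, hxP⟩ := hm.2
    exact hxP (h hx)

lemma not_mixed_of_subset_compl {B : Finset α} (h : B ⊆ Finset.univ \ P) : ¬ Mixed P B :=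
  fun hm => by
    obtain ⟨x, hx, hxP⟩ := hm.1
    exact (Finset.mem_sdiff.1 (h hx)).2 hxP

lemma not_mixed_of_mem_union (hF : F ∈ partsOf P) (hS : S ∈ partsOf (Finset.univ \ P))
    {B : Finset α} (hB : B ∈ F ∪ S) : ¬ Mixed P B := by
  rcases Finset.mem_union.1 hB with h | h
  exacts [not_mixed_of_subset (subset_of_mem_partsOf hF h),
    not_mixed_of_subset_compl (subset_of_mem_partsOf hS h)]

lemma mixed_union (hF : F ∈ partsOf P) (hS : S ∈ partsOf (Finset.univ \ P)) {D D' : Finset α}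
    (hD : D ∈ F) (hD' : D' ∈ S) : Mixed P (D ∪ D') := by
  obtain ⟨x, hx⟩ := nonempty_of_mem_partsOf hF hD
  obtain ⟨y, hy⟩ := nonempty_of_mem_partsOf hS hD'
  exact ⟨⟨x, Finset.mem_union_left _ hx, subset_of_mem_partsOf hF hD hx⟩,
    ⟨y, Finset.mem_union_right _ hy, (Finset.mem_sdiff.1 (subset_of_mem_partsOf hS hD' hy)).2⟩⟩

lemma union_inter_left_part (hF : F ∈ partsOf P) (hS : S ∈ partsOf (Finset.univ \ P))
    {D D' : Finset α} (hD : D ∈ F) (hD' : D' ∈ S) : (D ∪ D') ∩ P = D := by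
  have h1 := subset_of_mem_partsOf hF hD
  have h2 := subset_of_mem_partsOf hS hD'
  ext x
  have := @h1 x
  have := @h2 x
  simp only [Finset.mem_inter, Finset.mem_union, Finset.mem_sdiff, Finset.mem_univ, true_and] at *
  tauto

lemma union_inter_right_part (hF : F ∈ partsOf P) (hS : S ∈ partsOf (Finset.univ \ P))
    {D D' : Finset α} (hD : D ∈ F) (hD' : D' ∈ S) : (D ∪ D') ∩ (Finset.univ \ P) = D' := by
  have h1 := subset_of_mem_partsOf hF hD
  have h2 := subset_of_mem_partsOf hS hD'
  ext x
  have := @h1 x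
  have := @h2 x
  simp only [Finset.mem_inter, Finset.mem_union, Finset.mem_sdiff, Finset.mem_univ, true_and] at *
  tauto

lemma erase_union_erase_mem_partsOf (hF : F ∈ partsOf P) (hS : S ∈ partsOf (Finset.univ \ P))
    {D D' : Finset α} (hD : D ∈ F) (hD' : D' ∈ S) :
    F.erase D ∪ S.erase D' ∈ partsOf (Finset.univ \ (D ∪ D')) := by
  have h1 := subset_of_mem_partsOf hF hD
  have h2 := subset_of_mem_partsOf hS hD'
  refine union_mem_partsOf (U := P \ D) ?_ (erase_mem_partsOf hF hD) ?_
  · intro x hx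
    have := @h2 x
    simp only [Finset.mem_union, Finset.mem_sdiff, Finset.mem_univ, true_and] at *
    tauto
  · have e : (Finset.univ \ (D ∪ D')) \ (P \ D) = (Finset.univ \ P) \ D' := by
      ext x
      have := @h1 x
      simp only [Finset.mem_union, Finset.mem_sdiff, Finset.mem_univ, true_and] at *
      tauto
    rw [e]
    exact erase_mem_partsOf hS hD'

lemma union_base_mem_partsOf (hF : F ∈ partsOf P) (hS : S ∈ partsOf (Finset.univ \ P))
    {D D' : Finset α} (hD : D ∈ F) (hD' : D' ∈ S) {p : Finset (Finset α)}
    (hp : p ∈ partsOf (D ∪ D')) : p ∪ (F.erase D ∪ S.erase D') ∈ partsOf Finset.univ :=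
  union_mem_partsOf (Finset.subset_univ _) hp (erase_union_erase_mem_partsOf hF hS hD hD')

lemma disjoint_erase_union_erase (hF : F ∈ partsOf P) (hS : S ∈ partsOf (Finset.univ \ P))
    {D D' : Finset α} (hD : D ∈ F) (hD' : D' ∈ S) {p : Finset (Finset α)}
    (hp : p ∈ partsOf (D ∪ D')) : Disjoint p (F.erase D ∪ S.erase D') :=
  disjoint_of_mem_partsOf Finset.disjoint_sdiff hp (erase_union_erase_mem_partsOf hF hS hD hD')

/-- The partitions that induce `F` and `S` and have one mixed block. -/
lemma merger_iff (hF : F ∈ partsOf P) (hS : S ∈ partsOf (Finset.univ \ P)) (c : SetPart α) :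
    ((trace c P).parts = F ∧ (trace c (Finset.univ \ P)).parts = S ∧
      c.parts.card + 1 = F.card + S.card) ↔
    ∃ D ∈ F, ∃ D' ∈ S, c.parts = {D ∪ D'} ∪ (F.erase D ∪ S.erase D') := by
  classical
  have hFS : Disjoint F S := disjoint_of_mem_partsOf Finset.disjoint_sdiff hF hS
  constructor
  · rintro ⟨hcF, hcS, hcard⟩
    have himage : ∀ U : Finset α, (trace c U).parts =
        (c.parts.filter fun C => (C ∩ U).Nonempty).image (· ∩ U) := by
      intro U
      ext B
      simp only [mem_trace_parts, Finset.mem_image, Finset.mem_filter, and_assoc]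
      constructor
      · rintro ⟨hne, A, hA, rfl⟩
        exact ⟨A, hA, hne, rfl⟩
      · rintro ⟨A, hA, hne, rfl⟩
        exact ⟨hne, A, hA, rfl⟩
    have hcount : ∀ U : Finset α, (trace c U).parts.card =
        (c.parts.filter fun C => (C ∩ U).Nonempty).card := by
      intro U
      rw [himage]
      refine Finset.card_image_of_injOn fun A hA A' hA' h => ?_
      simp only [Finset.coe_filter, Set.mem_ofPred_eq] at hA hA' h
      obtain ⟨x, hx⟩ := hA.2
      have hx' := h ▸ hx
      exact c.eq_of_mem_parts hA.1 hA'.1 (Finset.mem_inter.1 hx).1 (Finset.mem_inter.1 hx').1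
    have hunion : (c.parts.filter fun C => (C ∩ P).Nonempty) ∪
        (c.parts.filter fun C => (C ∩ (Finset.univ \ P)).Nonempty) = c.parts := by
      rw [← Finset.filter_or, Finset.filter_true_of_mem]
      intro C hC
      obtain ⟨x, hx⟩ := c.nonempty_of_mem_parts hC
      by_cases hxP : x ∈ P
      · exact Or.inl ⟨x, Finset.mem_inter.2 ⟨hx, hxP⟩⟩
      · exact Or.inr ⟨x, Finset.mem_inter.2 ⟨hx, by simpa using hxP⟩⟩
    -- The sum `|F| + |S|` counts each mixed block of `c` twice, so the condition on `|c|` says that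
    -- exactly one block is mixed.
    have hone := Finset.card_union_add_card_inter
      (c.parts.filter fun C => (C ∩ P).Nonempty)
      (c.parts.filter fun C => (C ∩ (Finset.univ \ P)).Nonempty)
    rw [hunion, ← hcount, ← hcount, hcF, hcS, ← Finset.filter_and] at hone
    obtain ⟨C, hC⟩ := Finset.card_eq_one.1 (show (c.parts.filter fun C =>
      (C ∩ P).Nonempty ∧ (C ∩ (Finset.univ \ P)).Nonempty).card = 1 by omega)
    have hCmem : C ∈ c.parts ∧ (C ∩ P).Nonempty ∧ (C ∩ (Finset.univ \ P)).Nonempty := by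
      have := Finset.mem_singleton_self C
      rwa [← hC, Finset.mem_filter] at this
    have hD : C ∩ P ∈ F := hcF ▸ mem_trace_parts.2 ⟨hCmem.2.1, C, hCmem.1, rfl⟩
    have hD' : C ∩ (Finset.univ \ P) ∈ S :=
      hcS ▸ mem_trace_parts.2 ⟨hCmem.2.2, C, hCmem.1, rfl⟩
    have hCC : C ∩ P ∪ C ∩ (Finset.univ \ P) = C := by
      rw [← Finset.inter_union_distrib_left, Finset.union_sdiff_of_subset (Finset.subset_univ P),
        Finset.inter_univ]
    refine ⟨_, hD, _, hD', eq_of_subset_of_mem_partsOf (parts_mem_partsOf c)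
      (union_base_mem_partsOf hF hS hD hD' (singleton_mem_partsOf ?_)) fun B hB => ?_⟩
    · rw [hCC]
      exact c.nonempty_of_mem_parts hCmem.1
    rw [hCC]
    by_cases hBC : B = C
    · exact Finset.mem_union_left _ (Finset.mem_singleton.2 hBC)
    refine Finset.mem_union_right _ ?_
    obtain ⟨x, hx⟩ := c.nonempty_of_mem_parts hB
    have hxC : x ∉ C := fun h => hBC (c.eq_of_mem_parts hB hCmem.1 hx h)
    have hBm : ¬ ((B ∩ P).Nonempty ∧ (B ∩ (Finset.univ \ P)).Nonempty) := fun h =>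
      hBC (Finset.mem_singleton.1 (hC ▸ Finset.mem_filter.2 ⟨hB, h⟩))
    by_cases hxP : x ∈ P
    · have hxBP : x ∈ B ∩ P := Finset.mem_inter.2 ⟨hx, hxP⟩
      have hBP : B ⊆ P := fun y hy => by
        by_contra h
        exact hBm ⟨⟨x, hxBP⟩, ⟨y, Finset.mem_inter.2 ⟨hy, by simpa using h⟩⟩⟩
      refine Finset.mem_union_left _ (Finset.mem_erase.2 ⟨fun h => ?_, ?_⟩)
      · rw [h] at hx
        exact hxC (Finset.mem_inter.1 hx).1
      · rw [← hcF, mem_trace_parts]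
        exact ⟨⟨x, hx⟩, B, hB, Finset.inter_eq_left.2 hBP⟩
    · have hxP' : x ∈ Finset.univ \ P := by simpa using hxP
      have hBP : B ⊆ Finset.univ \ P := fun y hy => by
        by_contra h
        exact hBm ⟨⟨y, Finset.mem_inter.2 ⟨hy, by simpa using h⟩⟩,
          ⟨x, Finset.mem_inter.2 ⟨hx, hxP'⟩⟩⟩
      refine Finset.mem_union_right _ (Finset.mem_erase.2 ⟨fun h => ?_, ?_⟩)
      · rw [h] at hx
        exact hxC (Finset.mem_inter.1 hx).1
      · rw [← hcS, mem_trace_parts]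
        exact ⟨⟨x, hx⟩, B, hB, Finset.inter_eq_left.2 hBP⟩
  · rintro ⟨D, hD, D', hD', hc⟩
    have hDmem : D ∪ D' ∈ c.parts := by simp [hc]
    refine ⟨(eq_of_subset_of_mem_partsOf hF (parts_mem_partsOf _) fun A hA => ?_).symm,
      (eq_of_subset_of_mem_partsOf hS (parts_mem_partsOf _) fun A hA => ?_).symm, ?_⟩
    · refine mem_trace_parts.2 ⟨nonempty_of_mem_partsOf hF hA, ?_⟩
      by_cases h : A = D
      · subst h
        exact ⟨_, hDmem, union_inter_left_part hF hS hA hD'⟩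
      · exact ⟨A, by simp [hc, h, hA], Finset.inter_eq_left.2 (subset_of_mem_partsOf hF hA)⟩
    · refine mem_trace_parts.2 ⟨nonempty_of_mem_partsOf hS hA, ?_⟩
      by_cases h : A = D'
      · subst h
        exact ⟨_, hDmem, union_inter_right_part hF hS hD hA⟩
      · exact ⟨A, by simp [hc, h, hA], Finset.inter_eq_left.2 (subset_of_mem_partsOf hS hA)⟩
    · have hne : (D ∪ D').Nonempty := c.nonempty_of_mem_parts hDmem
      rw [hc, Finset.card_union_of_disjoint (disjoint_erase_union_erase hF hS hD hD'
        (singleton_mem_partsOf hne)), Finset.card_union_of_disjoint (hFS.mono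
        (Finset.erase_subset _ _) (Finset.erase_subset _ _)), Finset.card_erase_of_mem hD,
        Finset.card_erase_of_mem hD', Finset.card_singleton]
      have := Finset.card_pos.2 ⟨D, hD⟩
      have := Finset.card_pos.2 ⟨D', hD'⟩
      omega

/-- The merged block is the only mixed one, and `D`, `D'` are its traces on the two sides. -/
lemma merger_injective (hF : F ∈ partsOf P) (hS : S ∈ partsOf (Finset.univ \ P))
    {D D' A A' : Finset α} (hD : D ∈ F) (hD' : D' ∈ S) (hA : A ∈ F) (hA' : A' ∈ S)
    (h : {D ∪ D'} ∪ (F.erase D ∪ S.erase D') = {A ∪ A'} ∪ (F.erase A ∪ S.erase A')) :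
    D = A ∧ D' = A' := by
  have h1 : D ∪ D' ∈ {A ∪ A'} ∪ (F.erase A ∪ S.erase A') := h ▸ (by simp)
  have h2 : D ∪ D' = A ∪ A' := by
    rcases Finset.mem_union.1 h1 with h2 | h2
    · exact Finset.mem_singleton.1 h2
    · exact absurd (mixed_union hF hS hD hD') (not_mixed_of_mem_union hF hS
        (Finset.union_subset_union (Finset.erase_subset _ _) (Finset.erase_subset _ _) h2))
  constructor
  · rw [← union_inter_left_part hF hS hD hD', h2, union_inter_left_part hF hS hA hA']
  · rw [← union_inter_right_part hF hS hD hD', h2, union_inter_right_part hF hS hA hA']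

end Merging

/-! ### Admissible refinements of a merged partition. -/

section InnerPartitions

variable {d : ℕ} {ι : Type*} [Fintype ι] [DecidableEq ι] {ω : ι → Word d} {P : Finset (Pos ω)}
  {F S : Finset (Finset (Pos ω))}

/-- The refinements of a merger that do not cut the original partitions. -/
lemma inner_iff (hF : F ∈ partsOf P) (hS : S ∈ partsOf (Finset.univ \ P))
    {D D' : Finset (Pos ω)} (hD : D ∈ F) (hD' : D' ∈ S) {c : SetPart (Pos ω)}
    (hc : c.parts = {D ∪ D'} ∪ (F.erase D ∪ S.erase D')) (b : SetPart (Pos ω)) :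
    (b ≤ c ∧ SameOnChains b c ∧ NotCutting b F ∧ NotCutting b S ∧ b.parts ≠ F ∪ S) ↔
    ∃ p ∈ partsOf (D ∪ D'), (∀ B ∈ p, Mixed P B ∧ KeepsWords (D ∪ D') B) ∧
      b.parts = p ∪ (F.erase D ∪ S.erase D') := by
  classical
  have hDmem : D ∪ D' ∈ c.parts := by simp [hc]
  rw [← and_assoc, le_and_sameOnChains_iff]
  constructor
  · rintro ⟨hKW, hbF, hbS, hbne⟩
    -- Inside a block of `c` that was not merged, a block of `b` cannot be a proper subset, so it is
    -- the whole block.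
    have hblock : ∀ B ∈ b.parts, B ∈ F ∪ S ∨ B ⊆ D ∪ D' ∧ KeepsWords (D ∪ D') B := by
      intro B hB
      obtain ⟨A, hA, hBA, hkw⟩ := hKW B hB
      rw [hc, Finset.mem_union, Finset.mem_singleton, Finset.mem_union] at hA
      rcases hA with rfl | hA | hA
      · exact Or.inr ⟨hBA, hkw⟩
      · have hA := Finset.mem_of_mem_erase hA
        rw [(hBA.eq_or_ssubset.resolve_right (hbF B hB A hA))]
        exact Or.inl (Finset.mem_union_left _ hA)
      · have hA := Finset.mem_of_mem_erase hA
        rw [(hBA.eq_or_ssubset.resolve_right (hbS B hB A hA))]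
        exact Or.inl (Finset.mem_union_right _ hA)
    have hFS : F ∪ S ∈ partsOf Finset.univ :=
      union_mem_partsOf (Finset.subset_univ _) hF hS
    have hDF := subset_of_mem_partsOf hF hD
    have hDS := subset_of_mem_partsOf hS hD'
    have hsubL : ∀ B ⊆ D ∪ D', B ⊆ P → B ⊆ D := fun B hB hBP x hx =>
      (Finset.mem_union.1 (hB hx)).resolve_right fun h => (Finset.mem_sdiff.1 (hDS h)).2 (hBP hx)
    have hsubR : ∀ B ⊆ D ∪ D', B ⊆ Finset.univ \ P → B ⊆ D' := fun B hB hBP x hx =>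
      (Finset.mem_union.1 (hB hx)).resolve_left fun h => (Finset.mem_sdiff.1 (hBP hx)).2 (hDF h)
    have hpure : ∀ B ∈ b.parts, B ⊆ D ∪ D' → ¬ Mixed P B → B = D ∨ B = D' := by
      intro B hB hBD hBm
      by_cases h : ∃ x ∈ B, x ∈ P
      · have hBP : B ⊆ P := fun y hy => by
          by_contra hyP
          exact hBm ⟨h, y, hy, hyP⟩
        exact Or.inl ((hsubL B hBD hBP).eq_or_ssubset.resolve_right (hbF B hB D hD))
      · have hBP : B ⊆ Finset.univ \ P := fun y hy => by
          simpa using fun hyP => h ⟨y, hy, hyP⟩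
        exact Or.inr ((hsubR B hBD hBP).eq_or_ssubset.resolve_right (hbS B hB D' hD'))
    have hDD : Disjoint D D' := Finset.disjoint_left.2 fun x hx hx' =>
      (Finset.mem_sdiff.1 (hDS hx')).2 (hDF hx)
    -- A block of `b` inside `D ∪ D'` that is not mixed must be `D` or `D'`; then the other one is a
    -- block as well and `b` is the excluded partition `F ∪ S`.
    have hnotmem : ∀ B ∈ b.parts, B ⊆ D ∪ D' → Mixed P B := by
      intro B hB hBD
      by_contra hBm
      refine hbne (eq_of_subset_of_mem_partsOf (parts_mem_partsOf b) hFS fun A hA => ?_)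
      rcases hblock A hA with h | ⟨hAD, -⟩
      · exact h
      by_cases hAB : A = B
      · rcases hpure B hB hBD hBm with h | h <;> rw [hAB, h]
        exacts [Finset.mem_union_left _ hD, Finset.mem_union_right _ hD']
      have hdisj := b.disjoint hA hB hAB
      rcases hpure B hB hBD hBm with rfl | rfl
      · have : A ⊆ D' := fun x hx => (Finset.mem_union.1 (hAD hx)).resolve_left fun h =>
          Finset.disjoint_left.1 hdisj hx h
        rw [this.eq_or_ssubset.resolve_right (hbS A hA D' hD')]
        exact Finset.mem_union_right _ hD'
      · have : A ⊆ D := fun x hx => (Finset.mem_union.1 (hAD hx)).resolve_right fun h =>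
          Finset.disjoint_left.1 hdisj hx h
        rw [this.eq_or_ssubset.resolve_right (hbF A hA D hD)]
        exact Finset.mem_union_left _ hD
    have hcover : ∀ B ∈ b.parts, ∀ x ∈ B, x ∈ D ∪ D' → B ⊆ D ∪ D' := by
      intro B hB x hx hxD
      obtain ⟨A, hA, hBA, -⟩ := hKW B hB
      rwa [c.eq_of_mem_parts hDmem hA hxD (hBA hx)]
    have hp : b.parts.filter (· ⊆ D ∪ D') ∈ partsOf (D ∪ D') := by
      refine filter_mem_partsOf (parts_mem_partsOf b) _ fun x => ⟨fun hx => ?_, ?_⟩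
      · obtain ⟨B, hB, hxB⟩ := b.exists_mem (Finset.mem_univ x)
        exact ⟨B, hB, hcover B hB x hxB hx, hxB⟩
      · rintro ⟨B, -, h, hx⟩
        exact h hx
    refine ⟨_, hp, fun B hB => ?_, eq_of_subset_of_mem_partsOf (parts_mem_partsOf b)
      (union_base_mem_partsOf hF hS hD hD' hp) fun B hB => ?_⟩
    · rw [Finset.mem_filter] at hB
      have hm := hnotmem B hB.1 hB.2
      exact ⟨hm, ((hblock B hB.1).resolve_left fun h => not_mixed_of_mem_union hF hS h hm).2⟩
    · by_cases hBD : B ⊆ D ∪ D'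
      · exact Finset.mem_union_left _ (Finset.mem_filter.2 ⟨hB, hBD⟩)
      · refine Finset.mem_union_right _ ?_
        have h := (hblock B hB).resolve_right fun h => hBD h.1
        rw [Finset.mem_union] at h ⊢
        refine h.imp (fun h => Finset.mem_erase.2 ⟨?_, h⟩) fun h => Finset.mem_erase.2 ⟨?_, h⟩
        · rintro rfl
          exact hBD Finset.subset_union_left
        · rintro rfl
          exact hBD Finset.subset_union_right
  · rintro ⟨p, hp, hpm, hb⟩
    have hsub : ∀ A, A ∈ F.erase D ∪ S.erase D' → A ∈ F ∪ S := fun A hA =>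
      Finset.union_subset_union (Finset.erase_subset _ _) (Finset.erase_subset _ _) hA
    have hFS : F ∪ S ∈ partsOf Finset.univ :=
      union_mem_partsOf (Finset.subset_univ _) hF hS
    have hcut : ∀ G ⊆ F ∪ S, NotCutting b G := by
      intro G hG B hB A hA hlt
      obtain ⟨x, hx⟩ := b.nonempty_of_mem_parts hB
      rw [hb] at hB
      rcases Finset.mem_union.1 hB with hB | hB
      · refine not_mixed_of_mem_union hF hS (hG hA) ?_
        obtain ⟨⟨⟨y, hy, hyP⟩, ⟨z, hz, hzP⟩⟩, -⟩ := hpm B hB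
        exact ⟨⟨y, hlt.1 hy, hyP⟩, ⟨z, hlt.1 hz, hzP⟩⟩
      · exact hlt.ne (eq_of_mem_partsOf hFS (hsub B hB) (hG hA) hx (hlt.1 hx))
    refine ⟨fun B hB => ?_, hcut F Finset.subset_union_left, hcut S Finset.subset_union_right,
      fun h => ?_⟩
    · rw [hb] at hB
      rcases Finset.mem_union.1 hB with hB | hB
      · exact ⟨_, hDmem, subset_of_mem_partsOf hp hB, (hpm B hB).2⟩
      · exact ⟨B, hc ▸ Finset.mem_union_right _ hB, subset_rfl, fun _ _ y hy _ => hy⟩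
    · obtain ⟨x, hx⟩ := nonempty_of_mem_partsOf hF hD
      obtain ⟨B, hB, -⟩ := exists_mem_of_mem_partsOf hp (Finset.mem_union_left D' hx)
      exact not_mixed_of_mem_union hF hS (h ▸ hb ▸ Finset.mem_union_left _ hB) (hpm B hB).1

/-- Partitions that cut a word contribute zero and are discarded. The index set is described by
membership alone, in the terms that `inner_iff` uses. -/
lemma exists_mixedMoment_eq_sum (P : Finset (Pos ω)) (g : Finset (Pos ω) → ℝ)
    (C : Finset (Pos ω)) : ∃ t : Finset (Finset (Finset (Pos ω))),
      (∀ p, p ∈ t ↔ p ∈ partsOf C ∧ ∀ B ∈ p, Mixed P B ∧ KeepsWords C B) ∧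
      mixedMoment P g C = ∑ p ∈ t, ∏ B ∈ p, g B := by
  classical
  refine ⟨((partsOf C).filter fun p => ∀ B ∈ p, Mixed P B).filter
    fun p => ∀ B ∈ p, KeepsWords C B, fun p => ?_, ?_⟩
  · simp only [Finset.mem_filter, and_assoc, forall₂_and]
  · rw [mixedMoment, Finset.sum_filter (p := fun p => ∀ B ∈ p, KeepsWords C B)]
    refine Finset.sum_congr (by congr) fun p _ => ?_
    split_ifs with h
    · exact Finset.prod_congr rfl fun B hB => if_pos (h B hB)
    · push Not at h
      obtain ⟨B, hB, hn⟩ := h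
      exact Finset.prod_eq_zero hB (if_neg hn)

open Classical in
/-- The double sum over mergers and their refinements. -/
lemma sum_mergers_sum_inner (hF : F ∈ partsOf P) (hS : S ∈ partsOf (Finset.univ \ P))
    (g : Finset (Pos ω) → ℝ) :
    ∑ c : SetPart (Pos ω) with (trace c P).parts = F ∧
      (trace c (Finset.univ \ P)).parts = S ∧ c.parts.card + 1 = F.card + S.card,
      ∑ b : SetPart (Pos ω) with
        b ≤ c ∧ SameOnChains b c ∧ NotCutting b F ∧ NotCutting b S ∧ b.parts ≠ F ∪ S,
        ∏ B ∈ b.parts, g B =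
    ∑ D ∈ F, ∑ D' ∈ S, mixedMoment P g (D ∪ D') *
      ((∏ B ∈ F.erase D, g B) * ∏ B ∈ S.erase D', g B) := by
  -- A merger is determined by the pair of blocks it joins, and its admissible refinements by the
  -- partitions of `D ∪ D'` into mixed blocks that keep words; all other blocks give a common
  -- factor.
  have hex : ∀ q : (_ : Finset (Pos ω)) × Finset (Pos ω), q ∈ F.sigma (fun _ => S) →
      ∃ c : SetPart (Pos ω), c.parts = {q.1 ∪ q.2} ∪ (F.erase q.1 ∪ S.erase q.2) := by
    rintro ⟨D, D'⟩ hq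
    rw [Finset.mem_sigma] at hq
    refine exists_parts_eq (union_base_mem_partsOf hF hS hq.1 hq.2 (singleton_mem_partsOf ?_))
    exact (nonempty_of_mem_partsOf hF hq.1).mono Finset.subset_union_left
  choose m hm using hex
  rw [Finset.sum_sigma' F fun _ => S]
  refine (Finset.sum_bij m ?_ ?_ ?_ ?_).symm
  · rintro ⟨D, D'⟩ hq
    have hq' := Finset.mem_sigma.1 hq
    rw [Finset.mem_filter]
    exact ⟨Finset.mem_univ _, (merger_iff hF hS _).2 ⟨D, hq'.1, D', hq'.2, hm _ hq⟩⟩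
  · rintro ⟨D, D'⟩ hq ⟨A, A'⟩ hq' h
    have h1 := Finset.mem_sigma.1 hq
    have h2 := Finset.mem_sigma.1 hq'
    have h3 := hm _ hq
    rw [h, hm _ hq'] at h3
    obtain ⟨rfl, rfl⟩ := merger_injective hF hS h2.1 h2.2 h1.1 h1.2 h3
    rfl
  · intro c hc
    obtain ⟨D, hD, D', hD', h⟩ := (merger_iff hF hS c).1 (Finset.mem_filter.1 hc).2
    have hq : (⟨D, D'⟩ : (_ : Finset (Pos ω)) × Finset (Pos ω)) ∈ F.sigma (fun _ => S) :=
      Finset.mem_sigma.2 ⟨hD, hD'⟩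
    exact ⟨⟨D, D'⟩, hq, Finpartition.ext ((hm _ hq).trans h.symm)⟩
  · rintro ⟨D, D'⟩ hq
    obtain ⟨hD, hD'⟩ := Finset.mem_sigma.1 hq
    simp only at hD hD'
    have hc := hm _ hq
    simp only at hc ⊢
    obtain ⟨t, ht, hsum⟩ := exists_mixedMoment_eq_sum P g (D ∪ D')
    rw [hsum, Finset.sum_mul]
    have hex : ∀ p ∈ t, ∃ b : SetPart (Pos ω), b.parts = p ∪ (F.erase D ∪ S.erase D') :=
      fun p hp => exists_parts_eq (union_base_mem_partsOf hF hS hD hD' ((ht p).1 hp).1)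
    choose r hr using hex
    refine Finset.sum_bij r ?_ ?_ ?_ ?_
    · intro p hp
      have hp' := (ht p).1 hp
      rw [Finset.mem_filter]
      exact ⟨Finset.mem_univ _, (inner_iff hF hS hD hD' hc _).2 ⟨p, hp'.1, hp'.2, hr p hp⟩⟩
    · intro p hp q hq h
      have h1 := hr p hp
      rw [h, hr q hq] at h1
      have hd := disjoint_erase_union_erase hF hS hD hD' ((ht p).1 hp).1
      have hd' := disjoint_erase_union_erase hF hS hD hD' ((ht q).1 hq).1
      rw [← Finset.union_sdiff_cancel_right hd, ← h1, Finset.union_sdiff_cancel_right hd']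
    · intro b hb
      obtain ⟨p, hp, hpm, h⟩ := (inner_iff hF hS hD hD' hc b).1 (Finset.mem_filter.1 hb).2
      have hp' : p ∈ t := (ht p).2 ⟨hp, hpm⟩
      exact ⟨p, hp', Finpartition.ext ((hr p hp').trans h.symm)⟩
    · intro p hp
      rw [hr p hp, Finset.prod_union (disjoint_erase_union_erase hF hS hD hD' ((ht p).1 hp).1),
        Finset.prod_union]
      exact (disjoint_of_mem_partsOf Finset.disjoint_sdiff hF hS).mono (Finset.erase_subset _ _)
        (Finset.erase_subset _ _)

end InnerPartitions

end SigPolykay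

namespace SigPolykay

/-! ### Letters of a subfamily of words -/

section PosMap

variable {d : ℕ} {ι κ : Type*}

/-- The letters of a subfamily of a tuple of words. -/
def posMap (f : ι ↪ κ) (ω : κ → Word d) : Pos (ω ∘ f) ↪ Pos ω where
  toFun x := ⟨f x.1, x.2⟩
  inj' := by
    rintro ⟨i, x⟩ ⟨j, y⟩ h
    obtain ⟨h1, h2⟩ := Sigma.mk.inj_iff.1 h
    obtain rfl := f.injective h1
    exact Sigma.ext rfl h2

variable [DecidableEq ι] [DecidableEq κ]

lemma subword_map (f : ι ↪ κ) (ω : κ → Word d) (B : Finset (Pos (ω ∘ f))) (j : ι) :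
    subword ω (B.map (posMap f ω)) (f j) = subword (ω ∘ f) B j := by
  have h : ∀ i : Fin (ω (f j)).length, (⟨f j, i⟩ : Pos ω) ∈ B.map (posMap f ω) ↔
      (⟨j, i⟩ : Pos (ω ∘ f)) ∈ B := fun i =>
    Finset.mem_map' (posMap f ω) (a := (⟨j, i⟩ : Pos (ω ∘ f)))
  simp only [subword, h]
  rfl

lemma keepsWords_map (f : ι ↪ κ) (ω : κ → Word d) {C B : Finset (Pos (ω ∘ f))} :
    KeepsWords (C.map (posMap f ω)) (B.map (posMap f ω)) ↔ KeepsWords C B := by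
  simp only [KeepsWords, Finset.forall_mem_map, Finset.mem_map']
  exact forall₄_congr fun x _ y _ => imp_congr_left f.injective.eq_iff

lemma partMoment_map {R : Type*} [CommRing R] (f : ι ↪ κ) (ω : κ → Word d) (g : Finset (Pos ω) → R)
    (C : Finset (Pos (ω ∘ f))) :
    partMoment g (C.map (posMap f ω)) = partMoment (fun B => g (B.map (posMap f ω))) C := by
  classical
  rw [partMoment, partsOf_map, Finset.sum_map, partMoment]
  refine Finset.sum_congr rfl fun p _ => ?_
  simp only [RelEmbedding.coe_toEmbedding, Finset.mapEmbedding_apply, Finset.prod_map]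
  exact Finset.prod_congr rfl fun B _ => if_congr (keepsWords_map f ω) rfl rfl

variable [Fintype ι] [Fintype κ]

lemma blockSupport_map (f : ι ↪ κ) (ω : κ → Word d) (B : Finset (Pos (ω ∘ f))) :
    blockSupport ω (B.map (posMap f ω)) = (blockSupport (ω ∘ f) B).map f := by
  ext j
  simp only [mem_blockSupport, Finset.mem_map]
  constructor
  · rintro ⟨_, ⟨x, hx, rfl⟩, rfl⟩
    exact ⟨x.1, ⟨x, hx, rfl⟩, rfl⟩
  · rintro ⟨_, ⟨x, hx, rfl⟩, rfl⟩
    exact ⟨_, ⟨x, hx, rfl⟩, rfl⟩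

lemma blockCumulant_map {E : Type*} [MeasurableSpace E] (ν : Measure E) (S : E → TensorSeries d)
    (f : ι ↪ κ) (ω : κ → Word d) (B : Finset (Pos (ω ∘ f))) :
    blockCumulant ν S ω (B.map (posMap f ω)) = blockCumulant ν S (ω ∘ f) B := by
  rw [blockCumulant, blockCumulant, jointCumulant_eq, blockSupport_map, cumulantFn_map,
    jointCumulant_eq]
  simp only [Finset.prod_map, subword_map]

end PosMap

lemma blockMoment_eq_partMoment {d : ℕ} {ι : Type*} [Fintype ι] [DecidableEq ι] {E : Type*}
    [MeasurableSpace E] (ν : Measure E) [IsProbabilityMeasure ν] (S : E → TensorSeries d)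
    (τ : ι → Word d) (C : Finset (Pos τ)) :
    blockMoment ν S τ C = partMoment (blockCumulant ν S τ) C := by
  rw [blockMoment_eq_sum]
  rfl

/-! ### Two tuples of words -/

section Concat

variable {d : ℕ} {ι ι' : Type*} (τ : ι → Word d) (σ : ι' → Word d)
  [DecidableEq ι] [DecidableEq ι']

/-- The letters of the first tuple as letters of the concatenated tuple. -/
def inlPos : Pos τ ↪ Pos (concat τ σ) := posMap Function.Embedding.inl (concat τ σ)

/-- The letters of the second tuple as letters of the concatenated tuple. -/
def inrPos : Pos σ ↪ Pos (concat τ σ) := posMap Function.Embedding.inr (concat τ σ)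

lemma inFirst_eq_map (B : Finset (Pos τ)) : inFirst τ σ B = B.map (inlPos τ σ) := by
  rw [Finset.map_eq_image]
  rfl

lemma inSecond_eq_map (B : Finset (Pos σ)) : inSecond τ σ B = B.map (inrPos τ σ) := by
  rw [Finset.map_eq_image]
  rfl

/-- A set of letters of the first and a set of letters of the second tuple. -/
def joinPos (B : Finset (Pos τ)) (B' : Finset (Pos σ)) : Finset (Pos (concat τ σ)) :=
  inFirst τ σ B ∪ inSecond τ σ B'

variable {τ σ}

lemma inl_mem_inFirst {B : Finset (Pos τ)} {j : ι} {i : Fin (τ j).length} :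
    (⟨Sum.inl j, i⟩ : Pos (concat τ σ)) ∈ inFirst τ σ B ↔ (⟨j, i⟩ : Pos τ) ∈ B := by
  rw [inFirst_eq_map]
  exact Finset.mem_map' (inlPos τ σ) (a := (⟨j, i⟩ : Pos τ))

lemma inr_mem_inSecond {B : Finset (Pos σ)} {j : ι'} {i : Fin (σ j).length} :
    (⟨Sum.inr j, i⟩ : Pos (concat τ σ)) ∈ inSecond τ σ B ↔ (⟨j, i⟩ : Pos σ) ∈ B := by
  rw [inSecond_eq_map]
  exact Finset.mem_map' (inrPos τ σ) (a := (⟨j, i⟩ : Pos σ))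

lemma inr_notMem_inFirst {B : Finset (Pos τ)} {j : ι'} {i : Fin (σ j).length} :
    (⟨Sum.inr j, i⟩ : Pos (concat τ σ)) ∉ inFirst τ σ B := by
  intro h
  obtain ⟨x, -, hx⟩ := Finset.mem_image.1 h
  cases (Sigma.mk.inj_iff.1 hx).1

lemma inl_notMem_inSecond {B : Finset (Pos σ)} {j : ι} {i : Fin (τ j).length} :
    (⟨Sum.inl j, i⟩ : Pos (concat τ σ)) ∉ inSecond τ σ B := by
  intro h
  obtain ⟨x, -, hx⟩ := Finset.mem_image.1 h
  cases (Sigma.mk.inj_iff.1 hx).1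

lemma inl_mem_joinPos {B : Finset (Pos τ)} {B' : Finset (Pos σ)} {j : ι} {i : Fin (τ j).length} :
    (⟨Sum.inl j, i⟩ : Pos (concat τ σ)) ∈ joinPos τ σ B B' ↔ (⟨j, i⟩ : Pos τ) ∈ B := by
  rw [joinPos, Finset.mem_union, inl_mem_inFirst, or_iff_left inl_notMem_inSecond]

lemma inr_mem_joinPos {B : Finset (Pos τ)} {B' : Finset (Pos σ)} {j : ι'} {i : Fin (σ j).length} :
    (⟨Sum.inr j, i⟩ : Pos (concat τ σ)) ∈ joinPos τ σ B B' ↔ (⟨j, i⟩ : Pos σ) ∈ B' := by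
  rw [joinPos, Finset.mem_union, inr_mem_inSecond, or_iff_right inr_notMem_inFirst]

lemma ext_concat {U V : Finset (Pos (concat τ σ))}
    (h : ∀ j (i : Fin (τ j).length), (⟨Sum.inl j, i⟩ : Pos (concat τ σ)) ∈ U ↔
      (⟨Sum.inl j, i⟩ : Pos (concat τ σ)) ∈ V)
    (h' : ∀ j (i : Fin (σ j).length), (⟨Sum.inr j, i⟩ : Pos (concat τ σ)) ∈ U ↔
      (⟨Sum.inr j, i⟩ : Pos (concat τ σ)) ∈ V) : U = V := by
  ext ⟨j | j, i⟩
  exacts [h j i, h' j i]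

lemma subset_concat_iff {U V : Finset (Pos (concat τ σ))} : U ⊆ V ↔
    (∀ j (i : Fin (τ j).length), (⟨Sum.inl j, i⟩ : Pos (concat τ σ)) ∈ U →
      (⟨Sum.inl j, i⟩ : Pos (concat τ σ)) ∈ V) ∧
    (∀ j (i : Fin (σ j).length), (⟨Sum.inr j, i⟩ : Pos (concat τ σ)) ∈ U →
      (⟨Sum.inr j, i⟩ : Pos (concat τ σ)) ∈ V) := by
  constructor
  · exact fun h => ⟨fun j i hi => h hi, fun j i hi => h hi⟩
  · rintro ⟨h, h'⟩ ⟨j | j, i⟩ hx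
    exacts [h j i hx, h' j i hx]

lemma joinPos_subset_iff {B D : Finset (Pos τ)} {B' D' : Finset (Pos σ)} :
    joinPos τ σ D D' ⊆ joinPos τ σ B B' ↔ D ⊆ B ∧ D' ⊆ B' := by
  simp only [subset_concat_iff, inl_mem_joinPos, inr_mem_joinPos]
  constructor
  · rintro ⟨h, h'⟩
    exact ⟨fun x hx => h x.1 x.2 hx, fun x hx => h' x.1 x.2 hx⟩
  · rintro ⟨h, h'⟩
    exact ⟨fun j i hi => h hi, fun j i hi => h' hi⟩

lemma keepsWords_joinPos {B D : Finset (Pos τ)} {B' D' : Finset (Pos σ)} :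
    KeepsWords (joinPos τ σ B B') (joinPos τ σ D D') ↔ KeepsWords B D ∧ KeepsWords B' D' := by
  constructor
  · intro h
    constructor
    · intro x hx y hy hyx
      exact inl_mem_joinPos.1 (h ⟨Sum.inl x.1, x.2⟩ (inl_mem_joinPos.2 hx) ⟨Sum.inl y.1, y.2⟩
        (inl_mem_joinPos.2 hy) (congrArg Sum.inl hyx))
    · intro x hx y hy hyx
      exact inr_mem_joinPos.1 (h ⟨Sum.inr x.1, x.2⟩ (inr_mem_joinPos.2 hx) ⟨Sum.inr y.1, y.2⟩
        (inr_mem_joinPos.2 hy) (congrArg Sum.inr hyx))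
  · rintro ⟨h, h'⟩ ⟨j | j, i⟩ hx ⟨k | k, l⟩ hy hyx
    · exact inl_mem_joinPos.2 (h _ (inl_mem_joinPos.1 hx) ⟨k, l⟩ (inl_mem_joinPos.1 hy)
        (Sum.inl.inj hyx))
    · cases hyx
    · cases hyx
    · exact inr_mem_joinPos.2 (h' _ (inr_mem_joinPos.1 hx) ⟨k, l⟩ (inr_mem_joinPos.1 hy)
        (Sum.inr.inj hyx))

lemma inSecond_univ_eq [Fintype ι] [Fintype ι'] :
    inSecond τ σ Finset.univ = Finset.univ \ inFirst τ σ Finset.univ :=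
  ext_concat (fun j i => by simp [inl_notMem_inSecond, inl_mem_inFirst])
    fun j i => by simp [inr_mem_inSecond, inr_notMem_inFirst]

variable [Fintype ι] [Fintype ι']

lemma joinPos_inter (B : Finset (Pos τ)) (B' : Finset (Pos σ)) :
    joinPos τ σ B B' ∩ inFirst τ σ Finset.univ = inFirst τ σ B :=
  ext_concat (fun j i => by simp [inl_mem_joinPos, inl_mem_inFirst])
    fun j i => by simp [inr_notMem_inFirst]

lemma joinPos_sdiff (B : Finset (Pos τ)) (B' : Finset (Pos σ)) :
    joinPos τ σ B B' \ inFirst τ σ Finset.univ = inSecond τ σ B' :=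
  ext_concat (fun j i => by simp [inl_notMem_inSecond, inl_mem_inFirst])
    fun j i => by simp [inr_mem_joinPos, inr_mem_inSecond, inr_notMem_inFirst]

lemma joinPos_sdiff_joinPos (B D : Finset (Pos τ)) (B' D' : Finset (Pos σ)) :
    joinPos τ σ B B' \ joinPos τ σ D D' = joinPos τ σ (B \ D) (B' \ D') :=
  ext_concat (fun j i => by simp [inl_mem_joinPos]) fun j i => by simp [inr_mem_joinPos]

lemma mixed_joinPos_iff {D : Finset (Pos τ)} {D' : Finset (Pos σ)} :
    Mixed (inFirst τ σ Finset.univ) (joinPos τ σ D D') ↔ D.Nonempty ∧ D'.Nonempty := by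
  constructor
  · rintro ⟨⟨⟨j | j, i⟩, hx, hxP⟩, ⟨⟨k | k, l⟩, hy, hyP⟩⟩
    · exact absurd (inl_mem_inFirst.2 (Finset.mem_univ _)) hyP
    · exact ⟨⟨_, inl_mem_joinPos.1 hx⟩, ⟨_, inr_mem_joinPos.1 hy⟩⟩
    · exact absurd hxP inr_notMem_inFirst
    · exact absurd hxP inr_notMem_inFirst
  · rintro ⟨⟨x, hx⟩, ⟨y, hy⟩⟩
    exact ⟨⟨⟨Sum.inl x.1, x.2⟩, inl_mem_joinPos.2 hx, inl_mem_inFirst.2 (Finset.mem_univ _)⟩,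
      ⟨⟨Sum.inr y.1, y.2⟩, inr_mem_joinPos.2 hy, inr_notMem_inFirst⟩⟩

/-- The first side consists of whole words, as the separation of mixed blocks requires. -/
lemma inFirst_univ_respects (x y : Pos (concat τ σ)) (h : x.1 = y.1)
    (hx : x ∈ inFirst τ σ Finset.univ) : y ∈ inFirst τ σ Finset.univ := by
  obtain ⟨j | j, i⟩ := x <;> obtain ⟨k | k, l⟩ := y
  · exact inl_mem_inFirst.2 (Finset.mem_univ _)
  · cases h
  · exact inl_mem_inFirst.2 (Finset.mem_univ _)
  · exact absurd hx inr_notMem_inFirst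

lemma firstBlocks_mem_partsOf (a : SetPart (Pos τ)) :
    firstBlocks τ σ a ∈ partsOf (inFirst τ σ Finset.univ) := by
  have h := map_mem_partsOf (inlPos τ σ) (parts_mem_partsOf a)
  rw [← inFirst_eq_map, Finset.map_eq_image] at h
  convert h using 1
  exact Finset.image_congr fun B _ => inFirst_eq_map τ σ B

lemma secondBlocks_mem_partsOf (a : SetPart (Pos σ)) :
    secondBlocks τ σ a ∈ partsOf (Finset.univ \ inFirst τ σ Finset.univ) := by
  have h := map_mem_partsOf (inrPos τ σ) (parts_mem_partsOf a)
  rw [← inSecond_eq_map, inSecond_univ_eq, Finset.map_eq_image] at h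
  convert h using 1
  exact Finset.image_congr fun B _ => inSecond_eq_map τ σ B

lemma partMoment_inFirst (g : Finset (Pos (concat τ σ)) → ℝ) (C : Finset (Pos τ)) :
    partMoment g (inFirst τ σ C) = partMoment (fun B => g (inFirst τ σ B)) C := by
  simp only [inFirst_eq_map]
  exact partMoment_map Function.Embedding.inl (concat τ σ) g C

lemma partMoment_inSecond (g : Finset (Pos (concat τ σ)) → ℝ) (C : Finset (Pos σ)) :
    partMoment g (inSecond τ σ C) = partMoment (fun B => g (inSecond τ σ B)) C := by
  simp only [inSecond_eq_map]
  exact partMoment_map Function.Embedding.inr (concat τ σ) g C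

lemma blockCumulant_inFirst {E : Type*} [MeasurableSpace E] (ν : Measure E)
    (S : E → TensorSeries d) (B : Finset (Pos τ)) :
    blockCumulant ν S (concat τ σ) (inFirst τ σ B) = blockCumulant ν S τ B := by
  rw [inFirst_eq_map]
  exact blockCumulant_map ν S Function.Embedding.inl (concat τ σ) B

lemma blockCumulant_inSecond {E : Type*} [MeasurableSpace E] (ν : Measure E)
    (S : E → TensorSeries d) (B : Finset (Pos σ)) :
    blockCumulant ν S (concat τ σ) (inSecond τ σ B) = blockCumulant ν S σ B := by
  rw [inSecond_eq_map]
  exact blockCumulant_map ν S Function.Embedding.inr (concat τ σ) B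

lemma inFirst_injective : Function.Injective (inFirst τ σ) := by
  intro B C h
  simp only [inFirst_eq_map] at h
  exact Finset.map_injective _ h

lemma inSecond_injective : Function.Injective (inSecond τ σ) := by
  intro B C h
  simp only [inSecond_eq_map] at h
  exact Finset.map_injective _ h

open Classical in
lemma sum_subsets_joinPos (B : Finset (Pos τ)) (B' : Finset (Pos σ))
    (f : Finset (Pos (concat τ σ)) → ℝ) :
    ∑ U ∈ (joinPos τ σ B B').powerset.filter (KeepsWords (joinPos τ σ B B') ·), f U =
      ∑ D ∈ B.powerset.filter (KeepsWords B ·), ∑ D' ∈ B'.powerset.filter (KeepsWords B' ·),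
        f (joinPos τ σ D D') := by
  rw [← Finset.sum_product']
  let fst : Finset (Pos (concat τ σ)) → Finset (Pos τ) := fun U =>
    Finset.univ.filter fun x : Pos τ => (⟨Sum.inl x.1, x.2⟩ : Pos (concat τ σ)) ∈ U
  let snd : Finset (Pos (concat τ σ)) → Finset (Pos σ) := fun U =>
    Finset.univ.filter fun x : Pos σ => (⟨Sum.inr x.1, x.2⟩ : Pos (concat τ σ)) ∈ U
  have hjoin : ∀ U, joinPos τ σ (fst U) (snd U) = U := fun U =>
    ext_concat (fun j i => by simp [inl_mem_joinPos, fst]) fun j i => by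
      simp [inr_mem_joinPos, snd]
  refine Finset.sum_bij' (fun U _ => (fst U, snd U)) (fun q _ => joinPos τ σ q.1 q.2)
    ?_ ?_ ?_ ?_ ?_
  · intro U hU
    rw [← hjoin U, Finset.mem_filter, Finset.mem_powerset, joinPos_subset_iff,
      keepsWords_joinPos] at hU
    simp only [Finset.mem_product, Finset.mem_filter, Finset.mem_powerset]
    exact ⟨⟨hU.1.1, hU.2.1⟩, hU.1.2, hU.2.2⟩
  · rintro ⟨D, D'⟩ hq
    simp only [Finset.mem_product, Finset.mem_filter, Finset.mem_powerset] at hq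
    rw [Finset.mem_filter, Finset.mem_powerset, joinPos_subset_iff, keepsWords_joinPos]
    exact ⟨⟨hq.1.1, hq.2.1⟩, hq.1.2, hq.2.2⟩
  · intro U _
    exact hjoin U
  · rintro ⟨D, D'⟩ _
    refine Prod.ext (Finset.ext fun x => ?_) (Finset.ext fun x => ?_)
    · simp only [fst, Finset.mem_filter, Finset.mem_univ, true_and]
      exact inl_mem_joinPos
    · simp only [snd, Finset.mem_filter, Finset.mem_univ, true_and]
      exact inr_mem_joinPos
  · intro U _
    exact congrArg f (hjoin U).symm

open Classical in
lemma sum_subsets_eq_add {ρ : ι → Word d} (B : Finset (Pos ρ)) (G : Finset (Pos ρ) → ℝ) :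
    ∑ D ∈ B.powerset.filter (KeepsWords B ·), G D =
      G ∅ + ∑ D ∈ B.powerset with D.Nonempty ∧ KeepsWords B D, G D := by
  have h0 : ∅ ∈ B.powerset.filter (KeepsWords B ·) :=
    Finset.mem_filter.2 ⟨by simp, fun x hx => by simp at hx⟩
  rw [← Finset.add_sum_erase _ _ h0]
  congr 1
  refine Finset.sum_congr (Finset.ext fun D => ?_) fun _ _ => rfl
  rw [Finset.mem_erase, Finset.mem_filter, Finset.mem_filter, Finset.nonempty_iff_ne_empty]
  tauto

open Classical in
/-- The covariance of two products in terms of joint cumulants. -/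
lemma partMoment_joinPos_sub (g : Finset (Pos (concat τ σ)) → ℝ) (B : Finset (Pos τ))
    (B' : Finset (Pos σ)) :
    partMoment g (joinPos τ σ B B') - partMoment g (inFirst τ σ B) * partMoment g (inSecond τ σ B') =
      ∑ D ∈ B.powerset with D.Nonempty ∧ KeepsWords B D,
        ∑ D' ∈ B'.powerset with D'.Nonempty ∧ KeepsWords B' D',
          mixedMoment (inFirst τ σ Finset.univ) g (joinPos τ σ D D') *
            (partMoment g (inFirst τ σ (B \ D)) * partMoment g (inSecond τ σ (B' \ D'))) := by
  have hempty : joinPos τ σ ∅ ∅ = ∅ := by simp [joinPos, inFirst, inSecond]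
  -- A nonempty set on one side has no partition into mixed blocks. Hence the union of the mixed
  -- blocks is either empty, which gives the subtracted product, or meets both sides.
  have hzero : ∀ (D : Finset (Pos τ)) (D' : Finset (Pos σ)), D.Nonempty ∨ D'.Nonempty →
      ¬ (D.Nonempty ∧ D'.Nonempty) →
      mixedMoment (inFirst τ σ Finset.univ) g (joinPos τ σ D D') = 0 := by
    intro D D' h h'
    refine mixedMoment_eq_zero g ?_ fun hm => h' (mixed_joinPos_iff.1 hm)
    rcases h with ⟨x, hx⟩ | ⟨x, hx⟩
    exacts [⟨⟨Sum.inl x.1, x.2⟩, inl_mem_joinPos.2 hx⟩, ⟨⟨Sum.inr x.1, x.2⟩, inr_mem_joinPos.2 hx⟩]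
  rw [partMoment_eq_sum_mixedMoment inFirst_univ_respects, sum_subsets_joinPos]
  simp only [joinPos_sdiff_joinPos, joinPos_inter, joinPos_sdiff]
  rw [sum_subsets_eq_add, sum_subsets_eq_add, hempty, mixedMoment_empty, one_mul,
    Finset.sdiff_empty, Finset.sdiff_empty, Finset.sum_eq_zero, add_zero, add_sub_cancel_left]
  · refine Finset.sum_congr rfl fun D hD => ?_
    rw [sum_subsets_eq_add, hzero D ∅ (Or.inl (Finset.mem_filter.1 hD).2.1) (by simp), zero_mul,
      zero_add]
  · intro D' hD'
    rw [hzero ∅ D' (Or.inr (Finset.mem_filter.1 hD').2.1) (by simp), zero_mul]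

end Concat

end SigPolykay

namespace SigPolykay

/-! ### The asymptotic covariance -/

section Combinatorial

variable {d : ℕ} {ι ι' : Type*} {τ : ι → Word d} {σ : ι' → Word d}
  [DecidableEq ι] [DecidableEq ι'] [Fintype ι] [Fintype ι'] {E : Type*} [MeasurableSpace E]

/-- `𝒱(a₁, a₂)` by the blocks that are merged. -/
lemma partCov_eq (ν : Measure E) (S : E → TensorSeries d) (a : SetPart (Pos τ))
    (b : SetPart (Pos σ)) :
    partCov ν S τ σ a b = ∑ D ∈ a.parts, ∑ D' ∈ b.parts,
      mixedMoment (inFirst τ σ Finset.univ) (blockCumulant ν S (concat τ σ)) (joinPos τ σ D D') *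
        ((∏ B ∈ a.parts.erase D, blockCumulant ν S τ B) *
          ∏ B ∈ b.parts.erase D', blockCumulant ν S σ B) := by
  have h := sum_mergers_sum_inner (firstBlocks_mem_partsOf (σ := σ) a)
    (secondBlocks_mem_partsOf (τ := τ) b) (blockCumulant ν S (concat τ σ))
  have hcard : (firstBlocks τ σ a).card = a.parts.card :=
    Finset.card_image_of_injective _ inFirst_injective
  have hcard' : (secondBlocks τ σ b).card = b.parts.card :=
    Finset.card_image_of_injective _ inSecond_injective
  have e1 : ∑ D ∈ firstBlocks τ σ a, ∑ D' ∈ secondBlocks τ σ b,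
      mixedMoment (inFirst τ σ Finset.univ) (blockCumulant ν S (concat τ σ)) (D ∪ D') *
        ((∏ B ∈ (firstBlocks τ σ a).erase D, blockCumulant ν S (concat τ σ) B) *
          ∏ B ∈ (secondBlocks τ σ b).erase D', blockCumulant ν S (concat τ σ) B) =
      ∑ D ∈ a.parts, ∑ D' ∈ b.parts,
        mixedMoment (inFirst τ σ Finset.univ) (blockCumulant ν S (concat τ σ)) (joinPos τ σ D D') *
        ((∏ B ∈ a.parts.erase D, blockCumulant ν S τ B) *
          ∏ B ∈ b.parts.erase D', blockCumulant ν S σ B) := by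
    rw [firstBlocks, Finset.sum_image inFirst_injective.injOn]
    refine Finset.sum_congr rfl fun D _ => ?_
    rw [secondBlocks, Finset.sum_image inSecond_injective.injOn]
    refine Finset.sum_congr rfl fun D' _ => ?_
    rw [← Finset.image_erase inFirst_injective, ← Finset.image_erase inSecond_injective,
      Finset.prod_image inFirst_injective.injOn, Finset.prod_image inSecond_injective.injOn]
    simp only [blockCumulant_inFirst, blockCumulant_inSecond]
    rfl
  rw [← e1, ← h, partCov]
  refine Finset.sum_congr (Finset.ext fun c => ?_) fun c _ =>
    Finset.sum_congr (Finset.ext fun b' => ?_) fun _ _ => rfl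
  · rw [mergers, Finset.mem_filter, Finset.mem_filter, inSecond_univ_eq, hcard, hcard']
  · simp only [innerPartitions, Finset.mem_filter]

open Classical in
/-- The covariances for the moments of two ordered partitions, in terms of `𝒱`. -/
lemma sum_partMoment_joinPos (ν : Measure E) (S : E → TensorSeries d) (a : SetPart (Pos τ))
    (b : SetPart (Pos σ)) :
    ∑ B ∈ a.parts, ∑ B' ∈ b.parts,
      (partMoment (blockCumulant ν S (concat τ σ)) (joinPos τ σ B B') -
        partMoment (blockCumulant ν S τ) B * partMoment (blockCumulant ν S σ) B') *
      ((∏ A ∈ a.parts.erase B, partMoment (blockCumulant ν S τ) A) *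
        ∏ A ∈ b.parts.erase B', partMoment (blockCumulant ν S σ) A) =
    ∑ a' : SetPart (Pos τ) with a' ≤ a ∧ SameOnChains a' a,
      ∑ b' : SetPart (Pos σ) with b' ≤ b ∧ SameOnChains b' b, partCov ν S τ σ a' b' := by
  set m := mixedMoment (inFirst τ σ Finset.univ) (blockCumulant ν S (concat τ σ)) with hm
  set κ := blockCumulant ν S τ with hκ
  set κ' := blockCumulant ν S σ with hκ'
  -- The marking identity is applied twice: in `b` with `D` held fixed, then in `a` with the
  -- resulting sum as the weight of `D`.
  have hb : ∀ D, ∑ b' : SetPart (Pos σ) with b' ≤ b ∧ SameOnChains b' b,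
      ∑ D' ∈ b'.parts, m (joinPos τ σ D D') * ∏ B ∈ b'.parts.erase D', κ' B = _ := fun D =>
    sum_refinements_sum_mem b κ' fun D' => m (joinPos τ σ D D')
  have ha := sum_refinements_sum_mem a κ fun D =>
    ∑ b' : SetPart (Pos σ) with b' ≤ b ∧ SameOnChains b' b,
      ∑ D' ∈ b'.parts, m (joinPos τ σ D D') * ∏ B ∈ b'.parts.erase D', κ' B
  have hR : ∑ a' : SetPart (Pos τ) with a' ≤ a ∧ SameOnChains a' a,
      ∑ b' : SetPart (Pos σ) with b' ≤ b ∧ SameOnChains b' b, partCov ν S τ σ a' b' =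
      ∑ a' : SetPart (Pos τ) with a' ≤ a ∧ SameOnChains a' a, ∑ D ∈ a'.parts,
        (∑ b' : SetPart (Pos σ) with b' ≤ b ∧ SameOnChains b' b,
          ∑ D' ∈ b'.parts, m (joinPos τ σ D D') * ∏ B ∈ b'.parts.erase D', κ' B) *
          ∏ B ∈ a'.parts.erase D, κ B := by
    refine Finset.sum_congr rfl fun a' _ => ?_
    simp only [partCov_eq, Finset.sum_mul]
    rw [Finset.sum_comm]
    refine Finset.sum_congr rfl fun D _ => Finset.sum_congr rfl fun b' _ =>
      Finset.sum_congr rfl fun D' _ => ?_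
    ring
  rw [hR, ha]
  simp only [hb]
  refine Finset.sum_congr rfl fun B _ => ?_
  have hcov : ∀ B', partMoment (blockCumulant ν S (concat τ σ)) (joinPos τ σ B B') -
      partMoment κ B * partMoment κ' B' =
      ∑ D ∈ B.powerset with D.Nonempty ∧ KeepsWords B D,
        ∑ D' ∈ B'.powerset with D'.Nonempty ∧ KeepsWords B' D',
          m (joinPos τ σ D D') * (partMoment κ (B \ D) * partMoment κ' (B' \ D')) := by
    intro B'
    have h := partMoment_joinPos_sub (blockCumulant ν S (concat τ σ)) B B'
    simp only [partMoment_inFirst, partMoment_inSecond, blockCumulant_inFirst,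
      blockCumulant_inSecond] at h
    exact h
  simp only [hcov, Finset.sum_mul]
  rw [Finset.sum_comm]
  refine Finset.sum_congr rfl fun D _ => Finset.sum_congr rfl fun B' _ =>
    Finset.sum_congr rfl fun D' _ => ?_
  ring

lemma mem_ancestry {a b : SetPart (Pos τ)} :
    b ∈ ancestry a ↔ b ∈ orp (Pos τ) ∧ a ≤ b ∧ SameOnChains a b := by
  simp only [ancestry, Finset.mem_filter]

open Classical in
-- Exchanging sums: `𝔡(a)` collects the coefficients of the ancestors of `a`, and the refinements of
-- an ordered partition that agree with it on chains are again ordered, by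
-- `mem_orp_of_sameOnChains`.
lemma sum_height_mul (X : SetPart (Pos τ) → ℝ) :
    ∑ a ∈ orp (Pos τ), height a * X a = ∑ a ∈ orp (Pos τ), orpCoeff a *
      ∑ b : SetPart (Pos τ) with b ≤ a ∧ SameOnChains b a, X b := by
  simp only [height, Finset.sum_mul, Finset.mul_sum]
  refine Finset.sum_comm' fun a b => ?_
  rw [mem_ancestry, Finset.mem_filter]
  constructor
  · rintro ⟨-, hb, h⟩
    exact ⟨⟨Finset.mem_univ _, h⟩, hb⟩
  · rintro ⟨⟨-, h⟩, hb⟩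
    exact ⟨mem_orp_of_sameOnChains hb h.1 h.2, hb, h⟩

/-- Both heights are traded for polykay coefficients and sums over refinements; these sums of `𝒱`
are then covariances of blocks times moments of the other blocks, the form in which influence
functions produce them. -/
lemma asymCov_eq (ν : Measure E) (S : E → TensorSeries d) :
    asymCov ν S τ σ = ∑ a ∈ orp (Pos τ), ∑ b ∈ orp (Pos σ), orpCoeff a * orpCoeff b *
      ∑ B ∈ a.parts, ∑ B' ∈ b.parts,
        (partMoment (blockCumulant ν S (concat τ σ)) (joinPos τ σ B B') -
          partMoment (blockCumulant ν S τ) B * partMoment (blockCumulant ν S σ) B') *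
        ((∏ A ∈ a.parts.erase B, partMoment (blockCumulant ν S τ) A) *
          ∏ A ∈ b.parts.erase B', partMoment (blockCumulant ν S σ) A) := by
  classical
  simp only [sum_partMoment_joinPos, asymCov]
  simp only [mul_assoc, ← Finset.mul_sum, sum_height_mul (τ := τ)]
  refine Finset.sum_congr rfl fun a _ => ?_
  congr 1
  rw [Finset.sum_congr rfl fun a' _ => sum_height_mul (τ := σ) fun b => partCov ν S τ σ a' b,
    Finset.sum_comm]
  simp only [Finset.mul_sum]

end Combinatorial

/-! ### The covariance of influence functions is the combinatorial covariance. -/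

section Influence

variable {d : ℕ} {p T : ℝ} {hT : 0 < T} [MeasurableSpace (RoughPath d p T)]
  {ν : Measure (RoughPath d p T)} [IsProbabilityMeasure ν]

/-- The covariance of two Hájek projections. -/
lemma integral_hajek_mul_hajek {E : Type*} [MeasurableSpace E] {ν : Measure E}
    [IsProbabilityMeasure ν] {β γ : Type*} [Fintype β] [Fintype γ] [DecidableEq β] [DecidableEq γ]
    {Y : β → E → ℝ} {Z : γ → E → ℝ} (hY : ∀ b, AllLp (Y b) ν) (hZ : ∀ c, AllLp (Z c) ν) :
    ∫ z, hajek ν Y z * hajek ν Z z ∂ν = ∑ b, ∑ c,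
      ((∫ z, Y b z * Z c z ∂ν) - (∫ z, Y b z ∂ν) * ∫ z, Z c z ∂ν) *
        ((∏ b' ∈ Finset.univ.erase b, ∫ z, Y b' z ∂ν) *
          ∏ c' ∈ Finset.univ.erase c, ∫ z, Z c' z ∂ν) := by
  simp only [hajek_eq, Finset.sum_mul_sum]
  have hint : ∀ b c, AllLp (fun z => (Y b z - ∫ u, Y b u ∂ν) * (Z c z - ∫ u, Z c u ∂ν)) ν :=
    fun b c => ((hY b).sub (allLp_const _)).mul ((hZ c).sub (allLp_const _))
  have hre : ∀ b c z, (Y b z - ∫ u, Y b u ∂ν) * (∏ b' ∈ Finset.univ.erase b, ∫ z, Y b' z ∂ν) *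
      ((Z c z - ∫ u, Z c u ∂ν) * ∏ c' ∈ Finset.univ.erase c, ∫ z, Z c' z ∂ν) =
      (Y b z - ∫ u, Y b u ∂ν) * (Z c z - ∫ u, Z c u ∂ν) *
        ((∏ b' ∈ Finset.univ.erase b, ∫ z, Y b' z ∂ν) *
          ∏ c' ∈ Finset.univ.erase c, ∫ z, Z c' z ∂ν) := fun b c z => by ring
  simp only [hre]
  rw [integral_finsetSum _ fun b _ => integrable_finsetSum _ fun c _ =>
    ((hint b c).integrable.mul_const _)]
  refine Finset.sum_congr rfl fun b _ => ?_
  rw [integral_finsetSum _ fun c _ => ((hint b c).integrable.mul_const _)]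
  refine Finset.sum_congr rfl fun c _ => ?_
  rw [integral_mul_const]
  congr 1
  have hYZ := ((hY b).mul (hZ c)).integrable
  have h1 : ∀ z, (Y b z - ∫ u, Y b u ∂ν) * (Z c z - ∫ u, Z c u ∂ν) =
      Y b z * Z c z - (∫ u, Z c u ∂ν) * Y b z - (∫ u, Y b u ∂ν) * (Z c z - ∫ u, Z c u ∂ν) :=
    fun z => by ring
  have hA : Integrable (fun z => Y b z * Z c z - (∫ u, Z c u ∂ν) * Y b z) ν :=
    hYZ.sub ((hY b).integrable.const_mul _)
  have hB : Integrable (fun z => (∫ u, Y b u ∂ν) * (Z c z - ∫ u, Z c u ∂ν)) ν :=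
    ((hZ c).integrable.sub (integrable_const _)).const_mul _
  simp only [h1]
  rw [integral_sub hA hB, integral_sub hYZ ((hY b).integrable.const_mul _), integral_const_mul,
    integral_const_mul, integral_sub (hZ c).integrable (integrable_const _)]
  simp
  ring

/-- A product of two block variables is a block variable of the concatenated tuple, so the same
cumulant expansion covers mixed moments. -/
lemma blockVar_joinPos {ι ι' : Type*} [Fintype ι] [Fintype ι'] [DecidableEq ι] [DecidableEq ι']
    {τ : ι → Word d} {σ : ι' → Word d} (B : Finset (Pos τ)) (B' : Finset (Pos σ))
    (x : RoughPath d p T) :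
    blockVar hT (concat τ σ) (joinPos τ σ B B') x = blockVar hT τ B x * blockVar hT σ B' x := by
  rw [blockVar_eq_prod, blockVar_eq_prod, blockVar_eq_prod, Fintype.prod_sum_type]
  have h1 : ∀ j, subword (concat τ σ) (joinPos τ σ B B') (Sum.inl j) = subword τ B j := fun j => by
    rw [subword_congr (C := inFirst τ σ B) fun i => inl_mem_joinPos.trans inl_mem_inFirst.symm,
      inFirst_eq_map]
    exact subword_map Function.Embedding.inl (concat τ σ) B j
  have h2 : ∀ j, subword (concat τ σ) (joinPos τ σ B B') (Sum.inr j) = subword σ B' j := fun j => by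
    rw [subword_congr (C := inSecond τ σ B') fun i => inr_mem_joinPos.trans inr_mem_inSecond.symm,
      inSecond_eq_map]
    exact subword_map Function.Embedding.inr (concat τ σ) B' j
  simp only [h1, h2]

lemma integral_blockVar_eq {ι : Type*} [Fintype ι] [DecidableEq ι] (τ : ι → Word d)
    (B : Finset (Pos τ)) : ∫ x, blockVar hT τ B x ∂ν =
      partMoment (blockCumulant ν (signature hT) τ) B :=
  blockMoment_eq_partMoment ν (signature hT) τ B

lemma prod_univ_erase_coe {α : Type*} [DecidableEq α] (s : Finset α) (b : s) (m : α → ℝ) :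
    ∏ c ∈ Finset.univ.erase b, m c.1 = ∏ c ∈ s.erase b.1, m c := by
  refine Finset.prod_bij (fun c _ => c.1) ?_ ?_ ?_ ?_
  · intro c hc
    exact Finset.mem_erase.2 ⟨fun h => (Finset.mem_erase.1 hc).1 (Subtype.ext h), c.2⟩
  · intro c _ c' _ h
    exact Subtype.ext h
  · intro c hc
    rw [Finset.mem_erase] at hc
    exact ⟨⟨c, hc.2⟩, Finset.mem_erase.2 ⟨fun h => hc.1 (congrArg Subtype.val h),
      Finset.mem_univ _⟩, rfl⟩
  · intro c _
    rfl

/-- The covariance of the influence functions of two signature polykays. -/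
theorem HasSigMoments.integral_polykayInfluence_mul (hν : HasSigMoments hT ν) {k l : ℕ}
    (τ : Fin k → Word d) (σ : Fin l → Word d) :
    ∫ z, polykayInfluence hT ν τ z * polykayInfluence hT ν σ z ∂ν =
      asymCov ν (signature hT) τ σ := by
  classical
  have hint : ∀ (a : SetPart (Pos τ)) (b : SetPart (Pos σ)), Integrable (fun z =>
      orpCoeff a * hajek ν (fun B : a.parts => blockVar hT τ B.1) z *
        (orpCoeff b * hajek ν (fun B : b.parts => blockVar hT σ B.1) z)) ν := fun a b =>
    (((allLp_hajek (hν.allLp_blockVar_parts τ a)).const_mul _).mul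
      ((allLp_hajek (hν.allLp_blockVar_parts σ b)).const_mul _)).integrable
  simp only [polykayInfluence, Finset.sum_mul_sum]
  rw [integral_finsetSum _ fun a _ => integrable_finsetSum _ fun b _ => hint a b, asymCov_eq]
  refine Finset.sum_congr rfl fun a _ => ?_
  rw [integral_finsetSum _ fun b _ => hint a b]
  refine Finset.sum_congr rfl fun b _ => ?_
  have hre : ∀ z, orpCoeff a * hajek ν (fun B : a.parts => blockVar hT τ B.1) z *
      (orpCoeff b * hajek ν (fun B : b.parts => blockVar hT σ B.1) z) = orpCoeff a * orpCoeff b *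
      (hajek ν (fun B : a.parts => blockVar hT τ B.1) z *
        hajek ν (fun B : b.parts => blockVar hT σ B.1) z) := fun z => by ring
  simp only [hre]
  rw [integral_const_mul, integral_hajek_mul_hajek (hν.allLp_blockVar_parts τ a)
    (hν.allLp_blockVar_parts σ b)]
  congr 1
  -- Mixed and single moments alike become sums over partitions, as in `asymCov_eq`; what remains is
  -- to pass from sums over subtypes to sums over blocks.
  simp only [← blockVar_joinPos, integral_blockVar_eq]
  rw [← Finset.sum_coe_sort a.parts]
  refine Finset.sum_congr rfl fun B _ => ?_
  rw [← Finset.sum_coe_sort b.parts]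
  refine Finset.sum_congr rfl fun B' _ => ?_
  rw [prod_univ_erase_coe a.parts B, prod_univ_erase_coe b.parts B']

end Influence

end SigPolykay

/-! ### Assembly of the four statements. -/

theorem proposition4p2 {d : ℕ} {p T : ℝ} (hp : 1 ≤ p) (hT : 0 < T)
    [MeasurableSpace (RoughPath d p T)]
    (hmeas : ∀ w : Word d, Measurable fun x : RoughPath d p T => signature hT x w)
    {Ω : Type*} [MeasurableSpace Ω] (P : Measure Ω) [IsProbabilityMeasure P]
    (X : ℕ → Ω → RoughPath d p T) (ν : Measure (RoughPath d p T))
    (hlaw : ∀ i, HasLaw (X i) ν P) (hindep : iIndepFun X P)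
    (hmom : HasSigMoments hT ν) :
    (∀ (k : ℕ) (τ : Fin k → Word d),
      -- unbiasedness
      (∀ n : ℕ, ∑ j, (τ j).length ≤ n →
        Integrable (estimator hT X (polykay n τ)) P ∧
        ∫ ω, estimator hT X (polykay n τ) ω ∂P = estimand hT τ ν) ∧
      -- minimum variance among unbiased polynomial estimators
      (∀ n : ℕ, ∑ j, (τ j).length ≤ n →
        IsUnbiasedPolyEstimator (p := p) hT n (estimand hT τ) (polykay n τ) ∧
        ∀ g : MvPolynomial (Fin n × Word d) ℝ,
          IsUnbiasedPolyEstimator (p := p) hT n (estimand hT τ) g →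
          MemLp (estimator hT X (polykay n τ)) 2 P ∧ MemLp (estimator hT X g) 2 P ∧
          variance (estimator hT X (polykay n τ)) P ≤ variance (estimator hT X g) P) ∧
      -- almost sure convergence
      (∀ᵐ ω ∂P, Tendsto (fun n => estimator hT X (polykay n τ) ω) atTop (𝓝 (estimand hT τ ν))) ∧
      -- convergence in `L^q` for all finite `q`
      (∀ q : ENNReal, 1 ≤ q → q ≠ ⊤ →
        (∀ n, MemLp (estimator hT X (polykay n τ)) q P) ∧
        Tendsto (fun n => eLpNorm (fun ω => estimator hT X (polykay n τ) ω - estimand hT τ ν) q P)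
          atTop (𝓝 0))) ∧
    -- joint asymptotic normality
    (∀ (m : ℕ) (k : Fin m → ℕ) (τ : ∀ s, Fin (k s) → Word d),
      (Matrix.of fun s t => asymCov ν (signature hT) (τ s) (τ t)).PosSemidef ∧
      TendstoInDistribution
        (fun (n : ℕ) (ω : Ω) => WithLp.toLp 2 fun s : Fin m =>
          Real.sqrt n * (estimator hT X (polykay n (τ s)) ω - estimand hT (τ s) ν))
        atTop (id : EuclideanSpace ℝ (Fin m) → EuclideanSpace ℝ (Fin m)) (fun _ => P)
        (multivariateGaussian 0
          (Matrix.of fun s t => asymCov ν (signature hT) (τ s) (τ t)))) := by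
  have : IsProbabilityMeasure ν := (hlaw 0).isProbabilityMeasure_iff.1 inferInstance
  have hlim : ∀ (k : ℕ) (τ : Fin k → Word d), TendstoAllLp (fun n => estimator hT X (polykay n τ))
      (estimand hT τ ν) P := fun k τ => hmom.tendstoAllLp_polykay hlaw hindep τ
  have hLp : ∀ (n : ℕ) (g : MvPolynomial (Fin n × Word d) ℝ), AllLp (estimator hT X g) P :=
    fun n g => hmom.allLp_evalSample (x := fun i : Fin n => X i) (fun i => hlaw i) g
  refine ⟨fun k τ => ⟨fun n hn => ⟨(hLp n _).integrable, ?_⟩, fun n hn => ⟨?_, fun g hg => ?_⟩,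
    (hlim k τ).ae, fun q hq hq' => ⟨fun n => hLp n _ q hq', (hlim k τ).eLpNorm q hq hq'⟩⟩,
    fun m k τ => ?_⟩
  · exact hmom.integral_polykay (x := fun i : Fin n => X i) (fun i => hlaw i)
      (hindep.precomp Fin.val_injective) τ hn
  · exact isUnbiasedPolyEstimator_polykay τ hn
  · exact ⟨hLp n _ 2 (by simp), hLp n _ 2 (by simp),
      variance_polykay_le hn hmeas hg hmom hlaw hindep⟩
  · have h := tendstoInDistribution_of_expansion (θ := fun s => estimand hT (τ s) ν)
      (F := fun s n => estimator hT X (polykay n (τ s))) hlaw hindep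
      (fun s => hmom.allLp_polykayInfluence (τ s)) (fun s => hmom.integral_polykayInfluence (τ s))
      (fun s n => hLp n _) (fun s => hmom.tendstoZeroL1_polykay hlaw hindep (τ s))
    -- The limit theorem supplies the covariance of the influence functions, which is `asymCov`.
    simp only [hmom.integral_polykayInfluence_mul] at h
    exact h
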